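/- Let $\kappa\in\{1,-1\}$, and let $\mathbb{M}^2$ be the unit sphere $\mathbb{S}^2$ if $\kappa=1$ and the hyperbolic plane $\mathbb{H}^2$ of curvature $-1$ if $\kappa=-1$, realized as $\mathbb{M}^2=\{x\in\mathbb{R}^3_\kappa:\ x_1^2+x_2^2+\kappa x_3^2=\kappa\}$, with $x_3>0$ if $\kappa=-1$, where $\mathbb{R}^3_\kappa$ is $\mathbb{R}^3$ with the scalar product of signature $(+,+,\kappa)$. Endow $\mathbb{M}^2\times\mathbb{R}$ with the product metric, and let $\partial_z$ be the unit vertical field. Let $H\in C^1([-1,1])$ satisfy $H(-y)=H(y)$ for all $y\in[-1,1]$ and, if $\kappa=-1$, also $2|H(y)|>\sqrt{1-y^2}$ for all $y\in[-1,1]$. Then there is a rotational, embedded $H$-sphere in $\mathbb{M}^2\times\mathbb{R}$. That is, there is an embedded $C^2$ surface $S\subset\mathbb{M}^2\times\mathbb{R}$, homeomorphic to the $2$-sphere and invariant under all rotations about the vertical axis $\{(0,0,1)\}\times\mathbb{R}$, with a continuous unit normal field $\eta$ such that the mean curvature of $S$ with respect to $\eta$ (half the trace of the second fundamental form $\langle\nabla_X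 Y,\eta\rangle$) satisfies $$H_S(p)=H(\langle\eta_p,\partial_z\rangle)\qquad\text{for all } p\in S.$$ -/

import Mathlib

noncomputable section

namespace ProductSurface

/-- The linear space containing the product `𝕄² × ℝ`: the first factor is `ℝ³_κ`
(Euclidean space for `κ = 1`, Lorentz-Minkowski space for `κ = -1`), the second the height. -/
abbrev Ambient : Type := (Fin 3 → ℝ) × ℝ

/-- The scalar product of `ℝ³_κ`, of signature `(+, +, κ)`. -/
def baseForm (κ : ℝ) (u v : Fin 3 → ℝ) : ℝ :=
  u 0 * v 0 + u 1 * v 1 + κ * (u 2 * v 2)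

/-- The scalar product of `ℝ³_κ × ℝ`. On vectors tangent to `𝕄² × ℝ` it is the product metric. -/
def ambientForm (κ : ℝ) (u v : Ambient) : ℝ :=
  baseForm κ u.1 v.1 + u.2 * v.2

/-- The base surface: the unit sphere `𝕊²` for `κ = 1`, and the upper sheet of the hyperboloid
`x₁² + x₂² - x₃² = -1`, i.e. the hyperbolic plane `ℍ²`, for `κ = -1`. -/
def baseSurface (κ : ℝ) : Set (Fin 3 → ℝ) :=
  {x | baseForm κ x x = 1 / κ ∧ 0 ≤ (1 - κ) * x 2}

/-- The Riemannian product `𝕄² × ℝ`. -/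
def productSpace (κ : ℝ) : Set Ambient :=
  baseSurface κ ×ˢ Set.univ

/-- `v` is tangent to `𝕄² × ℝ` at `p`: the normal direction of the quadric `𝕄²` in `ℝ³_κ` at
a point is the position vector. -/
def IsTangent (κ : ℝ) (p v : Ambient) : Prop :=
  baseForm κ p.1 v.1 = 0

/-- The vertical unit Killing field `∂_z`. -/
def vertical : Ambient := (0, 1)

/-- The rotation of angle `θ` about the vertical axis `{(0, 0, 1)} × ℝ`. -/
def rotation (θ : ℝ) (p : Ambient) : Ambient :=
  (![Real.cos θ * p.1 0 - Real.sin θ * p.1 1, Real.sin θ * p.1 0 + Real.cos θ * p.1 1, p.1 2], p.2)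

/-- A `C²` local parametrization of the subset `S`: an injective immersion of an open subset `U`
of the plane which is a homeomorphism onto a relatively open subset of `S`. -/
structure IsLocalParam (S : Set Ambient) (U : Set (ℝ × ℝ)) (φ : ℝ × ℝ → Ambient) : Prop where
  isOpen : IsOpen U
  contDiffOn : ContDiffOn ℝ 2 φ U
  immersion : ∀ q ∈ U, Function.Injective (fderiv ℝ φ q)
  injOn : Set.InjOn φ U
  /-- images of open sets are relatively open in `S` -/
  image_open : ∀ W ⊆ U, IsOpen W → ∃ V : Set Ambient, IsOpen V ∧ φ '' W = S ∩ V

/-- First fundamental form of the parametrization `φ` at `q`. -/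
def firstForm (κ : ℝ) (φ : ℝ × ℝ → Ambient) (q v w : ℝ × ℝ) : ℝ :=
  ambientForm κ (fderiv ℝ φ q v) (fderiv ℝ φ q w)

/-- Second fundamental form `⟨∇_v w, n⟩` at `q`, for the unit normal `n` at `φ q`. Since `n` is
tangent to `𝕄² × ℝ`, the flat derivative and the Levi-Civita derivative of `𝕄² × ℝ` have the same
scalar product with `n`. -/
def secondForm (κ : ℝ) (φ : ℝ × ℝ → Ambient) (n : Ambient) (q v w : ℝ × ℝ) : ℝ :=
  ambientForm κ (fderiv ℝ (fderiv ℝ φ) q v w) n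

/-- Mean curvature at `q`, with respect to the unit normal `n` at `φ q`: half the trace of the
second fundamental form with respect to the first, `(e G - 2 f F + g E) / (2 (E G - F²))`. -/
def meanCurvature (κ : ℝ) (φ : ℝ × ℝ → Ambient) (n : Ambient) (q : ℝ × ℝ) : ℝ :=
  (secondForm κ φ n q (1, 0) (1, 0) * firstForm κ φ q (0, 1) (0, 1)
      - 2 * secondForm κ φ n q (1, 0) (0, 1) * firstForm κ φ q (1, 0) (0, 1)
      + secondForm κ φ n q (0, 1) (0, 1) * firstForm κ φ q (1, 0) (1, 0))
    / (2 * (firstForm κ φ q (1, 0) (1, 0) * firstForm κ φ q (0, 1) (0, 1)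
      - firstForm κ φ q (1, 0) (0, 1) ^ 2))

/-- `S` is an embedded `C²` surface in `𝕄² × ℝ`, oriented by the continuous unit normal field `η`
and of prescribed mean curvature `H`: its mean curvature at `p` is `H (⟨η p, ∂_z⟩)`. As the
tangent plane and the mean curvature do not depend on the local parametrization, it is enough
to compute them in one parametrization around each point. -/
structure IsEmbeddedHSurface (κ : ℝ) (H : ℝ → ℝ) (S : Set Ambient) (η : Ambient → Ambient) :
    Prop where
  subset : S ⊆ productSpace κ
  normal_continuous : ContinuousOn η S
  normal_tangent : ∀ p ∈ S, IsTangent κ p (η p)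
  normal_unit : ∀ p ∈ S, ambientForm κ (η p) (η p) = 1
  local_param : ∀ p ∈ S, ∃ (U : Set (ℝ × ℝ)) (φ : ℝ × ℝ → Ambient) (q : ℝ × ℝ),
    IsLocalParam S U φ ∧ q ∈ U ∧ φ q = p ∧
    (∀ v, ambientForm κ (fderiv ℝ φ q v) (η p) = 0) ∧
    meanCurvature κ φ (η p) q = H (ambientForm κ (η p) vertical)

/-- `S` is rotational: invariant under all rotations about the axis `{(0, 0, 1)} × ℝ`. -/
def IsRotational (S : Set Ambient) : Prop :=
  ∀ θ : ℝ, rotation θ '' S = S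

/-- `S` is a topological sphere (for a surface: closed and of genus zero). -/
def IsSphere (S : Set Ambient) : Prop :=
  Nonempty (S ≃ₜ Metric.sphere (0 : EuclideanSpace ℝ (Fin 3)) 1)

/-- The class of prescribed functions: `C¹` and even on `[-1, 1]` and, if `κ = -1`, with
`2 |H y| > √(1 - y²)` on `[-1, 1]`. -/
structure IsAdmissible (κ : ℝ) (H : ℝ → ℝ) : Prop where
  contDiffOn : ContDiffOn ℝ 1 H (Set.Icc (-1) 1)
  even : ∀ y ∈ Set.Icc (-1 : ℝ) 1, H (-y) = H y
  bound : κ = -1 → ∀ y ∈ Set.Icc (-1 : ℝ) 1, Real.sqrt (1 - y ^ 2) < 2 * |H y|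

end ProductSurface

end

section

open Set Filter Topology MeasureTheory

/-! Use the coordinate ξ = κ(1 − x₃), which vanishes on the axis, so that x₁² + x₂² = σ(ξ) = 2ξ −
κξ² (`radiusSq`). Let φ be the slope angle of the profile curve of a rotational graph and put u = √σ
sin φ. The prescribed curvature equation then has first order: u' = 2H(ν) with u(0) = 0, where ν =
cos φ = √(1 − u²/σ) is the angle function. It is singular on the axis and not Lipschitz where the
profile becomes vertical, so only existence is used (`exists_integral_solution`), never uniqueness.

Assume H(1) > 0. The profile must become vertical, that is, u² must reach σ. On the sphere, σ
returns to 0 at the antipodal axis while u keeps a positive lower bound long enough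
(`exists_vertical_point_sphere`). In the hyperbolic plane, the gap 2H(ν) > √(1 − ν²) makes u/(1 + ξ)
grow at least logarithmically, while √σ < 1 + ξ (`exists_vertical_point_hyperbolic`).

The crucial point is that σ − u² has negative derivative at the first vertical point ξ₁
(`profile_transversal`). Evenness of H enters here through H'(0) = 0. Hence the squared reciprocal
slope Γ = (dξ/dz)² of the profile has a simple zero at ξ₁, the height is finite there, and the
inverse Ξ of the height satisfies Ξ'² = Γ(Ξ) and Ξ'' = Γ'(Ξ)/2. Reflection in the horizontal plane
of the equator therefore glues two caps in a C² way (`exists_reflected_inverse`). The reflection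
replaces ν by −ν, and evenness of H keeps the prescribed value.

Near the axis the surface is a graph F(x² + y²) in suitable coordinates; it is C² because F' is
continuous and ξF''(ξ) tends to 0 (`contDiffOn_radial`). The curvature is computed on one meridian,
in `hasLocalParam_capChart` away from the equator and in `hasLocalParam_bandChart` on it; rotations
and the reflection carry it to the other points. If H(1) < 0, the normal is reversed and H is
replaced by −H. If H(1) = 0, then κ = 1, and the totally geodesic slice is the required sphere. -/

/-! ### Peano–Carathéodory existence for bounded scalar equations -/

theorem lipschitz_primitive {C : ℝ} {w : ℝ → ℝ} (hw : Measurable w) (hb : ∀ x, |w x| ≤ C)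
    (x y : ℝ) : |(∫ t in (0 : ℝ)..x, w t) - ∫ t in (0 : ℝ)..y, w t| ≤ C * |x - y| := by
  have hi : ∀ a b : ℝ, IntervalIntegrable w volume a b := fun a b => by
    refine (intervalIntegrable_const (c := C)).mono_fun hw.aestronglyMeasurable ?_
    filter_upwards with t
    simpa using (hb t).trans (le_abs_self C)
  rw [intervalIntegral.integral_interval_sub_left (hi _ _) (hi _ _)]
  have := intervalIntegral.norm_integral_le_of_norm_le_const (a := y) (b := x) (f := w) (C := C)
    (fun t _ => by simpa using hb t)
  simpa using this

/-- The delayed integral operator of the equation `u' = f x u`. -/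
noncomputable def delayedPicard (f : ℝ → ℝ → ℝ) (δ : ℝ) (u : ℝ → ℝ) (ξ : ℝ) : ℝ :=
  ∫ x in (0 : ℝ)..ξ, f x (u (max (x - δ) 0))

/-- Tonelli's scheme: with a delay δ the equation is solved by integrating over successive intervals
of length δ. The Lipschitz constant does not depend on δ, which gives the compactness needed to let
δ tend to 0. -/
theorem exists_delayed_solution {f : ℝ → ℝ → ℝ} {C R δ : ℝ}
    (hf : Measurable (Function.uncurry f)) (hC : ∀ x y, |f x y| ≤ C) (hδ : 0 < δ) :
    ∃ u : ℝ → ℝ, (∀ x y, |u x - u y| ≤ C * |x - y|) ∧ u 0 = 0 ∧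
      ∀ ξ ∈ Icc 0 R, u ξ = ∫ x in (0 : ℝ)..ξ, f x (u (max (x - δ) 0)) := by
  have hC0 : 0 ≤ C := (abs_nonneg _).trans (hC 0 0)
  let v : ℕ → ℝ → ℝ := fun k => (delayedPicard f δ)^[k] 0
  have hv : ∀ k, v (k + 1) = delayedPicard f δ (v k) := fun k =>
    Function.iterate_succ_apply' _ _ _
  have hL : ∀ k x y, |v k x - v k y| ≤ C * |x - y| := by
    intro k
    induction k with
    | zero => intro x y; simpa [v] using mul_nonneg hC0 (abs_nonneg _)
    | succ k ih =>
      intro x y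
      have hm : Measurable (v k) := by
        have : LipschitzWith ⟨C, hC0⟩ (v k) :=
          LipschitzWith.of_dist_le_mul fun x y => ih x y
        exact this.continuous.measurable
      rw [hv]
      exact lipschitz_primitive (w := fun x => f x (v k (max (x - δ) 0)))
        (hf.comp (measurable_id.prodMk
          (hm.comp ((measurable_id.sub_const δ).max measurable_const))))
        (fun x => hC _ _) x y
  have h0 : ∀ k, v k 0 = 0 := by
    intro k
    cases k with
    | zero => simp [v]
    | succ k => rw [hv]; simp [delayedPicard]
  -- On [0, (k+1)δ] the operator reads its argument only on [0, kδ], so each iteration fixes the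
  -- solution on one more interval.
  have hstab : ∀ k : ℕ, ∀ ξ ∈ Icc (0 : ℝ) (k * δ), v (k + 1) ξ = v k ξ := by
    intro k
    induction k with
    | zero =>
      intro ξ hξ
      have : ξ = 0 := by simpa [le_antisymm_iff, and_comm] using hξ
      rw [this, h0, h0]
    | succ k ih =>
      intro ξ hξ
      rw [hv (k + 1), hv k]
      refine intervalIntegral.integral_congr fun x hx => ?_
      rw [uIcc_of_le hξ.1] at hx
      have : max (x - δ) 0 ∈ Icc (0 : ℝ) (k * δ) := by
        refine ⟨le_max_right _ _, max_le ?_ (by positivity)⟩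
        have := hξ.2
        push_cast at this
        linarith [hx.2]
      simp only [← hv k, ih _ this]
  obtain ⟨N, hN⟩ := exists_nat_ge (R / δ)
  refine ⟨v N, hL N, h0 N, fun ξ hξ => ?_⟩
  have := hstab N ξ ⟨hξ.1, hξ.2.trans ((div_le_iff₀ hδ).1 hN)⟩
  rw [← this, hv]
  rfl

/-- Existence of Caratheodory solutions of `u' = f x u`, `u 0 = 0`, for bounded `f`. -/
theorem exists_integral_solution {f : ℝ → ℝ → ℝ} {C R : ℝ} (hR : 0 ≤ R)
    (hf : Measurable (Function.uncurry f)) (hC : ∀ x y, |f x y| ≤ C)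
    (hc : ∀ x ∈ Ioc 0 R, Continuous (f x)) :
    ∃ u : ℝ → ℝ, Continuous u ∧ (∀ x ∈ Icc 0 R, ∀ y ∈ Icc 0 R, |u x - u y| ≤ C * |x - y|) ∧
      ∀ ξ ∈ Icc 0 R, u ξ = ∫ x in (0 : ℝ)..ξ, f x (u x) := by
  have hC0 : 0 ≤ C := (abs_nonneg _).trans (hC 0 0)
  have hδ : ∀ n : ℕ, (0 : ℝ) < 1 / ((n : ℝ) + 1) := fun n => by positivity
  choose v hvL hv0 hv using fun n : ℕ => exists_delayed_solution (R := R) hf hC (hδ n)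
  have hvc : ∀ n, Continuous (v n) := fun n =>
    (LipschitzWith.of_dist_le_mul (K := ⟨C, hC0⟩) fun x y => hvL n x y).continuous
  let A : Set (BoundedContinuousFunction (Icc (0 : ℝ) R) ℝ) :=
    {w | (∀ x y, |w x - w y| ≤ C * |(x : ℝ) - y|) ∧ ∀ x, |w x| ≤ C * x}
  have hev : ∀ x : Icc (0 : ℝ) R,
      Continuous fun w : BoundedContinuousFunction (Icc (0 : ℝ) R) ℝ => w x := fun x =>
    continuous_eval_const x
  have hclosed : IsClosed A := by
    have e : A = (⋂ x : Icc (0 : ℝ) R, ⋂ y : Icc (0 : ℝ) R,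
        {w : BoundedContinuousFunction (Icc (0 : ℝ) R) ℝ | |w x - w y| ≤ C * |(x : ℝ) - y|}) ∩
        ⋂ x : Icc (0 : ℝ) R, {w : BoundedContinuousFunction (Icc (0 : ℝ) R) ℝ | |w x| ≤ C * x} := by
      ext w; simp only [A, mem_ofPred_eq, mem_inter_iff, mem_iInter]
    rw [e]
    refine IsClosed.inter (isClosed_iInter fun x => isClosed_iInter fun y => ?_)
      (isClosed_iInter fun x => ?_)
    · exact isClosed_le ((hev x).sub (hev y)).abs continuous_const
    · exact isClosed_le (hev x).abs continuous_const
  have hcomp : IsCompact A := by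
    refine BoundedContinuousFunction.arzela_ascoli₂ (Icc (-(C * R)) (C * R)) isCompact_Icc A hclosed
      (fun w x hw => abs_le.1 ((hw.2 x).trans (mul_le_mul_of_nonneg_left x.2.2 hC0))) ?_
    refine (LipschitzWith.uniformEquicontinuous _ ⟨C, hC0⟩ fun w => ?_).equicontinuous
    exact LipschitzWith.of_dist_le_mul fun x y => w.2.1 x y
  let V : ℕ → BoundedContinuousFunction (Icc (0 : ℝ) R) ℝ := fun n =>
    BoundedContinuousFunction.mkOfCompact ⟨fun x => v n x, (hvc n).comp continuous_subtype_val⟩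
  have hVA : ∀ n, V n ∈ A := fun n => ⟨fun x y => hvL n x y, fun x => by
    have := hvL n x 0
    rwa [hv0, sub_zero, sub_zero, abs_of_nonneg x.2.1] at this⟩
  obtain ⟨w, hwA, ns, hns, hlim⟩ := hcomp.tendsto_subseq hVA
  let u : ℝ → ℝ := IccExtend hR w
  have hu : ∀ x (hx : x ∈ Icc 0 R), u x = w ⟨x, hx⟩ := fun x hx => IccExtend_of_mem hR w hx
  have huc : Continuous u := w.continuous.Icc_extend'
  have hlim' : ∀ x ∈ Icc (0 : ℝ) R, Tendsto (fun n => v (ns n) x) atTop (𝓝 (u x)) := by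
    intro x hx
    rw [hu x hx]
    exact ((hev ⟨x, hx⟩).tendsto w).comp hlim
  refine ⟨u, huc, fun x hx y hy => ?_, fun ξ hξ => ?_⟩
  · rw [hu x hx, hu y hy]; exact hwA.1 ⟨x, hx⟩ ⟨y, hy⟩
  -- The common Lipschitz bound makes the effect of the vanishing delay disappear in the limit.
  have hshift : ∀ x ∈ Ioc (0 : ℝ) R,
      Tendsto (fun n => v (ns n) (max (x - 1 / ((ns n : ℝ) + 1)) 0)) atTop (𝓝 (u x)) := by
    intro x hx
    have h1 := hlim' x ⟨hx.1.le, hx.2⟩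
    have h2 : Tendsto (fun n => C * |max (x - 1 / ((ns n : ℝ) + 1)) 0 - x|) atTop (𝓝 0) := by
      have h3 : Tendsto (fun n => 1 / ((ns n : ℝ) + 1)) atTop (𝓝 0) :=
        (tendsto_one_div_add_atTop_nhds_zero_nat (𝕜 := ℝ)).comp hns.tendsto_atTop
      have h4 := ((((tendsto_const_nhds (x := x)).sub h3).max
        (tendsto_const_nhds (x := (0 : ℝ)))).sub_const x).abs.const_mul C
      simpa [max_eq_left hx.1.le] using h4
    have h5 : Tendsto (fun n => v (ns n) (max (x - 1 / ((ns n : ℝ) + 1)) 0) - v (ns n) x) atTop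
        (𝓝 0) := squeeze_zero_norm (fun n => by simpa using hvL (ns n) _ _) h2
    simpa using h5.add h1
  have hInt : Tendsto (fun n => ∫ x in (0 : ℝ)..ξ, f x (v (ns n) (max (x - 1 / ((ns n : ℝ) + 1)) 0)))
      atTop (𝓝 (∫ x in (0 : ℝ)..ξ, f x (u x))) := by
    refine intervalIntegral.tendsto_integral_filter_of_dominated_convergence (fun _ => C) ?_ ?_
      intervalIntegrable_const ?_
    · filter_upwards with n
      exact (hf.comp (measurable_id.prodMk ((hvc _).measurable.comp
        ((measurable_id.sub_const _).max measurable_const)))).aestronglyMeasurable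
    · filter_upwards with n
      filter_upwards with x _
      simpa using hC _ _
    · filter_upwards with x hx
      rw [uIoc_of_le hξ.1] at hx
      have hx' : x ∈ Ioc 0 R := ⟨hx.1, hx.2.trans hξ.2⟩
      exact ((hc x hx').tendsto _).comp (hshift x hx')
  refine tendsto_nhds_unique (hlim' ξ hξ) (hInt.congr fun n => ?_)
  exact (hv (ns n) ξ hξ).symm

/-! ### The profile equation and its solution near the axis -/

/-- The square of the Euclidean distance to the axis of the point of the base surface at
height `1 - κ ξ`. -/
def radiusSq (κ ξ : ℝ) : ℝ := 2 * ξ - κ * ξ ^ 2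

theorem hasDerivAt_radiusSq (κ ξ : ℝ) : HasDerivAt (radiusSq κ) (2 * (1 - κ * ξ)) ξ := by
  have := ((hasDerivAt_id ξ).const_mul 2).fun_sub (((hasDerivAt_id ξ).fun_pow 2).const_mul κ)
  refine this.congr_deriv ?_
  simp only [id]; push_cast; ring

theorem continuous_radiusSq (κ : ℝ) : Continuous (radiusSq κ) := by
  unfold radiusSq; fun_prop

/-- `u = s sin φ` (with `s` the radius and `φ` the slope angle of the profile curve) solves the
equation of a rotational surface whose mean curvature is `K` of the angle function. -/
structure IsProfileSolution (κ R M : ℝ) (K u : ℝ → ℝ) : Prop where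
  continuous : Continuous u
  zero : u 0 = 0
  lipschitz : ∀ x ∈ Icc 0 R, ∀ y ∈ Icc 0 R, |u x - u y| ≤ 2 * M * |x - y|
  hasDerivAt : ∀ ξ ∈ Ioo 0 R, HasDerivAt u (2 * K √(1 - u ξ ^ 2 / radiusSq κ ξ)) ξ
  hasDerivWithinAt_zero : HasDerivWithinAt u (2 * K 1) (Ici 0) 0

/-- The right-hand side is not jointly continuous at the axis, but it is bounded, so an integral
solution exists. That solution is O(ξ) while σ is comparable to ξ; hence u²/σ tends to 0, the angle
function tends to 1, and the one-sided derivative at 0 is recovered from the limit of the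
derivatives. -/
theorem exists_profile_solution {κ R M : ℝ} {K : ℝ → ℝ} (hR : 0 < R) (hK : Continuous K)
    (hM : ∀ x, |K x| ≤ M) (hσ : ∀ ξ ∈ Ioc 0 R, 0 < radiusSq κ ξ) :
    ∃ u : ℝ → ℝ, IsProfileSolution κ R M K u := by
  -- Where y² exceeds σ the real square root is 0, so the equation makes sense for every y and the
  -- solution can be continued past a vertical point.
  obtain ⟨u, huc, huL, hu⟩ := exists_integral_solution (C := 2 * M) hR.le
    (f := fun ξ y => 2 * K √(1 - y ^ 2 / radiusSq κ ξ)) (by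
      refine (hK.measurable.comp (Measurable.sqrt ?_)).const_mul 2
      exact measurable_const.sub ((measurable_snd.pow_const 2).div
        ((continuous_radiusSq κ).measurable.comp measurable_fst)))
    (fun x y => by rw [abs_mul, abs_two]; linarith [hM √(1 - y ^ 2 / radiusSq κ x)])
    (fun x _ => by fun_prop)
  have hu0 : u 0 = 0 := by rw [hu 0 ⟨le_rfl, hR.le⟩]; simp
  have hcont : ∀ ξ ∈ Ioo 0 R,
      ContinuousAt (fun ξ => 2 * K √(1 - u ξ ^ 2 / radiusSq κ ξ)) ξ := fun ξ hξ => by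
    have h1 := hσ ξ ⟨hξ.1, hξ.2.le⟩
    have h2 : ContinuousAt (fun ξ => u ξ ^ 2 / radiusSq κ ξ) ξ :=
      (huc.continuousAt.pow 2).div (continuous_radiusSq κ).continuousAt h1.ne'
    exact (hK.continuousAt.comp
      (Real.continuous_sqrt.continuousAt.comp (continuousAt_const.sub h2))).const_mul 2
  have hmeas : Measurable (fun ξ => 2 * K √(1 - u ξ ^ 2 / radiusSq κ ξ)) := by
    refine (hK.measurable.comp (Measurable.sqrt ?_)).const_mul 2
    exact measurable_const.sub ((huc.measurable.pow_const 2).div (continuous_radiusSq κ).measurable)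
  have hii : ∀ a b, IntervalIntegrable (fun ξ => 2 * K √(1 - u ξ ^ 2 / radiusSq κ ξ)) volume a b :=
    fun a b => by
      refine (intervalIntegrable_const (c := 2 * M)).mono_fun hmeas.aestronglyMeasurable ?_
      filter_upwards with t
      rw [Real.norm_eq_abs, Real.norm_eq_abs, abs_mul, abs_two]
      exact (mul_le_mul_of_nonneg_left (hM _) two_pos.le).trans (le_abs_self _)
  have hder : ∀ ξ ∈ Ioo 0 R, HasDerivAt u (2 * K √(1 - u ξ ^ 2 / radiusSq κ ξ)) ξ := by
    intro ξ hξ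
    have := intervalIntegral.integral_hasDerivAt_right (hii 0 ξ)
      hmeas.stronglyMeasurable.stronglyMeasurableAtFilter (hcont ξ hξ)
    refine this.congr_of_eventuallyEq ?_
    filter_upwards [Ioo_mem_nhds hξ.1 hξ.2] with x hx
    exact hu x ⟨hx.1.le, hx.2.le⟩
  refine ⟨u, huc, hu0, huL, hder, ?_⟩
  have hmem : Ioo 0 R ∈ 𝓝[>] (0 : ℝ) := Ioo_mem_nhdsGT hR
  refine hasDerivWithinAt_Ici_of_tendsto_deriv (s := Ioo 0 R)
    (fun x hx => (hder x hx).differentiableAt.differentiableWithinAt)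
    huc.continuousWithinAt hmem ?_
  have hsmall : Tendsto (fun ξ => u ξ ^ 2 / radiusSq κ ξ) (𝓝[>] 0) (𝓝 0) := by
    have h1 : Tendsto (fun ξ : ℝ => (2 * M) ^ 2 * ξ / (2 - κ * ξ)) (𝓝[>] 0) (𝓝 0) := by
      have : ContinuousAt (fun ξ : ℝ => (2 * M) ^ 2 * ξ / (2 - κ * ξ)) 0 :=
        ContinuousAt.div (by fun_prop) (by fun_prop) (by norm_num)
      simpa using this.tendsto.mono_left nhdsWithin_le_nhds
    refine squeeze_zero' ?_ ?_ h1
    · filter_upwards [hmem] with ξ hξ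
      exact div_nonneg (sq_nonneg _) (hσ ξ ⟨hξ.1, hξ.2.le⟩).le
    · filter_upwards [hmem] with ξ hξ
      have h2 := hσ ξ ⟨hξ.1, hξ.2.le⟩
      have h3 : radiusSq κ ξ = ξ * (2 - κ * ξ) := by unfold radiusSq; ring
      have h4 : 0 < 2 - κ * ξ := by
        rw [h3] at h2; exact pos_of_mul_pos_right h2 hξ.1.le
      have h5 := huL ξ ⟨hξ.1.le, hξ.2.le⟩ 0 ⟨le_rfl, hR.le⟩
      rw [hu0, sub_zero, sub_zero, abs_of_pos hξ.1] at h5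
      rw [h3, div_le_div_iff₀ (mul_pos hξ.1 h4) h4]
      have h6 : u ξ ^ 2 ≤ (2 * M * ξ) ^ 2 := sq_le_sq' (by linarith [abs_le.1 h5])
        (abs_le.1 h5).2
      nlinarith [mul_le_mul_of_nonneg_right h6 h4.le]
  have hlim : Tendsto (fun ξ => 2 * K √(1 - u ξ ^ 2 / radiusSq κ ξ)) (𝓝[>] 0) (𝓝 (2 * K 1)) := by
    have h1 : Continuous fun t : ℝ => 2 * K √(1 - t) := by fun_prop
    have h2 := (h1.tendsto 0).comp hsmall
    simpa [Function.comp_def] using h2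
  refine hlim.congr' ?_
  filter_upwards [hmem] with ξ hξ
  exact (hder ξ hξ).deriv.symm

/-! ### Transversality at the first vertical point -/

/-- At the first point where `u² = σ`, the function `σ - u²` has negative derivative. -/
theorem profile_transversal {κ R ξ₁ : ℝ} {K u : ℝ → ℝ} (hK : HasDerivAt K 0 0)
    (hξ₁ : ξ₁ ∈ Ioo 0 R) (hσ : ∀ ξ ∈ Ioc 0 R, 0 < radiusSq κ ξ) (huc : Continuous u)
    (hder : ∀ ξ ∈ Ioo 0 R, HasDerivAt u (2 * K √(1 - u ξ ^ 2 / radiusSq κ ξ)) ξ)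
    (hlt : ∀ ξ ∈ Ioo 0 ξ₁, u ξ ^ 2 < radiusSq κ ξ) (heq : u ξ₁ ^ 2 = radiusSq κ ξ₁) :
    1 - κ * ξ₁ < 2 * K 0 * u ξ₁ := by
  by_contra hcon
  push Not at hcon
  have hσ1 := hσ ξ₁ ⟨hξ₁.1, hξ₁.2.le⟩
  have hder1 : HasDerivAt u (2 * K 0) ξ₁ := by
    have := hder ξ₁ hξ₁
    rwa [heq, div_self hσ1.ne', sub_self, Real.sqrt_zero] at this
  set A : ℝ → ℝ := fun ξ => 1 - κ * ξ - 2 * K 0 * u ξ with hA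
  have hAder : HasDerivAt A (-κ - 2 * K 0 * (2 * K 0)) ξ₁ := by
    have := (((hasDerivAt_id ξ₁).const_mul κ).const_sub 1).fun_sub (hder1.const_mul (2 * K 0))
    simpa using this
  -- Up to the variation of K near 0, the derivative of D = σ − u² is 2A. If A(ξ₁) > 0 the bound is
  -- continuity. If A(ξ₁) = 0, the identity (1 − κξ)² + κσ = 1 gives σ(ξ₁)A'(ξ₁) = −1, so A is
  -- bounded below by a linear function to the left of ξ₁.
  have hAlow : ∃ c > 0, ∀ᶠ ξ in 𝓝[<] ξ₁, c * (ξ₁ - ξ) ≤ A ξ := by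
    rcases hcon.lt_or_eq with h | h
    · refine ⟨1, one_pos, ?_⟩
      have : ContinuousAt (fun ξ => A ξ - 1 * (ξ₁ - ξ)) ξ₁ :=
        hAder.continuousAt.sub (by fun_prop)
      have h2 : 0 < A ξ₁ - 1 * (ξ₁ - ξ₁) := by simp only [hA]; linarith
      filter_upwards [(this.eventually (lt_mem_nhds h2)).filter_mono nhdsWithin_le_nhds] with ξ hξ
      linarith
    · have h1 : -κ - 2 * K 0 * (2 * K 0) < 0 := by
        have e : radiusSq κ ξ₁ * (-κ - 2 * K 0 * (2 * K 0)) = -1 := by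
          have : (2 * K 0) ^ 2 * radiusSq κ ξ₁ = (1 - κ * ξ₁) ^ 2 := by rw [← h, ← heq]; ring
          have e2 : radiusSq κ ξ₁ * κ = 2 * κ * ξ₁ - κ ^ 2 * ξ₁ ^ 2 := by unfold radiusSq; ring
          nlinarith
        by_contra h3
        push Not at h3
        nlinarith [mul_nonneg hσ1.le h3]
      set B := -κ - 2 * K 0 * (2 * K 0) with hB
      refine ⟨-B / 2, by linarith, ?_⟩
      have h0 : A ξ₁ = 0 := by simp only [hA]; linarith
      have h4 := (hasDerivAt_iff_tendsto_slope.1 hAder).mono_left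
        (nhdsWithin_mono ξ₁ (fun x (hx : x < ξ₁) => ne_of_lt hx))
      filter_upwards [h4.eventually (gt_mem_nhds (show B < B / 2 by linarith)),
        self_mem_nhdsWithin] with ξ h5 h6
      have h6' : ξ < ξ₁ := h6
      rw [slope_def_field, h0, div_lt_iff_of_neg (by linarith)] at h5
      linarith
  obtain ⟨c, hc, hAc⟩ := hAlow
  set D : ℝ → ℝ := fun ξ => radiusSq κ ξ - u ξ ^ 2 with hD
  have hDc : Continuous D := (continuous_radiusSq κ).sub (huc.pow 2)
  have hDpos : ∀ ξ ∈ Ioo 0 ξ₁, 0 < D ξ := fun ξ hξ => sub_pos.2 (hlt ξ hξ)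
  have hDder : ∀ ξ ∈ Ioo 0 R, HasDerivAt D
      (2 * A ξ - 4 * u ξ * (K √(1 - u ξ ^ 2 / radiusSq κ ξ) - K 0)) ξ := fun ξ hξ => by
    have := (hasDerivAt_radiusSq κ ξ).fun_sub ((hder ξ hξ).fun_pow 2)
    refine this.congr_deriv ?_
    simp only [hA]; push_cast; ring
  -- The error is controlled by e√D with e² = c. Below, √D ≤ (e/2)(ξ₁ − ξ), so the error is at most
  -- (c/2)(ξ₁ − ξ), less than the main term 2c(ξ₁ − ξ).
  set e := √c with he
  have hepos : 0 < e := Real.sqrt_pos.2 hc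
  have hesq : e ^ 2 = c := Real.sq_sqrt hc.le
  -- Since K'(0) = 0, the difference K(ν) − K(0) is o(ν), and ν = √D/√σ.
  have hloc : ∀ᶠ ξ in 𝓝[<] ξ₁,
      |4 * u ξ * (K √(1 - u ξ ^ 2 / radiusSq κ ξ) - K 0)| ≤ e * √(D ξ) := by
    set e' := e / 8
    have h1 : ∀ᶠ y in 𝓝 (0 : ℝ), |K y - K 0| ≤ e' * |y| := by
      have := (hasDerivAt_iff_isLittleO.1 hK).def (show 0 < e' by positivity)
      simpa using this
    have h2 : ContinuousAt (fun ξ => √(1 - u ξ ^ 2 / radiusSq κ ξ)) ξ₁ :=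
      Real.continuous_sqrt.continuousAt.comp (continuousAt_const.sub
        ((huc.continuousAt.pow 2).div (continuous_radiusSq κ).continuousAt hσ1.ne'))
    have h3 : √(1 - u ξ₁ ^ 2 / radiusSq κ ξ₁) = 0 := by
      rw [heq, div_self hσ1.ne', sub_self, Real.sqrt_zero]
    have h4 := h2.tendsto
    rw [h3] at h4
    filter_upwards [(h4.eventually h1).filter_mono nhdsWithin_le_nhds,
      Ioo_mem_nhdsLT hξ₁.1] with ξ h5 h6
    have h7 := hσ ξ ⟨h6.1, h6.2.le.trans hξ₁.2.le⟩
    have h8 : √(1 - u ξ ^ 2 / radiusSq κ ξ) = √(D ξ) / √(radiusSq κ ξ) := by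
      rw [← Real.sqrt_div (hDpos ξ h6).le]
      congr 1
      simp only [hD]; field_simp
    rw [abs_of_nonneg (Real.sqrt_nonneg _)] at h5
    have h9 : |u ξ| ≤ √(radiusSq κ ξ) := Real.abs_le_sqrt (hlt ξ h6).le
    have h10 : 0 < √(radiusSq κ ξ) := Real.sqrt_pos.2 h7
    rw [abs_mul, abs_mul, abs_of_pos (show (0 : ℝ) < 4 by norm_num)]
    calc 4 * |u ξ| * |K √(1 - u ξ ^ 2 / radiusSq κ ξ) - K 0|
        ≤ 4 * √(radiusSq κ ξ) * (e' * (√(D ξ) / √(radiusSq κ ξ))) := by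
          rw [h8] at h5 ⊢; gcongr
      _ = e / 2 * √(D ξ) := by simp only [e']; field_simp; ring
      _ ≤ e * √(D ξ) := by gcongr; linarith
  obtain ⟨a, ha, hall⟩ := (mem_nhdsLT_iff_exists_Ioo_subset' hξ₁.1).1
    ((hAc.and hloc).and (Ioo_mem_nhdsLT hξ₁.1))
  have ha1 : a < ξ₁ := ha
  have hD1 : D ξ₁ = 0 := by simp only [hD]; linarith
  have hDlow : ∀ ξ ∈ Ioo a ξ₁, 2 * c * (ξ₁ - ξ) - e * √(D ξ) ≤
      2 * A ξ - 4 * u ξ * (K √(1 - u ξ ^ 2 / radiusSq κ ξ) - K 0) := fun ξ hξ => by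
    have := (hall hξ).1
    have h2 := (abs_le.1 this.2).2
    linarith [this.1]
  have hsub : ∀ ξ ∈ Ioo a ξ₁, ξ ∈ Ioo 0 ξ₁ := fun ξ hξ => (hall hξ).2
  -- Dropping the positive term leaves D' ≥ −e√D, that is (√D)' ≥ −e/2; integrate up to ξ₁, where D
  -- vanishes.
  have hsqrt : ∀ ξ ∈ Ioo a ξ₁, √(D ξ) ≤ e / 2 * (ξ₁ - ξ) := by
    intro ξ hξ
    have hmono : MonotoneOn (fun x => √(D x) + e / 2 * x) (Icc ξ ξ₁) := by
      refine monotoneOn_of_hasDerivWithinAt_nonneg (convex_Icc _ _) (by fun_prop)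
        (f' := fun x => (2 * A x - 4 * u x * (K √(1 - u x ^ 2 / radiusSq κ x) - K 0)) /
          (2 * √(D x)) + e / 2) ?_ ?_
      · intro x hx
        rw [interior_Icc] at hx
        have hx0 := hsub x ⟨hξ.1.trans hx.1, hx.2⟩
        have h1 := ((hDder x ⟨hx0.1, hx0.2.trans hξ₁.2⟩).sqrt (hDpos x hx0).ne').add
          ((hasDerivAt_id x).const_mul (e / 2))
        rw [mul_one] at h1
        exact h1.hasDerivWithinAt
      · intro x hx
        rw [interior_Icc] at hx
        have hx0 := hsub x ⟨hξ.1.trans hx.1, hx.2⟩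
        have h1 := hDlow x ⟨hξ.1.trans hx.1, hx.2⟩
        have h2 : 0 < √(D x) := Real.sqrt_pos.2 (hDpos x hx0)
        have h3 : 0 ≤ 2 * c * (ξ₁ - x) := by
          have := hx.2
          have : 0 ≤ ξ₁ - x := by linarith
          positivity
        have h4 : -(e / 2) ≤ (2 * A x - 4 * u x * (K √(1 - u x ^ 2 / radiusSq κ x) - K 0)) /
          (2 * √(D x)) := by
          rw [le_div_iff₀ (by positivity)]
          linarith
        linarith
    have := hmono (left_mem_Icc.2 hξ.2.le) (right_mem_Icc.2 hξ.2.le) hξ.2.le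
    simp only [hD1, Real.sqrt_zero] at this
    linarith
  obtain ⟨b, hb⟩ := nonempty_Ioo.2 ha1
  -- Inserting the bound on √D gives D' ≥ 0, so D(b) ≤ D(ξ₁) = 0, against D > 0 before ξ₁.
  have hmono : MonotoneOn D (Icc b ξ₁) := by
    refine monotoneOn_of_hasDerivWithinAt_nonneg (convex_Icc _ _) hDc.continuousOn
      (f' := fun x => 2 * A x - 4 * u x * (K √(1 - u x ^ 2 / radiusSq κ x) - K 0)) ?_ ?_
    · intro x hx
      rw [interior_Icc] at hx
      have hx0 := hsub x ⟨hb.1.trans hx.1, hx.2⟩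
      exact (hDder x ⟨hx0.1, hx0.2.trans hξ₁.2⟩).hasDerivWithinAt
    · intro x hx
      rw [interior_Icc] at hx
      have hx' : x ∈ Ioo a ξ₁ := ⟨hb.1.trans hx.1, hx.2⟩
      have h1 := hDlow x hx'
      have h2 := mul_le_mul_of_nonneg_left (hsqrt x hx') hepos.le
      have h3 : 0 ≤ c * (ξ₁ - x) := mul_nonneg hc.le (by linarith [hx.2])
      nlinarith
  have := hmono (left_mem_Icc.2 hb.2.le) (right_mem_Icc.2 hb.2.le) hb.2.le
  linarith [hDpos b (hsub b hb)]

theorem IsProfileSolution.hasDerivWithinAt_Ici {κ R M : ℝ} {K u : ℝ → ℝ}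
    (hu : IsProfileSolution κ R M K u) {ξ : ℝ} (hξ : ξ ∈ Ico 0 R) :
    HasDerivWithinAt u (2 * K √(1 - u ξ ^ 2 / radiusSq κ ξ)) (Ici ξ) ξ := by
  rcases hξ.1.eq_or_lt with h | h
  · rw [← h, hu.zero]
    simpa using hu.hasDerivWithinAt_zero
  · exact (hu.hasDerivAt ξ ⟨h, hξ.2⟩).hasDerivWithinAt

/-! ### Existence of a vertical point -/

/-- In the spherical case the profile has to become vertical before the antipodal axis. -/
theorem exists_vertical_point_sphere {K : ℝ → ℝ} {M : ℝ} (hK : Continuous K)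
    (hM : ∀ x, |K x| ≤ M) (hK1 : 0 < K 1) :
    ∃ R, 0 < R ∧ R < 2 ∧ ∀ u, IsProfileSolution 1 R M K u →
      (∀ ξ ∈ Ioo 0 R, 0 < u ξ) ∧ ∃ ξ ∈ Ioo 0 R, radiusSq 1 ξ ≤ u ξ ^ 2 := by
  have hMpos : 0 < M := hK1.trans_le ((le_abs_self _).trans (hM 1))
  -- K is known to be positive only near 1. The same ε bounds 2K from below and measures, through
  -- u²/σ ≤ ε², how nearly horizontal the profile must be for that bound; this makes the two
  -- barriers below work.
  obtain ⟨ε, hε, hε1, hεK⟩ : ∃ ε, 0 < ε ∧ ε ≤ 1 ∧ ∀ t ∈ Icc 0 (ε ^ 2), ε < 2 * K √(1 - t) := by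
    have h1 : ContinuousAt (fun t => K √(1 - t)) 0 := by fun_prop
    have h2 : K 1 / 2 < K √(1 - 0) := by simp; linarith
    obtain ⟨d, hd, hball⟩ := Metric.eventually_nhds_iff.1 (h1.eventually (lt_mem_nhds h2))
    refine ⟨min (min 1 (d / 2)) (K 1 / 2), by positivity, (min_le_left _ _).trans (min_le_left _ _),
      fun t ht => ?_⟩
    set ε := min (min 1 (d / 2)) (K 1 / 2)
    have e1 : ε ≤ 1 := (min_le_left _ _).trans (min_le_left _ _)
    have e2 : ε ≤ d / 2 := (min_le_left _ _).trans (min_le_right _ _)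
    have e3 : ε ≤ K 1 / 2 := min_le_right _ _
    have e0 : 0 < ε := by positivity
    have := hball (y := t) (by
      rw [Real.dist_eq, sub_zero, abs_of_nonneg ht.1]
      nlinarith [ht.2])
    linarith
  set r := min (1 / 2) (ε / (4 * M)) with hr
  have hr0 : 0 < r := by positivity
  have hr1 : r ≤ 1 / 2 := min_le_left _ _
  have hr2 : 2 * M * r ≤ ε / 2 := by
    have : r ≤ ε / (4 * M) := min_le_right _ _
    rw [le_div_iff₀ (by positivity)] at this
    linarith
  -- At ξ = 2 − r² the second barrier gives u ≥ εr, and moving on to 2 − τ costs at most 2Mr² ≤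
  -- εr/2. Thus u² ≥ (εr/2)² = 4τ at 2 − τ, where σ = τ(2 − τ) is smaller.
  set τ := ε ^ 2 * r ^ 2 / 16 with hτ
  have hτ0 : 0 < τ := by positivity
  have hτr : 2 * τ < r ^ 2 := by
    have : ε ^ 2 ≤ 1 := by nlinarith
    have : ε ^ 2 * r ^ 2 ≤ 1 * r ^ 2 := mul_le_mul_of_nonneg_right this (sq_nonneg r)
    nlinarith [sq_pos_of_pos hr0]
  have hr3 : r ^ 2 ≤ 1 / 4 := by nlinarith
  set R := 2 - τ / 2 with hR
  refine ⟨R, by linarith, by linarith, fun u hu => ?_⟩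
  have hσ : ∀ ξ ∈ Ioc 0 R, 0 < radiusSq 1 ξ := fun ξ hξ => by
    have : radiusSq 1 ξ = ξ * (2 - ξ) := by unfold radiusSq; ring
    rw [this]
    exact mul_pos hξ.1 (by linarith [hξ.2])
  -- On [0, 1] one has ξ² ≤ σ, so at a contact with the line εξ the ratio u²/σ is at most ε² and u'
  -- > ε.
  have hlin : ∀ ξ ∈ Icc (0 : ℝ) 1, ε * ξ ≤ u ξ := by
    refine image_le_of_deriv_right_lt_deriv_boundary' (f' := fun _ => ε) (by fun_prop) ?_
      (by simp [hu.zero]) hu.continuous.continuousOn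
      (fun x hx => hu.hasDerivWithinAt_Ici ⟨hx.1, by linarith [hx.2]⟩) ?_
    · intro x _
      simpa using ((hasDerivAt_id x).const_mul ε).hasDerivWithinAt
    · intro x hx h
      refine hεK _ ⟨div_nonneg (sq_nonneg _) ?_, ?_⟩
      · unfold radiusSq; nlinarith [hx.1, hx.2]
      · refine div_le_of_le_mul₀ ?_ (sq_nonneg _) ?_
        · unfold radiusSq; nlinarith [hx.1, hx.2]
        · rw [← h, mul_pow]
          gcongr
          unfold radiusSq; nlinarith [hx.1, hx.2]
  -- For ξ ≥ 1 the barrier ε√σ is nonincreasing, while at a contact u²/σ = ε² and u' > ε > 0.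
  have hsq : ∀ ξ ∈ Icc (1 : ℝ) R, ε * √(radiusSq 1 ξ) ≤ u ξ := by
    refine image_le_of_deriv_right_lt_deriv_boundary'
      (f' := fun ξ => ε * (2 * (1 - 1 * ξ) / (2 * √(radiusSq 1 ξ)))) ?_ ?_ ?_
      hu.continuous.continuousOn
      (fun x hx => hu.hasDerivWithinAt_Ici ⟨by linarith [hx.1], hx.2⟩) ?_
    · have := continuous_radiusSq 1
      fun_prop
    · intro x hx
      exact (((hasDerivAt_radiusSq 1 x).sqrt
        (hσ x ⟨by linarith [hx.1], hx.2.le⟩).ne').const_mul ε).hasDerivWithinAt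
    · have := hlin 1 ⟨zero_le_one, le_rfl⟩
      have e : radiusSq 1 1 = 1 := by norm_num [radiusSq]
      simpa [e] using this
    · intro x hx h
      have h1 := hσ x ⟨by linarith [hx.1], hx.2.le⟩
      have h2 := hεK (u x ^ 2 / radiusSq 1 x) (by
        rw [← h, mul_pow, Real.sq_sqrt h1.le, mul_div_cancel_right₀ _ h1.ne']
        exact ⟨sq_nonneg _, le_rfl⟩)
      have h3 : ε * (2 * (1 - 1 * x) / (2 * √(radiusSq 1 x))) ≤ 0 := by
        refine mul_nonpos_of_nonneg_of_nonpos hε.le (div_nonpos_of_nonpos_of_nonneg ?_ ?_)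
        · linarith [hx.1]
        · positivity
      linarith
  refine ⟨fun ξ hξ => ?_, 2 - τ, ⟨by linarith, by linarith⟩, ?_⟩
  · rcases le_total ξ 1 with h | h
    · exact (mul_pos hε hξ.1).trans_le (hlin ξ ⟨hξ.1.le, h⟩)
    · exact (mul_pos hε (Real.sqrt_pos.2 (hσ ξ ⟨hξ.1, hξ.2.le⟩))).trans_le (hsq ξ ⟨h, hξ.2.le⟩)
  · have h1 := hsq (2 - r ^ 2) ⟨by linarith, by linarith⟩
    have h2 : r ≤ √(radiusSq 1 (2 - r ^ 2)) := by
      apply Real.le_sqrt_of_sq_le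
      unfold radiusSq; nlinarith [sq_nonneg r]
    have h3 := hu.lipschitz (2 - r ^ 2) ⟨by linarith, by linarith⟩ (2 - τ)
      ⟨by linarith, by linarith⟩
    rw [abs_of_nonpos (show 2 - r ^ 2 - (2 - τ) ≤ 0 by linarith)] at h3
    have h4 := (abs_le.1 h3).2
    have h5 : 2 * M * -(2 - r ^ 2 - (2 - τ)) ≤ 2 * M * r ^ 2 :=
      mul_le_mul_of_nonneg_left (by linarith) (by linarith)
    have h6 : 2 * M * r ^ 2 ≤ ε / 2 * r := by nlinarith
    have h7 : ε * r ≤ ε * √(radiusSq 1 (2 - r ^ 2)) := by gcongr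
    have h8 : ε * r / 2 ≤ u (2 - τ) := by linarith
    have h9 : (ε * r / 2) ^ 2 ≤ u (2 - τ) ^ 2 := by gcongr
    have h10 : (ε * r / 2) ^ 2 = 4 * τ := by simp only [hτ]; ring
    unfold radiusSq
    nlinarith

/-- In the hyperbolic case the profile becomes vertical at finite distance of the axis. -/
theorem exists_vertical_point_hyperbolic {K : ℝ → ℝ} {M : ℝ} (hK : Continuous K)
    (hK1 : ∀ y ∈ Icc (0 : ℝ) 1, √(1 - y ^ 2) < 2 * K y) :
    ∃ R, 0 < R ∧ ∀ u, IsProfileSolution (-1) R M K u →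
      (∀ ξ ∈ Ioo 0 R, 0 < u ξ) ∧ ∃ ξ ∈ Ioo 0 R, radiusSq (-1) ξ ≤ u ξ ^ 2 := by
  -- With w the sine of the slope angle and √(1 − w²) its cosine, the strict curvature bound reads
  -- 2K > w; compactness makes the gap uniform.
  obtain ⟨δ, hδ, hδK⟩ : ∃ δ > 0, ∀ w ∈ Icc (0 : ℝ) 1, w + δ ≤ 2 * K √(1 - w ^ 2) := by
    obtain ⟨w₀, hw₀, hmin⟩ := isCompact_Icc.exists_isMinOn (nonempty_Icc.2 zero_le_one)
      (f := fun w : ℝ => 2 * K √(1 - w ^ 2) - w) (s := Icc 0 1) (by fun_prop)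
    refine ⟨2 * K √(1 - w₀ ^ 2) - w₀, ?_, fun w hw => ?_⟩
    · have := hK1 √(1 - w₀ ^ 2) ⟨Real.sqrt_nonneg _, Real.sqrt_le_one.2 (by nlinarith)⟩
      rw [Real.sq_sqrt (by nlinarith [hw₀.1, hw₀.2]), sub_sub_cancel, Real.sqrt_sq hw₀.1] at this
      linarith
    · have := isMinOn_iff.1 hmin w hw
      linarith
  have hexp : 1 < Real.exp (1 / δ) := Real.one_lt_exp_iff.2 (by positivity)
  refine ⟨Real.exp (1 / δ), by positivity, fun u hu => ?_⟩
  set R := Real.exp (1 / δ)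
  have hσ : ∀ ξ > 0, 0 < radiusSq (-1) ξ := fun ξ hξ => by unfold radiusSq; nlinarith
  have hKpos : ∀ ξ > 0, 0 < K √(1 - u ξ ^ 2 / radiusSq (-1) ξ) := fun ξ hξ => by
    have := hK1 √(1 - u ξ ^ 2 / radiusSq (-1) ξ) ⟨Real.sqrt_nonneg _, Real.sqrt_le_one.2 (by
      have := div_nonneg (sq_nonneg (u ξ)) (hσ ξ hξ).le
      linarith)⟩
    have h2 := Real.sqrt_nonneg (1 - √(1 - u ξ ^ 2 / radiusSq (-1) ξ) ^ 2)
    linarith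
  have hmono : StrictMonoOn u (Icc 0 R) := by
    refine strictMonoOn_of_deriv_pos (convex_Icc _ _) hu.continuous.continuousOn fun x hx => ?_
    rw [interior_Icc] at hx
    rw [(hu.hasDerivAt x hx).deriv]
    linarith [hKpos x hx.1]
  have hpos : ∀ ξ ∈ Ioo 0 R, 0 < u ξ := fun ξ hξ => by
    have := hmono ⟨le_rfl, hξ.1.le.trans hξ.2.le⟩ ⟨hξ.1.le, hξ.2.le⟩ hξ.1
    rwa [hu.zero] at this
  refine ⟨hpos, ?_⟩
  by_contra! hcon
  -- As √σ ≤ 1 + ξ, the quotient v = u/(1 + ξ) is at most w = u/√σ, so (1 + ξ)v' = 2K − v ≥ δ. Hence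
  -- v ≥ 1 when 1 + ξ = R = exp(1/δ), and there u² ≥ (1 + ξ)² > σ.
  have hv : MonotoneOn (fun ξ => u ξ / (1 + ξ) - δ * Real.log (1 + ξ)) (Icc 0 (R - 1)) := by
    have hne : ∀ ξ ∈ Icc 0 (R - 1), 1 + ξ ≠ 0 := fun ξ hξ => by linarith [hξ.1]
    refine monotoneOn_of_hasDerivWithinAt_nonneg (convex_Icc _ _) ?_
      (f' := fun ξ => (2 * K √(1 - u ξ ^ 2 / radiusSq (-1) ξ) * (1 + ξ) - u ξ * 1) / (1 + ξ) ^ 2 -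
        δ * (1 / (1 + ξ))) ?_ ?_
    · refine (hu.continuous.continuousOn.div (by fun_prop) hne).sub
        (continuousOn_const.mul (ContinuousOn.log (by fun_prop) hne))
    · intro x hx
      rw [interior_Icc] at hx
      have h1 := hne x ⟨hx.1.le, hx.2.le⟩
      have h2 := (hasDerivAt_id x).const_add 1
      exact (((hu.hasDerivAt x ⟨hx.1, by linarith [hx.2]⟩).div h2 h1).sub
        ((h2.log h1).const_mul δ)).hasDerivWithinAt
    · intro x hx
      rw [interior_Icc] at hx
      have hxR : x ∈ Ioo 0 R := ⟨hx.1, by linarith [hx.2]⟩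
      have h1 := hσ x hx.1
      have h2 : 0 < √(radiusSq (-1) x) := Real.sqrt_pos.2 h1
      have h3 : √(radiusSq (-1) x) ≤ 1 + x := by
        refine Real.sqrt_le_iff.2 ⟨by linarith [hx.1], ?_⟩
        unfold radiusSq; nlinarith
      have h4 := hpos x hxR
      have h5 : u x / √(radiusSq (-1) x) ≤ 1 := by
        rw [div_le_one h2]
        exact Real.le_sqrt_of_sq_le (hcon x hxR).le
      have h6 := hδK (u x / √(radiusSq (-1) x)) ⟨by positivity, h5⟩
      rw [div_pow, Real.sq_sqrt h1.le] at h6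
      have h7 : u x / (1 + x) ≤ u x / √(radiusSq (-1) x) := by gcongr
      have h8 : 0 < 1 + x := by linarith [hx.1]
      have h9 : (2 * K √(1 - u x ^ 2 / radiusSq (-1) x) * (1 + x) - u x * 1) / (1 + x) ^ 2 -
        δ * (1 / (1 + x)) = (2 * K √(1 - u x ^ 2 / radiusSq (-1) x) - u x / (1 + x) - δ) / (1 + x)
          := by field_simp
      rw [h9]
      exact div_nonneg (by linarith) h8.le
  have h1 := hv (left_mem_Icc.2 (by linarith)) (right_mem_Icc.2 (by linarith)) (by linarith)
  have h2 : δ * Real.log R = 1 := by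
    simp only [R, Real.log_exp]; field_simp
  simp only [hu.zero, add_zero, Real.log_one, zero_div, mul_zero, sub_zero, add_sub_cancel, h2] at h1
  have h3 : R ≤ u (R - 1) := by
    have : 1 ≤ u (R - 1) / R := by linarith
    rwa [le_div_iff₀ (by linarith), one_mul] at this
  have h4 := hcon (R - 1) ⟨by linarith, by linarith⟩
  unfold radiusSq at h4
  nlinarith

/-! ### The profile up to its first vertical point -/

/-- The generating curve, up to its first vertical point, of the rotational sphere: `u` is the
product of the radius and the sine of the slope angle. -/
structure IsCapProfile (κ : ℝ) (H u : ℝ → ℝ) (R ξ₁ : ℝ) : Prop where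
  pos_end : 0 < ξ₁
  end_lt : ξ₁ < R
  radiusSq_pos : ∀ ξ ∈ Ioc 0 R, 0 < radiusSq κ ξ
  continuous : Continuous u
  zero : u 0 = 0
  hasDerivAt : ∀ ξ ∈ Ioo 0 R, HasDerivAt u (2 * H √(1 - u ξ ^ 2 / radiusSq κ ξ)) ξ
  hasDerivWithinAt_zero : HasDerivWithinAt u (2 * H 1) (Ici 0) 0
  pos : ∀ ξ ∈ Ioc 0 ξ₁, 0 < u ξ
  sq_lt : ∀ ξ ∈ Ioo 0 ξ₁, u ξ ^ 2 < radiusSq κ ξ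
  sq_end : u ξ₁ ^ 2 = radiusSq κ ξ₁
  transversal : 1 - κ * ξ₁ < 2 * H 0 * u ξ₁

theorem exists_capProfile {κ : ℝ} (hκ : κ = 1 ∨ κ = -1) {H : ℝ → ℝ}
    (hH : ProductSurface.IsAdmissible κ H) (hH1 : 0 < H 1) :
    ∃ u R ξ₁, IsCapProfile κ H u R ξ₁ := by
  have h11 : (-1 : ℝ) ≤ 1 := by norm_num
  have hHc : ContinuousOn H (Icc (-1) 1) := hH.contDiffOn.continuousOn
  -- Extending H by its end values gives a bounded continuous function on the line; the angle
  -- function stays in [0, 1], so the extension is invisible afterwards.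
  set K : ℝ → ℝ := IccExtend h11 ((Icc (-1) 1).domRestrict H) with hKdef
  have hKH : ∀ y ∈ Icc (-1 : ℝ) 1, K y = H y := fun y hy => IccExtend_of_mem h11 _ hy
  have hK : Continuous K := hHc.domRestrict.Icc_extend'
  have hK1 : K 1 = H 1 := hKH 1 ⟨h11, le_rfl⟩
  have hK0 : K 0 = H 0 := hKH 0 ⟨by norm_num, by norm_num⟩
  obtain ⟨M, hM⟩ : ∃ M, ∀ x, |K x| ≤ M := by
    obtain ⟨M, hM⟩ := isCompact_Icc.exists_bound_of_continuousOn hHc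
    refine ⟨M, fun x => ?_⟩
    exact hM _ (projIcc (-1 : ℝ) 1 h11 x).2
  -- The derivative of an even function at 0 equals its own negative.
  have hKd : HasDerivAt K 0 0 := by
    have hn : Icc (-1 : ℝ) 1 ∈ 𝓝 (0 : ℝ) := Icc_mem_nhds (by norm_num) (by norm_num)
    have hd : HasDerivAt H (deriv H 0) 0 :=
      ((hH.contDiffOn.contDiffAt hn).differentiableAt one_ne_zero).hasDerivAt
    have hd' : HasDerivAt H (-deriv H 0) 0 := by
      have h0 : HasDerivAt H (deriv H 0) (-0) := by simpa using hd
      have h1 := h0.scomp (0 : ℝ) (hasDerivAt_neg 0)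
      simp only [smul_eq_mul, neg_mul, one_mul] at h1
      refine h1.congr_of_eventuallyEq ?_
      filter_upwards [hn] with y hy
      exact (hH.even y hy).symm
    have h2 := hd.unique hd'
    have h3 : deriv H 0 = 0 := by linarith
    rw [h3] at hd
    refine hd.congr_of_eventuallyEq ?_
    filter_upwards [hn] with y hy
    exact hKH y hy
  obtain ⟨R, hR, hσ, hex⟩ : ∃ R, 0 < R ∧ (∀ ξ ∈ Ioc 0 R, 0 < radiusSq κ ξ) ∧
      ∀ u, IsProfileSolution κ R M K u →
        (∀ ξ ∈ Ioo 0 R, 0 < u ξ) ∧ ∃ ξ ∈ Ioo 0 R, radiusSq κ ξ ≤ u ξ ^ 2 := by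
    rcases hκ with rfl | rfl
    · obtain ⟨R, hR, hR2, h⟩ := exists_vertical_point_sphere hK hM (hK1 ▸ hH1)
      refine ⟨R, hR, fun ξ hξ => ?_, h⟩
      unfold radiusSq; nlinarith [hξ.1, hξ.2]
    -- The strict bound on |H| forbids zeros, so H keeps on [0, 1] the sign it has at 1.
    · have hpos : ∀ y ∈ Icc (0 : ℝ) 1, 0 < H y := by
        intro y hy
        by_contra! hneg
        have hc : ContinuousOn H (Icc y 1) := hHc.mono (Icc_subset_Icc_left (by linarith [hy.1]))
        obtain ⟨x, hx, hx0⟩ := intermediate_value_Icc hy.2 hc ⟨hneg, hH1.le⟩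
        have := hH.bound rfl x ⟨by linarith [hx.1, hy.1], hx.2⟩
        rw [hx0, abs_zero, mul_zero] at this
        exact absurd this (Real.sqrt_nonneg _).not_gt
      obtain ⟨R, hR, h⟩ := exists_vertical_point_hyperbolic (M := M) hK (fun y hy => by
        have hy' : y ∈ Icc (-1 : ℝ) 1 := ⟨by linarith [hy.1], hy.2⟩
        have := hH.bound rfl y hy'
        rwa [hKH y hy', ← abs_of_pos (hpos y hy)])
      refine ⟨R, hR, fun ξ hξ => ?_, h⟩
      unfold radiusSq; nlinarith [hξ.1]
  obtain ⟨u, hu⟩ := exists_profile_solution hR hK hM hσ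
  obtain ⟨hpos, ξ₂, hξ₂, hhit⟩ := hex u hu
  -- Near the axis u² = O(ξ²) is below σ ~ 2ξ. This excludes the trivial equality u² = σ at 0, so a
  -- least positive contact point exists.
  obtain ⟨a, ha, ha'⟩ : ∃ a > 0, ∀ ξ ∈ Ioo 0 a, u ξ ^ 2 < radiusSq κ ξ := by
    have h1 : ∀ᶠ ξ in 𝓝 (0 : ℝ), (2 * M) ^ 2 * ξ < 2 - κ * ξ := by
      have : ContinuousAt (fun ξ : ℝ => 2 - κ * ξ - (2 * M) ^ 2 * ξ) 0 := by fun_prop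
      filter_upwards [this.eventually (lt_mem_nhds (show (0 : ℝ) < _ by norm_num))] with ξ h
      linarith
    obtain ⟨a, ha, h⟩ := Metric.eventually_nhds_iff.1 h1
    refine ⟨min a R, by positivity, fun ξ hξ => ?_⟩
    have h2 := h (y := ξ) (by
      rw [Real.dist_eq, sub_zero, abs_of_pos hξ.1]
      exact hξ.2.trans_le (min_le_left _ _))
    have h3 := hu.lipschitz ξ ⟨hξ.1.le, hξ.2.le.trans (min_le_right _ _)⟩ 0 ⟨le_rfl, hR.le⟩
    rw [hu.zero, sub_zero, sub_zero, abs_of_pos hξ.1] at h3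
    have h4 : u ξ ^ 2 ≤ (2 * M * ξ) ^ 2 := sq_le_sq' (by linarith [(abs_le.1 h3).1]) (abs_le.1 h3).2
    have h5 := mul_lt_mul_of_pos_left h2 hξ.1
    unfold radiusSq
    nlinarith
  have haξ : a ≤ ξ₂ := by
    by_contra! h
    linarith [ha' ξ₂ ⟨hξ₂.1, h⟩]
  have hcl : IsCompact (Icc a ξ₂ ∩ {ξ | radiusSq κ ξ ≤ u ξ ^ 2}) :=
    isCompact_Icc.inter_right (isClosed_le (continuous_radiusSq κ) (hu.continuous.pow 2))
  obtain ⟨ξ₁, hξ₁, hleast⟩ := hcl.exists_isLeast ⟨ξ₂, ⟨haξ, le_rfl⟩, hhit⟩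
  have h0 : 0 < ξ₁ := ha.trans_le hξ₁.1.1
  have hR1 : ξ₁ < R := hξ₁.1.2.trans_lt hξ₂.2
  have hlt : ∀ ξ ∈ Ioo 0 ξ₁, u ξ ^ 2 < radiusSq κ ξ := by
    intro ξ hξ
    by_contra! h
    rcases lt_or_ge ξ a with h1 | h1
    · linarith [ha' ξ ⟨hξ.1, h1⟩]
    · linarith [hleast ⟨⟨h1, hξ.2.le.trans hξ₁.1.2⟩, h⟩, hξ.2]
  have heq : u ξ₁ ^ 2 = radiusSq κ ξ₁ := by
    refine le_antisymm ?_ hξ₁.2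
    have : Tendsto (fun ξ => radiusSq κ ξ - u ξ ^ 2) (𝓝[<] ξ₁) (𝓝 (radiusSq κ ξ₁ - u ξ₁ ^ 2)) :=
      (((continuous_radiusSq κ).sub (hu.continuous.pow 2)).tendsto ξ₁).mono_left nhdsWithin_le_nhds
    have := ge_of_tendsto this (b := 0) (by
      filter_upwards [Ioo_mem_nhdsLT h0] with ξ hξ
      linarith [hlt ξ hξ])
    linarith
  have htr := profile_transversal hKd ⟨h0, hR1⟩ hσ
    hu.continuous hu.hasDerivAt hlt heq
  refine ⟨u, R, ξ₁, h0, hR1, hσ, hu.continuous, hu.zero, fun ξ hξ => ?_, ?_, fun ξ hξ => ?_, hlt,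
    heq, by rwa [hK0] at htr⟩
  · have := hu.hasDerivAt ξ hξ
    rwa [hKH] at this
    refine ⟨by linarith [Real.sqrt_nonneg (1 - u ξ ^ 2 / radiusSq κ ξ)], Real.sqrt_le_one.2 ?_⟩
    have := div_nonneg (sq_nonneg (u ξ)) (hσ ξ ⟨hξ.1, hξ.2.le⟩).le
    linarith
  · rw [← hK1]; exact hu.hasDerivWithinAt_zero
  · exact hpos ξ ⟨hξ.1, hξ.2.trans_lt hR1⟩

/-! ### Height of the profile and its inverse across the equator -/

theorem hasDerivAt_of_tendsto_punctured {f g : ℝ → ℝ} {x l : ℝ}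
    (hd : ∀ᶠ y in 𝓝[≠] x, HasDerivAt f (g y) y) (hf : ContinuousAt f x)
    (hg : Tendsto g (𝓝[≠] x) (𝓝 l)) : HasDerivAt f l x := by
  have hr := hd.filter_mono (nhdsWithin_mono x (fun y (hy : x < y) => ne_of_gt hy))
  have hl := hd.filter_mono (nhdsWithin_mono x (fun y (hy : y < x) => ne_of_lt hy))
  have hgr := hg.mono_left (nhdsWithin_mono x (fun y (hy : x < y) => ne_of_gt hy))
  have hgl := hg.mono_left (nhdsWithin_mono x (fun y (hy : y < x) => ne_of_lt hy))
  have A : HasDerivWithinAt f l (Ici x) x := by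
    refine hasDerivWithinAt_Ici_of_tendsto_deriv (s := {y | HasDerivAt f (g y) y})
      (fun y hy => (HasDerivAt.differentiableAt hy).differentiableWithinAt)
      hf.continuousWithinAt hr (hgr.congr' ?_)
    filter_upwards [hr] with y hy using hy.deriv.symm
  have B : HasDerivWithinAt f l (Iic x) x := by
    refine hasDerivWithinAt_Iic_of_tendsto_deriv (s := {y | HasDerivAt f (g y) y})
      (fun y hy => (HasDerivAt.differentiableAt hy).differentiableWithinAt)
      hf.continuousWithinAt hl (hgl.congr' ?_)
    filter_upwards [hl] with y hy using hy.deriv.symm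
  simpa using B.union A

/-- If `g = Γ ^ (-1/2)` near a simple zero `ξ₁` of `Γ`, then `g` has a primitive which is
continuous up to `ξ₁`. -/
theorem exists_primitive_of_simple_zero {g Γ : ℝ → ℝ} {a ξ₁ Γ' : ℝ} (ha : a < ξ₁)
    (hg : ContinuousOn g (Iio ξ₁)) (hΓ : HasDerivAt Γ Γ' ξ₁) (hΓ' : Γ' < 0) (hΓ0 : Γ ξ₁ = 0)
    (hgΓ : ∀ ξ ∈ Ioo a ξ₁, g ξ = 1 / √(Γ ξ)) :
    ∃ f : ℝ → ℝ, f ξ₁ = 0 ∧ ContinuousOn f (Iic ξ₁) ∧ ∀ ξ < ξ₁, HasDerivAt f (-g ξ) ξ := by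
  obtain ⟨b, hb, hbΓ⟩ : ∃ b < ξ₁, ∀ ξ ∈ Ioo b ξ₁, ξ ∈ Ioo a ξ₁ ∧ -Γ' / 2 * (ξ₁ - ξ) ≤ Γ ξ := by
    have h4 := (hasDerivAt_iff_tendsto_slope.1 hΓ).mono_left
      (nhdsWithin_mono ξ₁ (fun x (hx : x < ξ₁) => ne_of_lt hx))
    refine (mem_nhdsLT_iff_exists_Ioo_subset' ha).1 ?_
    filter_upwards [h4.eventually (gt_mem_nhds (show Γ' < Γ' / 2 by linarith)),
      Ioo_mem_nhdsLT ha] with ξ h5 h6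
    refine ⟨h6, ?_⟩
    rw [slope_def_field, hΓ0, div_lt_iff_of_neg (by linarith [h6.2])] at h5
    linarith
  have hint : ∀ x < ξ₁, IntervalIntegrable g volume x ξ₁ := by
    intro x hx
    have hm : (max x b) < ξ₁ := max_lt hx hb
    have h1 : IntervalIntegrable g volume x (max x b) := by
      refine ContinuousOn.intervalIntegrable (hg.mono fun y hy => ?_)
      rw [uIcc_of_le (le_max_left _ _)] at hy
      exact hy.2.trans_lt hm
    refine h1.trans ?_
    set c := √(-Γ' / 2)
    have hc : 0 < c := Real.sqrt_pos.2 (by linarith)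
    -- A simple zero gives Γ ≥ c²(ξ₁ − y), so g is dominated by an integrable power with exponent
    -- −1/2.
    have h2 : IntervalIntegrable (fun y => 1 / c * (ξ₁ - y) ^ (-1 / 2 : ℝ)) volume (max x b) ξ₁ := by
      have := (intervalIntegral.intervalIntegrable_rpow' (a := ξ₁ - max x b) (b := 0)
        (r := -1 / 2) (by norm_num)).comp_sub_left ξ₁
      simpa using this.const_mul (1 / c)
    rw [intervalIntegrable_iff_integrableOn_Ioo_of_le hm.le] at h2 ⊢
    refine Integrable.mono' h2 ?_ ?_
    · exact (hg.mono fun y hy => hy.2).aestronglyMeasurable measurableSet_Ioo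
    · refine (ae_restrict_iff' measurableSet_Ioo).2 (Eventually.of_forall fun y hy => ?_)
      obtain ⟨h3, h4⟩ := hbΓ y ⟨(le_max_right _ _).trans_lt hy.1, hy.2⟩
      have h5 : 0 < ξ₁ - y := by linarith [hy.2]
      rw [hgΓ y h3, Real.norm_of_nonneg (by positivity)]
      have h6 : (ξ₁ - y) ^ (-1 / 2 : ℝ) = 1 / √(ξ₁ - y) := by
        rw [Real.sqrt_eq_rpow, show (-1 / 2 : ℝ) = -(1 / 2) by norm_num, Real.rpow_neg h5.le]
        simp
      rw [h6, one_div_mul_one_div]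
      have h7 : c * √(ξ₁ - y) ≤ √(Γ y) := by
        rw [← Real.sqrt_mul (by linarith)]
        exact Real.sqrt_le_sqrt h4
      exact one_div_le_one_div_of_le (by positivity) h7
  have hder : ∀ ξ < ξ₁, HasDerivAt (fun ξ => ∫ x in ξ..ξ₁, g x) (-g ξ) ξ := fun ξ hξ =>
    intervalIntegral.integral_hasDerivAt_left (hint ξ hξ)
      (hg.stronglyMeasurableAtFilter isOpen_Iio ξ hξ) (hg.continuousAt (Iio_mem_nhds hξ))
  refine ⟨fun ξ => ∫ x in ξ..ξ₁, g x, by simp, fun ξ hξ => ?_, hder⟩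
  rcases (mem_Iic.1 hξ).lt_or_eq with h | rfl
  · exact (hder ξ h).continuousAt.continuousWithinAt
  · have h1 := intervalIntegral.continuousOn_primitive_interval_left
      ((intervalIntegrable_iff_integrableOn_Icc_of_le ha.le).1 (hint a ha) |>.mono_set
        (uIcc_of_le ha.le).subset)
    have h2 := h1 ξ right_mem_uIcc
    rw [uIcc_of_le ha.le] at h2
    exact h2.mono_of_mem_nhdsWithin (Icc_mem_nhdsLE ha)

/-- The inverse of the primitive of `Γ ^ (-1/2)`, reflected at the simple zero `ξ₁` of `Γ`, is
twice differentiable: it solves `Ξ'' = Γ' / 2`. -/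
theorem exists_reflected_inverse {f g Γ Γ' : ℝ → ℝ} {a ξ₁ : ℝ} (ha : a < ξ₁)
    (hf0 : f ξ₁ = 0) (hfc : ContinuousOn f (Iic ξ₁)) (hfd : ∀ ξ < ξ₁, HasDerivAt f (-g ξ) ξ)
    (hΓ : ∀ ξ ∈ Ioc a ξ₁, HasDerivAt Γ (Γ' ξ) ξ) (hΓ'c : ContinuousOn Γ' (Ioc a ξ₁))
    (hΓ0 : Γ ξ₁ = 0) (hΓpos : ∀ ξ ∈ Ioo a ξ₁, 0 < Γ ξ)
    (hgΓ : ∀ ξ ∈ Ioo a ξ₁, g ξ = 1 / √(Γ ξ)) :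
    ∃ ε > 0, ∃ Ξ Ξ' : ℝ → ℝ, Ξ 0 = ξ₁ ∧ Ξ' 0 = 0 ∧ ∀ ζ ∈ Ioo (-ε) ε, Ξ ζ ∈ Ioc a ξ₁ ∧
      f (Ξ ζ) = |ζ| ∧ HasDerivAt Ξ (Ξ' ζ) ζ ∧ HasDerivAt Ξ' (Γ' (Ξ ζ) / 2) ζ ∧
      ContinuousAt (fun ζ => Γ' (Ξ ζ) / 2) ζ := by
  obtain ⟨b, hab, hb⟩ := exists_between ha
  have hsub : Icc b ξ₁ ⊆ Iic ξ₁ := fun x hx => hx.2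
  have hanti : StrictAntiOn f (Icc b ξ₁) := by
    refine strictAntiOn_of_deriv_neg (convex_Icc _ _) (hfc.mono hsub) fun x hx => ?_
    rw [interior_Icc] at hx
    have hx' : x ∈ Ioo a ξ₁ := ⟨hab.trans hx.1, hx.2⟩
    rw [(hfd x hx.2).deriv, hgΓ x hx', neg_neg_iff_pos]
    exact one_div_pos.2 (Real.sqrt_pos.2 (hΓpos x hx'))
  have hlb : b ∈ Icc b ξ₁ := ⟨le_rfl, hb.le⟩
  have hrb : ξ₁ ∈ Icc b ξ₁ := ⟨hb.le, le_rfl⟩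
  have hε : 0 < f b := by
    have := hanti hlb hrb hb
    rwa [hf0] at this
  -- Inverting f at |ζ| performs the reflection. The value 0 outside the range of interest is
  -- arbitrary.
  have hex : ∀ ζ : ℝ, ∃ x, |ζ| < f b → x ∈ Icc b ξ₁ ∧ f x = |ζ| := by
    intro ζ
    by_cases h : |ζ| < f b
    · obtain ⟨x, hx, hx'⟩ := intermediate_value_Icc' hb.le (hfc.mono hsub)
        (show |ζ| ∈ Icc (f ξ₁) (f b) from ⟨by rw [hf0]; positivity, h.le⟩)
      exact ⟨x, fun _ => ⟨hx, hx'⟩⟩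
    · exact ⟨0, fun h' => absurd h' h⟩
  choose Ξ hΞ using hex
  have hΞmem : ∀ ζ, |ζ| < f b → Ξ ζ ∈ Ioc b ξ₁ := fun ζ hζ => by
    obtain ⟨h1, h2⟩ := hΞ ζ hζ
    refine ⟨lt_of_le_of_ne h1.1 fun h => ?_, h1.2⟩
    rw [← h] at h2
    linarith
  have hΞ0 : Ξ 0 = ξ₁ := by
    obtain ⟨h1, h2⟩ := hΞ 0 (by simpa using hε)
    exact hanti.injOn h1 hrb (by rw [h2, hf0, abs_zero])
  have hopen : ∀ ζ, |ζ| < f b → ∀ᶠ y in 𝓝 ζ, |y| < f b := fun ζ hζ =>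
    (continuous_abs.tendsto ζ).eventually (gt_mem_nhds hζ)
  have hΞc : ∀ ζ, |ζ| < f b → ContinuousAt Ξ ζ := by
    intro ζ hζ
    have hm := hΞmem ζ hζ
    have hm' : Ξ ζ ∈ Icc b ξ₁ := ⟨hm.1.le, hm.2⟩
    refine tendsto_order.2 ⟨fun c hc => ?_, fun d hd => ?_⟩
    · have hc' : max c b ∈ Icc b ξ₁ := ⟨le_max_right _ _, max_le (hc.le.trans hm.2) hb.le⟩
      have h1 := hanti hc' hm' (max_lt hc hm.1)
      rw [(hΞ ζ hζ).2] at h1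
      filter_upwards [hopen ζ hζ, (continuous_abs.tendsto ζ).eventually (gt_mem_nhds h1)] with y h2 h3
      rw [← (hΞ y h2).2] at h3
      exact (le_max_left _ _).trans_lt ((hanti.lt_iff_gt (hΞ y h2).1 hc').1 h3)
    · rcases lt_or_ge ξ₁ d with h | h
      · filter_upwards [hopen ζ hζ] with y h2
        exact (hΞ y h2).1.2.trans_lt h
      · have hd' : d ∈ Icc b ξ₁ := ⟨hm.1.le.trans hd.le, h⟩
        have h1 := hanti hm' hd' hd
        rw [(hΞ ζ hζ).2] at h1
        filter_upwards [hopen ζ hζ, (continuous_abs.tendsto ζ).eventually (lt_mem_nhds h1)] with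
          y h2 h3
        rw [← (hΞ y h2).2] at h3
        exact (hanti.lt_iff_gt hd' (hΞ y h2).1).1 h3
  have hΞlt : ∀ ζ, |ζ| < f b → ζ ≠ 0 → Ξ ζ ∈ Ioo a ξ₁ := by
    intro ζ hζ h0
    refine ⟨hab.trans (hΞmem ζ hζ).1, lt_of_le_of_ne (hΞmem ζ hζ).2 fun h => ?_⟩
    have := (hΞ ζ hζ).2
    rw [h, hf0] at this
    exact h0 (abs_eq_zero.1 this.symm)
  have hΞa : ∀ ζ, |ζ| < f b → Ξ ζ ∈ Ioc a ξ₁ := fun ζ hζ =>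
    ⟨hab.trans (hΞmem ζ hζ).1, (hΞmem ζ hζ).2⟩
  have hΓΞ : ∀ ζ, |ζ| < f b → ContinuousAt (fun ζ => Γ (Ξ ζ)) ζ := fun ζ hζ =>
    ContinuousAt.comp (f := Ξ) (hΓ _ (hΞa ζ hζ)).continuousAt (hΞc ζ hζ)
  have hΓ'Ξ : ∀ ζ, |ζ| < f b → ContinuousAt (fun ζ => Γ' (Ξ ζ) / 2) ζ := fun ζ hζ => by
    refine ContinuousAt.div_const ?_ 2
    have h1 := hΓ'c _ (hΞa ζ hζ)
    refine Tendsto.comp h1 (tendsto_nhdsWithin_iff.2 ⟨hΞc ζ hζ, ?_⟩)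
    filter_upwards [hopen ζ hζ] with y hy using hΞa y hy
  -- Ξ decreases with height for ζ > 0 and increases for ζ < 0. Both branches satisfy Ξ'² = Γ(Ξ),
  -- whose derivative Ξ'' = Γ'(Ξ)/2 no longer depends on the sign and stays continuous at 0.
  let Ξ' : ℝ → ℝ := fun ζ => if 0 < ζ then -√(Γ (Ξ ζ)) else √(Γ (Ξ ζ))
  have hpos : ∀ {ζ : ℝ}, 0 < ζ → ∀ᶠ y in 𝓝 ζ, 0 < y := fun h => lt_mem_nhds h
  have hneg : ∀ {ζ : ℝ}, ζ < 0 → ∀ᶠ y in 𝓝 ζ, y < 0 := fun h => gt_mem_nhds h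
  have hderne : ∀ ζ, |ζ| < f b → ζ ≠ 0 → HasDerivAt Ξ (Ξ' ζ) ζ := by
    intro ζ hζ h0
    have hm := hΞlt ζ hζ h0
    have hs := Real.sqrt_pos.2 (hΓpos _ hm)
    have hf := hfd _ hm.2
    rw [hgΓ _ hm] at hf
    rcases h0.lt_or_gt with h | h
    · have := HasDerivAt.of_local_left_inverse (hΞc ζ hζ) hf.neg (by simp [hs.ne']) (by
        filter_upwards [hopen ζ hζ, hneg h] with y h1 h2
        rw [Pi.neg_apply, (hΞ y h1).2, abs_of_neg h2, neg_neg])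
      simpa [Ξ', h.not_gt] using this
    · have := HasDerivAt.of_local_left_inverse (hΞc ζ hζ) hf (by simp [hs.ne']) (by
        filter_upwards [hopen ζ hζ, hpos h] with y h1 h2
        rw [(hΞ y h1).2, abs_of_pos h2])
      simpa [Ξ', h, inv_neg] using this
  have h00 : |(0 : ℝ)| < f b := by simpa using hε
  have hΞ'c : Tendsto Ξ' (𝓝 0) (𝓝 0) := by
    have h1 : Tendsto (fun ζ => √(Γ (Ξ ζ))) (𝓝 0) (𝓝 0) := by
      have := (Real.continuous_sqrt.continuousAt.comp (hΓΞ 0 h00)).tendsto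
      simpa [Function.comp_def, hΞ0, hΓ0] using this
    refine squeeze_zero_norm (fun ζ => ?_) h1
    simp only [Ξ']
    split_ifs <;> simp [abs_of_nonneg (Real.sqrt_nonneg _)]
  have hΞ'0 : Ξ' 0 = 0 := by simp [Ξ', hΞ0, hΓ0]
  have hder'ne : ∀ ζ, |ζ| < f b → ζ ≠ 0 → HasDerivAt Ξ' (Γ' (Ξ ζ) / 2) ζ := by
    intro ζ hζ h0
    have hm := hΞlt ζ hζ h0
    have hs := Real.sqrt_pos.2 (hΓpos _ hm)
    have h1 := ((hΓ _ (hΞa ζ hζ)).comp ζ (hderne ζ hζ h0)).sqrt (hΓpos _ hm).ne'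
    rcases h0.lt_or_gt with h | h
    · refine (h1.congr_deriv ?_).congr_of_eventuallyEq ?_
      · simp only [Ξ', h.not_gt, if_false, Function.comp_apply]; field_simp
      · filter_upwards [hneg h] with y hy
        simp [Ξ', hy.not_gt]
    · refine (h1.neg.congr_deriv ?_).congr_of_eventuallyEq ?_
      · simp only [Ξ', h, if_true, Function.comp_apply]; field_simp
      · filter_upwards [hpos h] with y hy
        simp [Ξ', hy]
  have hpun : ∀ᶠ y in 𝓝[≠] (0 : ℝ), |y| < f b ∧ y ≠ 0 :=
    ((hopen 0 h00).filter_mono nhdsWithin_le_nhds).and self_mem_nhdsWithin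
  refine ⟨f b, hε, Ξ, Ξ', hΞ0, hΞ'0, fun ζ hζ => ?_⟩
  have hζ' : |ζ| < f b := abs_lt.2 hζ
  refine ⟨hΞa ζ hζ', (hΞ ζ hζ').2, ?_, ?_, hΓ'Ξ ζ hζ'⟩
  · rcases eq_or_ne ζ 0 with rfl | h
    · rw [hΞ'0]
      exact hasDerivAt_of_tendsto_punctured (hpun.mono fun y hy => hderne y hy.1 hy.2)
        (hΞc 0 h00) (hΞ'c.mono_left nhdsWithin_le_nhds)
    · exact hderne ζ hζ' h
  · rcases eq_or_ne ζ 0 with rfl | h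
    · refine hasDerivAt_of_tendsto_punctured (hpun.mono fun y hy => hder'ne y hy.1 hy.2)
        (by rw [ContinuousAt, hΞ'0]; exact hΞ'c) ((hΓ'Ξ 0 h00).tendsto.mono_left nhdsWithin_le_nhds)
    · exact hder'ne ζ hζ' h

/-! ### Slope functions of the profile up to the axis -/

/-- The sine of the slope angle divided by the radius, extended to the axis. -/
noncomputable def slopeRatio (κ : ℝ) (H u : ℝ → ℝ) (ξ : ℝ) : ℝ :=
  if ξ ≤ 0 then H 1 else u ξ / radiusSq κ ξ

/-- The cosine of the slope angle, i.e. the angle function of the lower cap. -/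
noncomputable def angleFn (κ : ℝ) (u : ℝ → ℝ) (ξ : ℝ) : ℝ :=
  if ξ ≤ 0 then 1 else √(1 - u ξ ^ 2 / radiusSq κ ξ)

/-- The derivative of the height of the profile curve with respect to `ξ`. -/
noncomputable def slopeFn (κ : ℝ) (H u : ℝ → ℝ) (ξ : ℝ) : ℝ :=
  slopeRatio κ H u ξ / angleFn κ u ξ

noncomputable def slopeRatioDeriv (κ : ℝ) (H u : ℝ → ℝ) (ξ : ℝ) : ℝ :=
  (2 * H (angleFn κ u ξ) - 2 * slopeRatio κ H u ξ * (1 - κ * ξ)) / radiusSq κ ξ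

noncomputable def angleFnDeriv (κ : ℝ) (H u : ℝ → ℝ) (ξ : ℝ) : ℝ :=
  -(2 * H (angleFn κ u ξ) * slopeRatio κ H u ξ + u ξ * slopeRatioDeriv κ H u ξ) /
    (2 * angleFn κ u ξ)

noncomputable def slopeFnDeriv (κ : ℝ) (H u : ℝ → ℝ) (ξ : ℝ) : ℝ :=
  (slopeRatioDeriv κ H u ξ * angleFn κ u ξ - slopeRatio κ H u ξ * angleFnDeriv κ H u ξ) /
    angleFn κ u ξ ^ 2

theorem angleFn_nonneg (κ : ℝ) (u : ℝ → ℝ) (ξ : ℝ) : 0 ≤ angleFn κ u ξ := by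
  unfold angleFn; split_ifs <;> positivity

namespace IsCapProfile

variable {κ R ξ₁ : ℝ} {H u : ℝ → ℝ}

theorem angleFn_le_one (h : IsCapProfile κ H u R ξ₁) {ξ : ℝ} (hξ : ξ ≤ R) :
    angleFn κ u ξ ≤ 1 := by
  unfold angleFn
  split_ifs with h0
  · exact le_rfl
  · refine Real.sqrt_le_one.2 ?_
    have := div_nonneg (sq_nonneg (u ξ)) (h.radiusSq_pos ξ ⟨not_le.1 h0, hξ⟩).le
    linarith

theorem angleFn_mem (h : IsCapProfile κ H u R ξ₁) {ξ : ℝ} (hξ : ξ ≤ R) :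
    angleFn κ u ξ ∈ Icc (-1 : ℝ) 1 :=
  ⟨by linarith [angleFn_nonneg κ u ξ], h.angleFn_le_one hξ⟩

theorem u_eq (h : IsCapProfile κ H u R ξ₁) {ξ : ℝ} (h0 : 0 ≤ ξ) (hξ : ξ ≤ R) :
    u ξ = slopeRatio κ H u ξ * radiusSq κ ξ := by
  rcases h0.eq_or_lt with rfl | h1
  · simp [h.zero, radiusSq]
  · rw [slopeRatio, if_neg h1.not_ge, div_mul_cancel₀ _ (h.radiusSq_pos ξ ⟨h1, hξ⟩).ne']

theorem sq_le (h : IsCapProfile κ H u R ξ₁) {ξ : ℝ} (h0 : 0 ≤ ξ) (hξ : ξ ≤ ξ₁) :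
    u ξ ^ 2 ≤ radiusSq κ ξ := by
  rcases h0.eq_or_lt with rfl | h1
  · simp [h.zero, radiusSq]
  rcases hξ.eq_or_lt with rfl | h2
  · exact h.sq_end.le
  · exact (h.sq_lt ξ ⟨h1, h2⟩).le

theorem angleFn_sq (h : IsCapProfile κ H u R ξ₁) {ξ : ℝ} (h0 : 0 ≤ ξ) (hξ : ξ ≤ ξ₁) :
    angleFn κ u ξ ^ 2 = 1 - u ξ * slopeRatio κ H u ξ := by
  rcases h0.eq_or_lt with rfl | h1
  · simp [angleFn, h.zero]
  · have hσ := h.radiusSq_pos ξ ⟨h1, hξ.trans h.end_lt.le⟩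
    rw [angleFn, if_neg h1.not_ge, slopeRatio, if_neg h1.not_ge, Real.sq_sqrt]
    · ring
    · rw [sub_nonneg, div_le_one hσ]
      exact h.sq_le h0 hξ

theorem angleFn_pos (h : IsCapProfile κ H u R ξ₁) {ξ : ℝ} (hξ : ξ < ξ₁) :
    0 < angleFn κ u ξ := by
  unfold angleFn
  split_ifs with h0
  · exact one_pos
  · have h0 := not_le.1 h0
    rw [Real.sqrt_pos, sub_pos, div_lt_one (h.radiusSq_pos ξ ⟨h0, hξ.le.trans h.end_lt.le⟩)]
    exact h.sq_lt ξ ⟨h0, hξ⟩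

theorem angleFn_end (h : IsCapProfile κ H u R ξ₁) : angleFn κ u ξ₁ = 0 := by
  rw [angleFn, if_neg h.pos_end.not_ge, h.sq_end,
    div_self (h.radiusSq_pos ξ₁ ⟨h.pos_end, h.end_lt.le⟩).ne', sub_self, Real.sqrt_zero]

theorem slopeRatio_pos (h : IsCapProfile κ H u R ξ₁) (hH : 0 < H 1) {ξ : ℝ} (hξ : ξ ≤ ξ₁) :
    0 < slopeRatio κ H u ξ := by
  unfold slopeRatio
  split_ifs with h0
  · exact hH
  · have h0 := not_le.1 h0
    exact div_pos (h.pos ξ ⟨h0, hξ⟩) (h.radiusSq_pos ξ ⟨h0, hξ.trans h.end_lt.le⟩)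

theorem two_sub_pos (h : IsCapProfile κ H u R ξ₁) {ξ : ℝ} (h0 : 0 ≤ ξ) (hξ : ξ ≤ R) :
    0 < 2 - κ * ξ := by
  rcases h0.eq_or_lt with rfl | h1
  · norm_num
  · have := h.radiusSq_pos ξ ⟨h1, hξ⟩
    have e : radiusSq κ ξ = ξ * (2 - κ * ξ) := by unfold radiusSq; ring
    rw [e] at this
    exact pos_of_mul_pos_right this h0

/-- Since u/σ = (u/ξ)/(2 − κξ), the limit is u'(0)/2 = H(1). -/
theorem tendsto_slopeRatio (h : IsCapProfile κ H u R ξ₁) :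
    Tendsto (slopeRatio κ H u) (𝓝[>] 0) (𝓝 (H 1)) := by
  have h1 := (hasDerivWithinAt_iff_tendsto_slope' (by simp)).1 h.hasDerivWithinAt_zero.Ioi_of_Ici
  have h2 : Tendsto (fun ξ : ℝ => 2 - κ * ξ) (𝓝[>] 0) (𝓝 2) := by
    have : ContinuousAt (fun ξ : ℝ => 2 - κ * ξ) 0 := by fun_prop
    simpa using this.tendsto.mono_left nhdsWithin_le_nhds
  have h3 := h1.div h2 two_ne_zero
  rw [mul_div_cancel_left₀ _ two_ne_zero] at h3
  refine h3.congr' ?_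
  filter_upwards [self_mem_nhdsWithin] with ξ hξ
  have hξ : (0 : ℝ) < ξ := hξ
  rw [slopeRatio, if_neg hξ.not_ge, Pi.div_apply, slope_def_field, h.zero, sub_zero, sub_zero,
    div_div]
  congr 1
  unfold radiusSq; ring

theorem continuousAt_slopeRatio (h : IsCapProfile κ H u R ξ₁) {ξ : ℝ} (hξ : ξ < R) :
    ContinuousAt (slopeRatio κ H u) ξ := by
  rcases lt_trichotomy ξ 0 with h0 | rfl | h0
  · refine continuousAt_const.congr (f := fun _ => H 1) ?_
    filter_upwards [gt_mem_nhds h0] with y hy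
    rw [slopeRatio, if_pos (le_of_lt hy)]
  · rw [continuousAt_iff_continuous_left'_right']
    have e : slopeRatio κ H u 0 = H 1 := by rw [slopeRatio, if_pos le_rfl]
    refine ⟨?_, by rw [ContinuousWithinAt, e]; exact h.tendsto_slopeRatio⟩
    rw [ContinuousWithinAt, e]
    refine tendsto_const_nhds.congr' ?_
    filter_upwards [self_mem_nhdsWithin] with y hy
    rw [slopeRatio, if_pos (le_of_lt hy)]
  · refine (h.continuous.continuousAt.div (continuous_radiusSq κ).continuousAt
      (h.radiusSq_pos ξ ⟨h0, hξ.le⟩).ne').congr ?_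
    filter_upwards [lt_mem_nhds h0] with y hy
    rw [slopeRatio, if_neg (not_le.2 hy), Pi.div_apply]

theorem continuousAt_angleFn (h : IsCapProfile κ H u R ξ₁) {ξ : ℝ} (hξ : ξ < R) :
    ContinuousAt (angleFn κ u) ξ := by
  rcases lt_or_ge ξ 0 with h0 | h0
  · refine continuousAt_const.congr (f := fun _ => (1 : ℝ)) ?_
    filter_upwards [gt_mem_nhds h0] with y hy
    rw [angleFn, if_pos (le_of_lt hy)]
  -- Nothing is known about u at negative arguments; `max` replaces it there by u(0) = 0, matching
  -- the constant extension of the angle function.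
  · have h1 : ContinuousAt (fun ξ => √(1 - u (max ξ 0) * slopeRatio κ H u ξ)) ξ := by
      refine Real.continuous_sqrt.continuousAt.comp (continuousAt_const.sub
        (ContinuousAt.mul ?_ (h.continuousAt_slopeRatio hξ)))
      exact (h.continuous.comp (continuous_id.max continuous_const)).continuousAt
    refine h1.congr (Eventually.of_forall fun y => ?_)
    rcases le_or_gt y 0 with hy | hy
    · simp [angleFn, hy, h.zero]
    · simp only [angleFn, slopeRatio]
      rw [if_neg hy.not_ge, if_neg hy.not_ge, max_eq_left hy.le]
      congr 1; ring

theorem continuousAt_H_angleFn (h : IsCapProfile κ H u R ξ₁) (hH : ContinuousOn H (Icc (-1) 1))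
    {ξ : ℝ} (hξ : ξ < R) : ContinuousAt (fun ξ => H (angleFn κ u ξ)) ξ := by
  refine Tendsto.comp (hH _ (h.angleFn_mem hξ.le)) (tendsto_nhdsWithin_iff.2
    ⟨h.continuousAt_angleFn hξ, ?_⟩)
  filter_upwards [gt_mem_nhds hξ] with y hy using h.angleFn_mem (le_of_lt hy)

theorem hasDerivAt_u (h : IsCapProfile κ H u R ξ₁) {ξ : ℝ} (h0 : 0 < ξ) (hξ : ξ < R) :
    HasDerivAt u (2 * H (angleFn κ u ξ)) ξ := by
  have := h.hasDerivAt ξ ⟨h0, hξ⟩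
  rwa [angleFn, if_neg h0.not_ge]

theorem hasDerivAt_slopeRatio (h : IsCapProfile κ H u R ξ₁) {ξ : ℝ} (h0 : 0 < ξ) (hξ : ξ < R) :
    HasDerivAt (slopeRatio κ H u) (slopeRatioDeriv κ H u ξ) ξ := by
  have hσ := h.radiusSq_pos ξ ⟨h0, hξ.le⟩
  have h1 := (h.hasDerivAt_u h0 hξ).div (hasDerivAt_radiusSq κ ξ) hσ.ne'
  refine (h1.congr_deriv ?_).congr_of_eventuallyEq ?_
  · rw [slopeRatioDeriv, slopeRatio, if_neg h0.not_ge]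
    field_simp
  · filter_upwards [lt_mem_nhds h0] with y hy
    rw [slopeRatio, if_neg (not_le.2 hy), Pi.div_apply]

theorem hasDerivAt_angleFn (h : IsCapProfile κ H u R ξ₁) {ξ : ℝ} (h0 : 0 < ξ) (hξ : ξ < ξ₁) :
    HasDerivAt (angleFn κ u) (angleFnDeriv κ H u ξ) ξ := by
  have hR := hξ.trans h.end_lt
  have h1 := ((h.hasDerivAt_u h0 hR).mul (h.hasDerivAt_slopeRatio h0 hR)).const_sub 1
  have h2 := h.angleFn_sq h0.le hξ.le
  have h3 := h.angleFn_pos hξ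
  have h4 := h1.sqrt (by simp only [Pi.mul_apply]; rw [← h2]; positivity)
  refine (h4.congr_deriv ?_).congr_of_eventuallyEq ?_
  · simp only [Pi.mul_apply]
    rw [← h2, Real.sqrt_sq h3.le, angleFnDeriv]
  · filter_upwards [Ioo_mem_nhds h0 hξ] with y hy
    simp only [Pi.mul_apply]
    rw [← h.angleFn_sq hy.1.le hy.2.le, Real.sqrt_sq (angleFn_nonneg _ _ _)]

theorem hasDerivAt_slopeFn (h : IsCapProfile κ H u R ξ₁) {ξ : ℝ} (h0 : 0 < ξ) (hξ : ξ < ξ₁) :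
    HasDerivAt (slopeFn κ H u) (slopeFnDeriv κ H u ξ) ξ :=
  (h.hasDerivAt_slopeRatio h0 (hξ.trans h.end_lt)).div (h.hasDerivAt_angleFn h0 hξ)
    (h.angleFn_pos hξ).ne'

theorem continuousOn_slopeFn (h : IsCapProfile κ H u R ξ₁) :
    ContinuousOn (slopeFn κ H u) (Iio ξ₁) := fun _ hξ =>
  ((h.continuousAt_slopeRatio (lt_trans hξ h.end_lt)).div
    (h.continuousAt_angleFn (lt_trans hξ h.end_lt)) (h.angleFn_pos hξ).ne').continuousWithinAt

/-- The long expression is ξ times the derivative of the slope, with the factor ξ of σ = ξ(2 − κξ)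
cancelled. In this form it is visibly continuous at the axis. -/
theorem continuousAt_mul_slopeFnDeriv (h : IsCapProfile κ H u R ξ₁)
    (hH : ContinuousOn H (Icc (-1) 1)) {ξ : ℝ} (hξ : ξ < ξ₁) (hξ' : 2 - κ * ξ ≠ 0) :
    ContinuousAt (fun ξ => ((2 * H (angleFn κ u ξ) - 2 * slopeRatio κ H u ξ * (1 - κ * ξ)) /
      (2 - κ * ξ) * angleFn κ u ξ - slopeRatio κ H u ξ *
      (-(2 * H (angleFn κ u ξ) * slopeRatio κ H u ξ * ξ + u ξ *
      ((2 * H (angleFn κ u ξ) - 2 * slopeRatio κ H u ξ * (1 - κ * ξ)) / (2 - κ * ξ))) /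
    (2 * angleFn κ u ξ))) / angleFn κ u ξ ^ 2) ξ := by
  have hR := hξ.trans h.end_lt
  have key : ∀ q ν w : ℝ → ℝ, ContinuousAt q ξ → ContinuousAt ν ξ → ContinuousAt w ξ → ν ξ ≠ 0 →
      ContinuousAt (fun ξ => ((2 * w ξ - 2 * q ξ * (1 - κ * ξ)) / (2 - κ * ξ) * ν ξ - q ξ *
      (-(2 * w ξ * q ξ * ξ + u ξ * ((2 * w ξ - 2 * q ξ * (1 - κ * ξ)) / (2 - κ * ξ))) /
      (2 * ν ξ))) / ν ξ ^ 2) ξ := by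
    intro q ν w c1 c2 c3 hp
    have c4 := h.continuous
    have c5 : ContinuousAt (fun ξ => (2 * w ξ - 2 * q ξ * (1 - κ * ξ)) / (2 - κ * ξ)) ξ :=
      ContinuousAt.div (by fun_prop) (by fun_prop) hξ'
    have c6 : ContinuousAt (fun ξ => -(2 * w ξ * q ξ * ξ + u ξ *
        ((2 * w ξ - 2 * q ξ * (1 - κ * ξ)) / (2 - κ * ξ))) / (2 * ν ξ)) ξ :=
      ContinuousAt.div (by fun_prop) (by fun_prop) (by positivity)
    exact ContinuousAt.div (by fun_prop) (by fun_prop) (by positivity)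
  exact key _ _ _ (h.continuousAt_slopeRatio hR) (h.continuousAt_angleFn hR)
    (h.continuousAt_H_angleFn hH hR) (h.angleFn_pos hξ).ne'

theorem mul_slopeFnDeriv (h : IsCapProfile κ H u R ξ₁) {ξ : ℝ} (h0 : 0 < ξ) (hξ : ξ < ξ₁) :
    ξ * slopeFnDeriv κ H u ξ =
      ((2 * H (angleFn κ u ξ) - 2 * slopeRatio κ H u ξ * (1 - κ * ξ)) /
      (2 - κ * ξ) * angleFn κ u ξ - slopeRatio κ H u ξ *
      (-(2 * H (angleFn κ u ξ) * slopeRatio κ H u ξ * ξ + u ξ *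
      ((2 * H (angleFn κ u ξ) - 2 * slopeRatio κ H u ξ * (1 - κ * ξ)) / (2 - κ * ξ))) /
    (2 * angleFn κ u ξ))) / angleFn κ u ξ ^ 2 := by
  have h1 := (h.two_sub_pos h0.le (hξ.trans h.end_lt).le).ne'
  have h2 := (h.angleFn_pos hξ).ne'
  have e : radiusSq κ ξ = ξ * (2 - κ * ξ) := by unfold radiusSq; ring
  unfold slopeFnDeriv angleFnDeriv slopeRatioDeriv
  rw [e]
  field_simp

theorem continuousOn_slopeFnDeriv (h : IsCapProfile κ H u R ξ₁)
    (hH : ContinuousOn H (Icc (-1) 1)) : ContinuousOn (slopeFnDeriv κ H u) (Ioo 0 ξ₁) := by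
  intro ξ hξ
  have h1 := (h.two_sub_pos hξ.1.le (hξ.2.trans h.end_lt).le).ne'
  refine (((h.continuousAt_mul_slopeFnDeriv hH hξ.2 h1).div continuousAt_id hξ.1.ne').congr
    ?_).continuousWithinAt
  filter_upwards [Ioo_mem_nhds hξ.1 hξ.2] with y hy
  rw [Pi.div_apply, ← h.mul_slopeFnDeriv hy.1 hy.2, id, mul_div_cancel_left₀ _ hy.1.ne']

/-- At the axis the cancelled formula reduces to the difference 2H(1) − 2H(1). Vanishing of this
limit is exactly what makes the radial graph C² there. -/
theorem tendsto_mul_slopeFnDeriv (h : IsCapProfile κ H u R ξ₁)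
    (hH : ContinuousOn H (Icc (-1) 1)) :
    Tendsto (fun ξ => ξ * slopeFnDeriv κ H u ξ) (𝓝[>] 0) (𝓝 0) := by
  have h1 := (h.continuousAt_mul_slopeFnDeriv hH h.pos_end (by norm_num)).tendsto.mono_left
    (nhdsWithin_le_nhds (s := Ioi 0))
  have e1 : angleFn κ u 0 = 1 := by rw [angleFn, if_pos le_rfl]
  have e2 : slopeRatio κ H u 0 = H 1 := by rw [slopeRatio, if_pos le_rfl]
  simp only [e1, e2, h.zero, mul_zero, sub_zero, mul_one, sub_self, zero_div, add_zero,
    neg_zero] at h1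
  refine h1.congr' ?_
  filter_upwards [Ioo_mem_nhdsGT h.pos_end] with ξ hξ
  exact (h.mul_slopeFnDeriv hξ.1 hξ.2).symm

/-- Existence of the height function `f` of the (upper) cap, and of its inverse `Ξ` near the
equator, extended by reflection. -/
theorem exists_height (h : IsCapProfile κ H u R ξ₁) (hH : ContinuousOn H (Icc (-1) 1))
    (hH1 : 0 < H 1) :
    ∃ f : ℝ → ℝ, f ξ₁ = 0 ∧ ContinuousOn f (Iic ξ₁) ∧ StrictAntiOn f (Icc 0 ξ₁) ∧
      (∀ ξ < ξ₁, HasDerivAt f (-slopeFn κ H u ξ) ξ) ∧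
      ∃ ε > 0, ∃ Ξ Ξ' Ξ'' : ℝ → ℝ, Ξ 0 = ξ₁ ∧ Ξ' 0 = 0 ∧
        Ξ'' 0 = 1 - κ * ξ₁ - 2 * H 0 * u ξ₁ ∧
        ∀ ζ ∈ Ioo (-ε) ε, Ξ ζ ∈ Ioc 0 ξ₁ ∧ f (Ξ ζ) = |ζ| ∧ HasDerivAt Ξ (Ξ' ζ) ζ ∧
          HasDerivAt Ξ' (Ξ'' ζ) ζ ∧ ContinuousAt Ξ'' ζ := by
  -- Γ = (σν/u)² is the squared reciprocal of the slope, written without ν so that it is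
  -- differentiable at ξ₁. There Γ' = 2(1 − κξ₁ − 2H(0)u), negative by transversality.
  set Γ : ℝ → ℝ := fun ξ => radiusSq κ ξ * (radiusSq κ ξ - u ξ ^ 2) / u ξ ^ 2
  set Γ' : ℝ → ℝ := fun ξ => ((2 * (1 - κ * ξ) * (radiusSq κ ξ - u ξ ^ 2) + radiusSq κ ξ *
    (2 * (1 - κ * ξ) - 2 * u ξ * (2 * H (angleFn κ u ξ)))) * u ξ ^ 2 -
    radiusSq κ ξ * (radiusSq κ ξ - u ξ ^ 2) * (2 * u ξ * (2 * H (angleFn κ u ξ)))) /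
      (u ξ ^ 2) ^ 2 with hΓ'
  have hΓ : ∀ ξ ∈ Ioc 0 ξ₁, HasDerivAt Γ (Γ' ξ) ξ := fun ξ hξ => by
    have h1 := (h.hasDerivAt_u hξ.1 (hξ.2.trans_lt h.end_lt)).fun_pow 2
    simp only [Nat.cast_ofNat, Nat.add_one_sub_one, pow_one] at h1
    have h2 := hasDerivAt_radiusSq κ ξ
    exact (h2.fun_mul (h2.fun_sub h1)).fun_div h1 (pow_ne_zero 2 (h.pos ξ hξ).ne')
  have hΓ'c : ContinuousOn Γ' (Ioc 0 ξ₁) := fun ξ hξ => by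
    have key : ∀ w σ : ℝ → ℝ, ContinuousAt w ξ → Continuous σ →
        ContinuousAt (fun ξ => ((2 * (1 - κ * ξ) * (σ ξ - u ξ ^ 2) + σ ξ *
          (2 * (1 - κ * ξ) - 2 * u ξ * (2 * w ξ))) * u ξ ^ 2 -
          σ ξ * (σ ξ - u ξ ^ 2) * (2 * u ξ * (2 * w ξ))) / (u ξ ^ 2) ^ 2) ξ := by
      intro w σ c1 c3
      have c2 := h.continuous
      have hp := (h.pos ξ hξ).ne'
      exact ContinuousAt.div (by fun_prop) (by fun_prop) (by positivity)
    exact (key _ _ (h.continuousAt_H_angleFn hH (hξ.2.trans_lt h.end_lt))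
      (continuous_radiusSq κ)).continuousWithinAt
  have hΓ0 : Γ ξ₁ = 0 := by simp only [Γ, h.sq_end, sub_self, mul_zero, zero_div]
  have hσ1 := h.radiusSq_pos ξ₁ ⟨h.pos_end, h.end_lt.le⟩
  have hΓ'1 : Γ' ξ₁ = 2 * (1 - κ * ξ₁ - 2 * H 0 * u ξ₁) := by
    simp only [hΓ', h.sq_end, sub_self, mul_zero, zero_mul, h.angleFn_end]
    field_simp; ring
  have hΓpos : ∀ ξ ∈ Ioo 0 ξ₁, 0 < Γ ξ := fun ξ hξ => by
    have h1 := h.sq_lt ξ hξ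
    have h2 := h.pos ξ ⟨hξ.1, hξ.2.le⟩
    have h3 := h.radiusSq_pos ξ ⟨hξ.1, (hξ.2.trans h.end_lt).le⟩
    have h4 : 0 < radiusSq κ ξ - u ξ ^ 2 := by linarith
    simp only [Γ]; positivity
  have hgΓ : ∀ ξ ∈ Ioo 0 ξ₁, slopeFn κ H u ξ = 1 / √(Γ ξ) := fun ξ hξ => by
    have h2 := h.pos ξ ⟨hξ.1, hξ.2.le⟩
    have h3 := h.radiusSq_pos ξ ⟨hξ.1, (hξ.2.trans h.end_lt).le⟩
    have h5 := h.angleFn_pos hξ.2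
    have e : Γ ξ = (radiusSq κ ξ * angleFn κ u ξ / u ξ) ^ 2 := by
      rw [div_pow, mul_pow, h.angleFn_sq hξ.1.le hξ.2.le, slopeRatio, if_neg hξ.1.not_ge]
      simp only [Γ]; field_simp
    rw [e, Real.sqrt_sq (by positivity), slopeFn, slopeRatio, if_neg hξ.1.not_ge]
    field_simp
  have htr := h.transversal
  obtain ⟨f, hf0, hfc, hfd⟩ := exists_primitive_of_simple_zero h.pos_end h.continuousOn_slopeFn
    (hΓ ξ₁ ⟨h.pos_end, le_rfl⟩) (by rw [hΓ'1]; linarith) hΓ0 hgΓ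
  obtain ⟨ε, hε, Ξ, Ξ', hΞ0, hΞ'0, hΞ⟩ := exists_reflected_inverse h.pos_end hf0 hfc hfd hΓ hΓ'c
    hΓ0 hΓpos hgΓ
  refine ⟨f, hf0, hfc, ?_, hfd, ε, hε, Ξ, Ξ', fun ζ => Γ' (Ξ ζ) / 2, hΞ0, hΞ'0, ?_, hΞ⟩
  · refine strictAntiOn_of_deriv_neg (convex_Icc _ _) (hfc.mono fun x hx => hx.2) fun x hx => ?_
    rw [interior_Icc] at hx
    rw [(hfd x hx.2).deriv, neg_neg_iff_pos]
    exact div_pos (h.slopeRatio_pos hH1 hx.2.le) (h.angleFn_pos hx.2)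
  · show Γ' (Ξ 0) / 2 = _
    rw [hΞ0, hΓ'1]; ring

end IsCapProfile

/-! ### C² regularity of radial functions in the plane -/

/-- A product rule in which the first factor need only be continuous, because the second one
vanishes at the point. It yields second derivatives of the charts without differentiating their
coefficients. -/
theorem hasDerivAt_mul_of_eq_zero {A B : ℝ → ℝ} {x B' : ℝ} (hA : ContinuousAt A x)
    (hB : HasDerivAt B B' x) (h0 : B x = 0) : HasDerivAt (fun t => A t * B t) (A x * B') x := by
  rw [hasDerivAt_iff_tendsto_slope] at hB ⊢
  refine ((hA.tendsto.mono_left nhdsWithin_le_nhds).mul hB).congr fun t => ?_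
  simp only [slope_def_field, h0, mul_zero, sub_zero]
  ring

theorem contDiffOn_two_of_hasDerivAt {f f' f'' : ℝ → ℝ} {s : Set ℝ} (hs : IsOpen s)
    (h1 : ∀ x ∈ s, HasDerivAt f (f' x) x) (h2 : ∀ x ∈ s, HasDerivAt f' (f'' x) x)
    (h3 : ContinuousOn f'' s) : ContDiffOn ℝ 2 f s := by
  rw [show (2 : WithTop ℕ∞) = 1 + 1 by norm_num, contDiffOn_succ_iff_deriv_of_isOpen hs]
  refine ⟨fun x hx => (h1 x hx).differentiableAt.differentiableWithinAt, by simp, ?_⟩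
  have e : EqOn (deriv f) f' s := fun x hx => (h1 x hx).deriv
  refine ContDiffOn.congr ?_ e
  rw [show (1 : WithTop ℕ∞) = 0 + 1 by norm_num, contDiffOn_succ_iff_deriv_of_isOpen hs]
  refine ⟨fun x hx => (h2 x hx).differentiableAt.differentiableWithinAt, by simp, ?_⟩
  rw [contDiffOn_zero]
  exact h3.congr fun x hx => (h2 x hx).deriv

theorem contDiffOn_one_of_hasFDerivAt {E F : Type*} [NormedAddCommGroup E] [NormedSpace ℝ E]
    [NormedAddCommGroup F] [NormedSpace ℝ F] {f : E → F} {f' : E → E →L[ℝ] F} {s : Set E}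
    (hs : IsOpen s) (h1 : ∀ x ∈ s, HasFDerivAt f (f' x) x) (h2 : ContinuousOn f' s) :
    ContDiffOn ℝ 1 f s := by
  rw [show (1 : WithTop ℕ∞) = 0 + 1 by norm_num, contDiffOn_succ_iff_fderiv_of_isOpen hs]
  refine ⟨fun x hx => (h1 x hx).differentiableAt.differentiableWithinAt, by simp, ?_⟩
  rw [contDiffOn_zero]
  exact h2.congr fun x hx => (h1 x hx).fderiv

/-- The squared norm of the plane. -/
def planeSq (q : ℝ × ℝ) : ℝ := q.1 ^ 2 + q.2 ^ 2

theorem continuous_planeSq : Continuous planeSq := by unfold planeSq; fun_prop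

theorem planeSq_nonneg (q : ℝ × ℝ) : 0 ≤ planeSq q := by unfold planeSq; positivity

theorem planeSq_pos {q : ℝ × ℝ} (hq : q ≠ 0) : 0 < planeSq q := by
  unfold planeSq
  rcases eq_or_ne q.1 0 with h | h
  · have : q.2 ≠ 0 := fun h' => hq (Prod.ext h h')
    positivity
  · positivity

theorem isOpen_planeDisk (r : ℝ) : IsOpen {q : ℝ × ℝ | planeSq q < r} :=
  isOpen_lt continuous_planeSq continuous_const

theorem hasFDerivAt_planeSq (q : ℝ × ℝ) : HasFDerivAt planeSq
    ((2 * q.1) • ContinuousLinearMap.fst ℝ ℝ ℝ + (2 * q.2) • ContinuousLinearMap.snd ℝ ℝ ℝ) q := by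
  have h := ((hasFDerivAt_fst (𝕜 := ℝ) (p := q)).pow 2).add ((hasFDerivAt_snd (𝕜 := ℝ) (p := q)).pow 2)
  refine HasFDerivAt.congr_fderiv (f := planeSq) h ?_
  ext <;> simp

/-- The partial derivatives are G + 2x²G' and 2xyG'. Their singular factors are bounded by 2|ξG'|
with ξ = x² + y², which tends to 0 at the origin. -/
theorem contDiffOn_fst_mul_radial {G G' : ℝ → ℝ} {r : ℝ} (hG : ContinuousOn G (Iio r))
    (hG' : ∀ ξ ∈ Ioo 0 r, HasDerivAt G (G' ξ) ξ) (hG'c : ContinuousOn G' (Ioo 0 r))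
    (h0 : Tendsto (fun ξ => ξ * G' ξ) (𝓝[>] 0) (𝓝 0)) :
    ContDiffOn ℝ 1 (fun q : ℝ × ℝ => q.1 * G (planeSq q)) {q | planeSq q < r} := by
  have hT : ContinuousWithinAt (fun ξ => ξ * G' ξ) (Ici 0) 0 := by
    rw [← continuousWithinAt_Ioi_iff_Ici, ContinuousWithinAt, zero_mul]
    exact h0
  have hTN : ContinuousAt (fun q : ℝ × ℝ => planeSq q * G' (planeSq q)) 0 := by
    have e : planeSq 0 = 0 := by simp [planeSq]
    have h1 : Tendsto planeSq (𝓝 0) (𝓝[≥] 0) := by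
      refine tendsto_nhdsWithin_iff.2 ⟨?_, Eventually.of_forall planeSq_nonneg⟩
      have := continuous_planeSq.tendsto 0
      rwa [e] at this
    have h2 := Tendsto.comp hT h1
    simpa [ContinuousAt, e, Function.comp_def] using h2
  have hGc : ∀ q : ℝ × ℝ, planeSq q < r → ContinuousAt (fun q => G (planeSq q)) q := fun q hq =>
    ContinuousAt.comp (f := planeSq) (hG.continuousAt (Iio_mem_nhds hq))
      continuous_planeSq.continuousAt
  have hcoef : ∀ ℓ : ℝ × ℝ → ℝ, Continuous ℓ → (∀ q, |ℓ q| ≤ 2 * planeSq q) →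
      ContinuousOn (fun q => ℓ q * G' (planeSq q)) {q | planeSq q < r} := by
    intro ℓ hℓ hb q hq
    rcases eq_or_ne q 0 with rfl | hne
    · have e : ℓ 0 = 0 := by
        have := hb 0
        simpa [planeSq] using this
      refine ContinuousAt.continuousWithinAt ?_
      rw [ContinuousAt, e, zero_mul]
      have h2 := hTN.tendsto.abs.const_mul 2
      rw [show planeSq 0 = 0 by simp [planeSq], zero_mul, abs_zero, mul_zero] at h2
      refine squeeze_zero_norm (fun q => ?_) h2
      rw [norm_mul, abs_mul, Real.norm_eq_abs, Real.norm_eq_abs, ← mul_assoc,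
        abs_of_nonneg (planeSq_nonneg q)]
      gcongr
      exact hb q
    · have hm : planeSq q ∈ Ioo 0 r := ⟨planeSq_pos hne, hq⟩
      exact (hℓ.continuousAt.mul (ContinuousAt.comp (f := planeSq)
        (hG'c.continuousAt (Ioo_mem_nhds hm.1 hm.2))
        continuous_planeSq.continuousAt)).continuousWithinAt
  refine contDiffOn_one_of_hasFDerivAt (isOpen_planeDisk r)
    (f' := fun q => (G (planeSq q) + 2 * q.1 ^ 2 * G' (planeSq q)) • ContinuousLinearMap.fst ℝ ℝ ℝ +
      (2 * (q.1 * q.2) * G' (planeSq q)) • ContinuousLinearMap.snd ℝ ℝ ℝ) ?_ ?_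
  · intro q hq
    rcases eq_or_ne q 0 with rfl | hne
    -- At the origin xG − xG(0) is o(|q|) by continuity of G alone.
    · have h1 := hGc 0 hq
      simp only [Prod.fst_zero, Prod.snd_zero, ne_eq, OfNat.ofNat_ne_zero, not_false_eq_true,
        zero_pow, mul_zero, zero_mul, add_zero, zero_smul]
      rw [hasFDerivAt_iff_isLittleO_nhds_zero]
      have h2 : (fun h : ℝ × ℝ => G (planeSq h) - G (planeSq 0)) =o[𝓝 0] (fun _ => (1 : ℝ)) := by
        rw [Asymptotics.isLittleO_one_iff]
        simpa using h1.tendsto.sub_const (G (planeSq 0))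
      have h3 : (fun h : ℝ × ℝ => h.1) =O[𝓝 0] (fun h => h) :=
        Asymptotics.isBigO_of_le _ fun h => norm_fst_le h
      have h5 := (h3.norm_right.mul_isLittleO h2)
      refine Asymptotics.IsLittleO.of_norm_right ?_
      refine h5.congr (fun h => ?_) (fun h => by simp)
      simp
      ring
    · have hm : planeSq q ∈ Ioo 0 r := ⟨planeSq_pos hne, hq⟩
      have h1 := (hG' _ hm).comp_hasFDerivAt q (hasFDerivAt_planeSq q)
      have h2 := (hasFDerivAt_fst (𝕜 := ℝ) (p := q)).mul h1
      refine h2.congr_fderiv ?_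
      ext <;> simp <;> ring
  · have h1 := hcoef (fun q => 2 * q.1 ^ 2) (by fun_prop) (fun q => by
      unfold planeSq
      rw [abs_of_nonneg (by positivity)]
      nlinarith [sq_nonneg q.2])
    have h2 := hcoef (fun q => 2 * (q.1 * q.2)) (by fun_prop) (fun q => by
      unfold planeSq
      rw [abs_le]
      constructor <;> nlinarith [sq_nonneg (q.1 + q.2), sq_nonneg (q.1 - q.2)])
    have h3 : ContinuousOn (fun q : ℝ × ℝ => G (planeSq q)) {q | planeSq q < r} :=
      fun q hq => (hGc q hq).continuousWithinAt
    exact ((h3.add h1).smul continuousOn_const).add (h2.smul continuousOn_const)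

/-- Regularity of a radial function of the plane in terms of its expression in the squared
radius. -/
theorem contDiffOn_radial {F G G' : ℝ → ℝ} {r : ℝ} (hF : ∀ ξ < r, HasDerivAt F (G ξ) ξ)
    (hG : ContinuousOn G (Iio r)) (hG' : ∀ ξ ∈ Ioo 0 r, HasDerivAt G (G' ξ) ξ)
    (hG'c : ContinuousOn G' (Ioo 0 r)) (h0 : Tendsto (fun ξ => ξ * G' ξ) (𝓝[>] 0) (𝓝 0)) :
    ContDiffOn ℝ 2 (fun q : ℝ × ℝ => F (planeSq q)) {q | planeSq q < r} := by
  have hP := contDiffOn_fst_mul_radial hG hG' hG'c h0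
  have hP' : ContDiffOn ℝ 1 (fun q : ℝ × ℝ => q.2 * G (planeSq q)) {q | planeSq q < r} := by
    have hs : ContDiffOn ℝ 1 (fun q : ℝ × ℝ => (q.2, q.1)) {q | planeSq q < r} := by fun_prop
    have := hP.comp hs (fun q hq => by
      simp only [planeSq, mem_ofPred_eq] at hq ⊢; linarith)
    refine this.congr fun q _ => ?_
    simp [planeSq, add_comm]
  have hd : ∀ q ∈ {q | planeSq q < r}, HasFDerivAt (fun q : ℝ × ℝ => F (planeSq q))
      ((2 * (q.1 * G (planeSq q))) • ContinuousLinearMap.fst ℝ ℝ ℝ +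
        (2 * (q.2 * G (planeSq q))) • ContinuousLinearMap.snd ℝ ℝ ℝ) q := fun q hq => by
    refine ((hF _ hq).comp_hasFDerivAt q (hasFDerivAt_planeSq q)).congr_fderiv ?_
    ext <;> simp <;> ring
  rw [show (2 : WithTop ℕ∞) = 1 + 1 by norm_num,
    contDiffOn_succ_iff_fderiv_of_isOpen (isOpen_planeDisk r)]
  refine ⟨fun q hq => (hd q hq).differentiableAt.differentiableWithinAt, by simp, ?_⟩
  refine ContDiffOn.congr ?_ fun q hq => (hd q hq).fderiv
  exact ((contDiffOn_const.mul hP).smul contDiffOn_const).add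
    ((contDiffOn_const.mul hP').smul contDiffOn_const)

/-! ### Local parametrizations and mean curvature from coordinate lines -/

theorem HasFDerivAt.clm_comp_line {E F : Type*} [NormedAddCommGroup E] [NormedSpace ℝ E]
    [NormedAddCommGroup F] [NormedSpace ℝ F] {D : E → E →L[ℝ] F} {D' : E →L[ℝ] E →L[ℝ] F} {q v : E}
    (hD : HasFDerivAt D D' q) : HasDerivAt (fun t : ℝ => D (q + t • v) v) (D' v v) 0 := by
  have hline : HasDerivAt (fun t : ℝ => q + t • v) v 0 := by
    simpa using ((hasDerivAt_id (0 : ℝ)).smul_const v).const_add q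
  have h7 : HasFDerivAt D D' (q + (0 : ℝ) • v) := by
    rwa [zero_smul, add_zero]
  have h8 : HasDerivAt (fun t : ℝ => D (q + t • v)) (D' v) 0 := h7.comp_hasDerivAt (0 : ℝ) hline
  exact ((ContinuousLinearMap.apply ℝ F v).hasFDerivAt).comp_hasDerivAt (0 : ℝ) h8

/-- Reduces diagonal second derivatives of a chart to one-variable calculus. These suffice for the
mean curvature when the coordinate lines are orthogonal at the point, because the mixed coefficient
is then multiplied by 0. -/
theorem fderiv_fderiv_of_line {E F : Type*} [NormedAddCommGroup E] [NormedSpace ℝ E]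
    [NormedAddCommGroup F] [NormedSpace ℝ F] {φ : E → F} {U : Set E} {q v : E} {c' : ℝ → F} {c'' : F}
    (hU : IsOpen U) (hφ : ContDiffOn ℝ 2 φ U) (hq : q ∈ U)
    (h1 : ∀ᶠ t in 𝓝 (0 : ℝ), HasDerivAt (fun t : ℝ => φ (q + t • v)) (c' t) t)
    (h2 : HasDerivAt c' c'' 0) :
    fderiv ℝ φ q v = c' 0 ∧ fderiv ℝ (fderiv ℝ φ) q v v = c'' := by
  have hline : ∀ t : ℝ, HasDerivAt (fun t : ℝ => q + t • v) v t := fun t => by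
    simpa using ((hasDerivAt_id t).smul_const v).const_add q
  have hmem : ∀ᶠ t in 𝓝 (0 : ℝ), q + t • v ∈ U := by
    have : ContinuousAt (fun t : ℝ => q + t • v) 0 := (hline 0).continuousAt
    exact this.eventually (by simpa using hU.mem_nhds hq)
  have he : ∀ᶠ t in 𝓝 (0 : ℝ), c' t = fderiv ℝ φ (q + t • v) v := by
    filter_upwards [h1, hmem] with t h3 h4
    have h5 := ((hφ.contDiffAt (hU.mem_nhds h4)).differentiableAt two_ne_zero).hasFDerivAt
    exact h3.unique (h5.comp_hasDerivAt t (hline t))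
  have h0 := he.self_of_nhds
  rw [zero_smul, add_zero] at h0
  refine ⟨h0.symm, ?_⟩
  have h6 : DifferentiableAt ℝ (fderiv ℝ φ) q :=
    ((hφ.contDiffAt (hU.mem_nhds hq)).fderiv_right (m := 1) (by norm_num)).differentiableAt
      one_ne_zero
  have h7 : HasDerivAt (fun t : ℝ => fderiv ℝ φ (q + t • v) v) (fderiv ℝ (fderiv ℝ φ) q v v) 0 :=
    h6.hasFDerivAt.clm_comp_line
  exact (h7.congr_of_eventuallyEq he).unique h2

open ProductSurface

/-- The local condition at `p` in the definition of an `H`-surface with unit normal `n` at `p`. -/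
def HasLocalParam (κ : ℝ) (H : ℝ → ℝ) (S : Set Ambient) (p n : Ambient) : Prop :=
  ∃ (U : Set (ℝ × ℝ)) (φ : ℝ × ℝ → Ambient) (q : ℝ × ℝ),
    IsLocalParam S U φ ∧ q ∈ U ∧ φ q = p ∧ (∀ v, ambientForm κ (fderiv ℝ φ q v) n = 0) ∧
    meanCurvature κ φ n q = H (ambientForm κ n vertical)

/-- A left inverse I, differentiable on an open set of the ambient space, gives everything at once:
the chain rule for I ∘ φ = id gives the immersion, and the image of W is cut out of S by the open
set O ∩ I⁻¹(W). -/
theorem isLocalParam_of_leftInverse {S O : Set Ambient} {U : Set (ℝ × ℝ)} {φ : ℝ × ℝ → Ambient}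
    {I : Ambient → ℝ × ℝ} (hU : IsOpen U) (hφ : ContDiffOn ℝ 2 φ U) (hO : IsOpen O)
    (hI : DifferentiableOn ℝ I O) (hmap : ∀ q ∈ U, φ q ∈ S ∧ φ q ∈ O ∧ I (φ q) = q)
    (hinv : ∀ p ∈ S, p ∈ O → I p ∈ U → φ (I p) = p) : IsLocalParam S U φ where
  isOpen := hU
  contDiffOn := hφ
  immersion := fun q hq => by
    have h1 := ((hφ.contDiffAt (hU.mem_nhds hq)).differentiableAt two_ne_zero).hasFDerivAt
    have h2 := (hI.differentiableAt (hO.mem_nhds (hmap q hq).2.1)).hasFDerivAt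
    have h3 := h2.comp q h1
    have h4 : HasFDerivAt (I ∘ φ) (ContinuousLinearMap.id ℝ (ℝ × ℝ)) q := by
      refine (hasFDerivAt_id q).congr_of_eventuallyEq ?_
      filter_upwards [hU.mem_nhds hq] with x hx
      exact (hmap x hx).2.2
    have h5 := h3.unique h4
    intro v w hvw
    have h6 : ∀ v, fderiv ℝ I (φ q) (fderiv ℝ φ q v) = v := fun v => by
      have := congrArg (fun L => L v) h5
      simpa using this
    rw [← h6 v, ← h6 w, hvw]
  injOn := fun x hx y hy hxy => by
    rw [← (hmap x hx).2.2, ← (hmap y hy).2.2, hxy]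
  image_open := fun W hWU hW => by
    refine ⟨O ∩ I ⁻¹' W, hI.continuousOn.isOpen_inter_preimage hO hW, ?_⟩
    ext p
    constructor
    · rintro ⟨q, hq, rfl⟩
      obtain ⟨h1, h2, h3⟩ := hmap q (hWU hq)
      exact ⟨h1, h2, by rwa [mem_preimage, h3]⟩
    · rintro ⟨h1, h2, h3⟩
      exact ⟨I p, h3, hinv p h1 h2 (hWU h3)⟩

section Forms

variable (κ : ℝ) (u v w : Ambient) (a : ℝ)

theorem ambientForm_apply : ambientForm κ u v =
    u.1 0 * v.1 0 + u.1 1 * v.1 1 + κ * (u.1 2 * v.1 2) + u.2 * v.2 := rfl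

theorem ambientForm_add_left : ambientForm κ (u + v) w = ambientForm κ u w + ambientForm κ v w := by
  simp only [ambientForm_apply, Prod.fst_add, Prod.snd_add, Pi.add_apply]; ring

theorem ambientForm_smul_left : ambientForm κ (a • u) w = a * ambientForm κ u w := by
  simp only [ambientForm_apply, Prod.smul_fst, Prod.smul_snd, Pi.smul_apply, smul_eq_mul]; ring

theorem ambientForm_neg_right : ambientForm κ u (-v) = -ambientForm κ u v := by
  simp only [ambientForm_apply, Prod.fst_neg, Prod.snd_neg, Pi.neg_apply]; ring

theorem ambientForm_vertical : ambientForm κ u vertical = u.2 := by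
  simp [ambientForm_apply, vertical]

end Forms

/-- Data for computing the mean curvature from the coordinate lines of a parametrization with
orthogonal coordinate lines. -/
theorem HasLocalParam.of_lines {κ : ℝ} {H : ℝ → ℝ} {S : Set Ambient} {U : Set (ℝ × ℝ)}
    {φ : ℝ × ℝ → Ambient} {q : ℝ × ℝ} {n c'' d'' : Ambient} {c' d' : ℝ → Ambient}
    (hφ : IsLocalParam S U φ) (hq : q ∈ U)
    (hc : ∀ᶠ t in 𝓝 (0 : ℝ), HasDerivAt (fun t : ℝ => φ (q + t • ((1, 0) : ℝ × ℝ))) (c' t) t)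
    (hc' : HasDerivAt c' c'' 0)
    (hd : ∀ᶠ t in 𝓝 (0 : ℝ), HasDerivAt (fun t : ℝ => φ (q + t • ((0, 1) : ℝ × ℝ))) (d' t) t)
    (hd' : HasDerivAt d' d'' 0)
    (hcd : ambientForm κ (c' 0) (d' 0) = 0) (hcn : ambientForm κ (c' 0) n = 0)
    (hdn : ambientForm κ (d' 0) n = 0)
    (hH : (ambientForm κ c'' n * ambientForm κ (d' 0) (d' 0) +
      ambientForm κ d'' n * ambientForm κ (c' 0) (c' 0)) /
        (2 * (ambientForm κ (c' 0) (c' 0) * ambientForm κ (d' 0) (d' 0))) = H n.2) :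
    HasLocalParam κ H S (φ q) n := by
  obtain ⟨e1, e2⟩ := fderiv_fderiv_of_line hφ.isOpen hφ.contDiffOn hq hc hc'
  obtain ⟨e3, e4⟩ := fderiv_fderiv_of_line hφ.isOpen hφ.contDiffOn hq hd hd'
  refine ⟨U, φ, q, hφ, hq, rfl, fun v => ?_, ?_⟩
  · have : v = v.1 • ((1, 0) : ℝ × ℝ) + v.2 • ((0, 1) : ℝ × ℝ) := by ext <;> simp
    rw [this, map_add, map_smul, map_smul, e1, e3, ambientForm_add_left, ambientForm_smul_left,
      ambientForm_smul_left, hcn, hdn]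
    simp
  · rw [ambientForm_vertical, ← hH]
    simp only [meanCurvature, secondForm, firstForm, e1, e2, e3, e4, hcd]
    ring

theorem ProductSurface.IsLocalParam.comp_equiv {S : Set Ambient} {U : Set (ℝ × ℝ)} {φ : ℝ × ℝ → Ambient}
    (hφ : IsLocalParam S U φ) (A : Ambient ≃L[ℝ] Ambient) (hS : A '' S = S) :
    IsLocalParam S U (A ∘ φ) where
  isOpen := hφ.isOpen
  contDiffOn := A.contDiff.comp_contDiffOn hφ.contDiffOn
  immersion := fun q hq => by
    rw [A.comp_fderiv]
    exact A.injective.comp (hφ.immersion q hq)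
  injOn := A.injective.injOn.comp hφ.injOn (mapsTo_univ _ _)
  image_open := fun W hW hWo => by
    obtain ⟨V, hV, h⟩ := hφ.image_open W hW hWo
    refine ⟨A '' V, A.toHomeomorph.isOpenMap V hV, ?_⟩
    rw [image_comp, h, image_inter A.injective, hS]

/-- The local condition is invariant under linear isometries that preserve the surface. -/
theorem HasLocalParam.comp_equiv {κ : ℝ} {H : ℝ → ℝ} {S : Set Ambient} {p n : Ambient}
    (h : HasLocalParam κ H S p n) (A : Ambient ≃L[ℝ] Ambient) (hS : A '' S = S)
    (hA : ∀ u v, ambientForm κ (A u) (A v) = ambientForm κ u v) (hH : H (A n).2 = H n.2) :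
    HasLocalParam κ H S (A p) (A n) := by
  obtain ⟨U, φ, q, hφ, hq, rfl, hn, hmc⟩ := h
  have e1 : ∀ x v, fderiv ℝ (A ∘ φ) x v = A (fderiv ℝ φ x v) := fun x v => by
    rw [A.comp_fderiv]; rfl
  have hd : DifferentiableAt ℝ (fderiv ℝ φ) q :=
    ((hφ.contDiffOn.contDiffAt (hφ.isOpen.mem_nhds hq)).fderiv_right (m := 1)
      (by norm_num)).differentiableAt one_ne_zero
  have hd' : DifferentiableAt ℝ (fderiv ℝ (A ∘ φ)) q :=
    (((hφ.comp_equiv A hS).contDiffOn.contDiffAt (hφ.isOpen.mem_nhds hq)).fderiv_right (m := 1)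
      (by norm_num)).differentiableAt one_ne_zero
  have e3 : ∀ v w, fderiv ℝ (fderiv ℝ (A ∘ φ)) q v w = A (fderiv ℝ (fderiv ℝ φ) q v w) :=
    fun v w => by
    have h1 := (hd'.hasFDerivAt.clm_apply (hasFDerivAt_const w q))
    have h2 := (A : Ambient →L[ℝ] Ambient).hasFDerivAt.comp q
      (hd.hasFDerivAt.clm_apply (hasFDerivAt_const w q))
    have h3 := h1.unique (h2.congr_of_eventuallyEq (Eventually.of_forall fun t => by
      simp [e1]))
    simpa using congrArg (fun L => L v) h3
  refine ⟨U, A ∘ φ, q, hφ.comp_equiv A hS, hq, rfl, fun v => ?_, ?_⟩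
  · rw [e1, hA, hn]
  · rw [ambientForm_vertical, hH, ← ambientForm_vertical κ n, ← hmc]
    simp only [meanCurvature, secondForm, firstForm, e1, e3, hA]

/-! ### Axial isometries -/

/-- The linear map of the ambient space acting as a rotation of angle with cosine `c` and sine `s`
on the first two coordinates, and multiplying the others by `a` and `b`. -/
def axialMap (c s a b : ℝ) : Ambient →ₗ[ℝ] Ambient where
  toFun p := (![c * p.1 0 - s * p.1 1, s * p.1 0 + c * p.1 1, a * p.1 2], b * p.2)
  map_add' p q := by
    ext i
    · fin_cases i <;> simp <;> ring
    · simp; ring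
  map_smul' t p := by
    ext i
    · fin_cases i <;> simp <;> ring
    · simp; ring

theorem axialMap_apply (c s a b : ℝ) (p : Ambient) : axialMap c s a b p =
    (![c * p.1 0 - s * p.1 1, s * p.1 0 + c * p.1 1, a * p.1 2], b * p.2) := rfl

/-- `axialMap` as an equivalence. -/
noncomputable def axialEquiv (c s a b : ℝ) (hcs : c ^ 2 + s ^ 2 = 1) (ha : a ^ 2 = 1) (hb : b ^ 2 = 1) :
    Ambient ≃L[ℝ] Ambient :=
  (LinearEquiv.ofLinearMap (axialMap c s a b) (axialMap c (-s) a b) (by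
    refine LinearMap.ext fun p => Prod.ext (funext fun i => ?_) ?_
    · fin_cases i <;> simp [axialMap_apply]
      · linear_combination p.1 0 * hcs
      · linear_combination p.1 1 * hcs
      · linear_combination p.1 2 * ha
    · simp [axialMap_apply]
      linear_combination p.2 * hb) (by
    refine LinearMap.ext fun p => Prod.ext (funext fun i => ?_) ?_
    · fin_cases i <;> simp [axialMap_apply]
      · linear_combination p.1 0 * hcs
      · linear_combination p.1 1 * hcs
      · linear_combination p.1 2 * ha
    · simp [axialMap_apply]
      linear_combination p.2 * hb)).toContinuousLinearEquiv

theorem axialEquiv_apply {c s a b : ℝ} (hcs : c ^ 2 + s ^ 2 = 1) (ha : a ^ 2 = 1) (hb : b ^ 2 = 1)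
    (p : Ambient) : axialEquiv c s a b hcs ha hb p =
    (![c * p.1 0 - s * p.1 1, s * p.1 0 + c * p.1 1, a * p.1 2], b * p.2) := rfl

theorem axialEquiv_form {c s a b : ℝ} (hcs : c ^ 2 + s ^ 2 = 1) (ha : a ^ 2 = 1) (hb : b ^ 2 = 1)
    (κ : ℝ) (u v : Ambient) : ambientForm κ (axialEquiv c s a b hcs ha hb u)
      (axialEquiv c s a b hcs ha hb v) = ambientForm κ u v := by
  simp only [axialEquiv_apply, ambientForm_apply, Matrix.cons_val_zero, Matrix.cons_val_one,
    Matrix.cons_val]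
  linear_combination (u.1 0 * v.1 0 + u.1 1 * v.1 1) * hcs + κ * u.1 2 * v.1 2 * ha +
    u.2 * v.2 * hb

theorem axialEquiv_symm_apply {c s a b : ℝ} (hcs : c ^ 2 + s ^ 2 = 1) (ha : a ^ 2 = 1)
    (hb : b ^ 2 = 1) (p : Ambient) : (axialEquiv c s a b hcs ha hb).symm p =
    axialEquiv c (-s) a b (by rwa [neg_sq]) ha hb p := rfl

theorem axialEquiv_image {c s a b : ℝ} (hcs : c ^ 2 + s ^ 2 = 1) (ha : a ^ 2 = 1) (hb : b ^ 2 = 1)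
    {S : Set Ambient} (hS : ∀ c s : ℝ, ∀ hcs : c ^ 2 + s ^ 2 = 1, ∀ p ∈ S,
      axialEquiv c s a b hcs ha hb p ∈ S) : axialEquiv c s a b hcs ha hb '' S = S := by
  refine subset_antisymm (image_subset_iff.2 fun p hp => hS c s hcs p hp) fun p hp => ?_
  refine ⟨(axialEquiv c s a b hcs ha hb).symm p, ?_, ContinuousLinearEquiv.apply_symm_apply _ _⟩
  rw [axialEquiv_symm_apply]
  exact hS _ _ _ p hp

theorem hasDerivAt_ambient {x y z h : ℝ → ℝ} {x' y' z' h' t : ℝ} (hx : HasDerivAt x x' t)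
    (hy : HasDerivAt y y' t) (hz : HasDerivAt z z' t) (hh : HasDerivAt h h' t) :
    HasDerivAt (fun t => ((![x t, y t, z t], h t) : Ambient)) (![x', y', z'], h') t := by
  refine HasDerivAt.prodMk (hasDerivAt_pi.2 fun i => ?_) hh
  fin_cases i <;> simpa

theorem contDiffOn_ambient {E : Type*} [NormedAddCommGroup E] [NormedSpace ℝ E] {s : Set E}
    {x y z h : E → ℝ} (hx : ContDiffOn ℝ 2 x s) (hy : ContDiffOn ℝ 2 y s) (hz : ContDiffOn ℝ 2 z s)
    (hh : ContDiffOn ℝ 2 h s) : ContDiffOn ℝ 2 (fun t => ((![x t, y t, z t], h t) : Ambient)) s := by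
  refine ContDiffOn.prodMk (contDiffOn_pi.2 fun i => ?_) hh
  fin_cases i <;> simpa

/-! ### The chart around the axis and its curvature -/

/-- The area preserving parametrization of a cap of the base surface, lifted to the graph of a
function `F` of the squared radius of the parameter. -/
noncomputable def capChart (κ : ℝ) (F : ℝ → ℝ) (q : ℝ × ℝ) : Ambient :=
  (![q.1 * √(2 - κ * planeSq q), q.2 * √(2 - κ * planeSq q), 1 - κ * planeSq q], F (planeSq q))

/-- In this chart 2 − κξ = 1 + x₃, so the inverse is (x₁, x₂)/√(1 + x₃). The open set O selects one
sheet of the surface. -/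
theorem isLocalParam_capChart {κ r : ℝ} {F : ℝ → ℝ} {S O : Set Ambient} (hκ : κ ^ 2 = 1)
    (hr : ∀ ξ, 0 ≤ ξ → ξ < r → 0 < 2 - κ * ξ)
    (hF : ContDiffOn ℝ 2 (fun q : ℝ × ℝ => F (planeSq q)) {q | planeSq q < r}) (hO : IsOpen O)
    (hmap : ∀ q, planeSq q < r → capChart κ F q ∈ S ∧ capChart κ F q ∈ O)
    (hS : ∀ p ∈ S, p ∈ O → 0 < 1 + p.1 2 →
      p.1 0 ^ 2 + p.1 1 ^ 2 = κ * (1 - p.1 2) * (1 + p.1 2) ∧ p.2 = F (κ * (1 - p.1 2))) :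
    IsLocalParam S {q | planeSq q < r} (capChart κ F) := by
  have hpos : ∀ q, planeSq q < r → 0 < 2 - κ * planeSq q := fun q hq => hr _ (planeSq_nonneg q) hq
  have hN : ContDiff ℝ 2 planeSq := by unfold planeSq; fun_prop
  have hm : ContDiffOn ℝ 2 (fun q : ℝ × ℝ => √(2 - κ * planeSq q)) {q | planeSq q < r} :=
    ContDiffOn.sqrt (contDiff_const.sub (contDiff_const.mul hN)).contDiffOn
      fun q hq => (hpos q hq).ne'
  have h12 : ∀ q, planeSq q < r → 1 + (capChart κ F q).1 2 = 2 - κ * planeSq q := fun q _ => by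
    simp [capChart]; ring
  refine isLocalParam_of_leftInverse (O := O ∩ {p | 0 < 1 + p.1 2})
    (I := fun p => (p.1 0 / √(1 + p.1 2), p.1 1 / √(1 + p.1 2))) (isOpen_planeDisk r) ?_ ?_ ?_ ?_ ?_
  · exact contDiffOn_ambient (contDiff_fst.contDiffOn.mul hm) (contDiff_snd.contDiffOn.mul hm)
      (contDiff_const.sub (contDiff_const.mul hN)).contDiffOn hF
  · exact hO.inter (isOpen_lt continuous_const (by fun_prop))
  · intro p hp
    have h1 : 1 + p.1 2 ≠ 0 := ne_of_gt hp.2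
    have h2 : √(1 + p.1 2) ≠ 0 := (Real.sqrt_pos.2 hp.2).ne'
    have h3 : ∀ i : Fin 3, DifferentiableAt ℝ (fun p : Ambient => p.1 i) p := fun i => by fun_prop
    have h4 : DifferentiableAt ℝ (fun p : Ambient => √(1 + p.1 2)) p :=
      ((h3 2).const_add 1).sqrt h1
    have h5 : ∀ i : Fin 3, DifferentiableAt ℝ (fun p : Ambient => p.1 i / √(1 + p.1 2)) p :=
fun i => by
      simp only [div_eq_mul_inv]
      exact (h3 i).fun_mul (h4.fun_inv h2)
    exact ((h5 0).prodMk (h5 1)).differentiableWithinAt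
  · intro q hq
    have h1 := hpos q hq
    have h2 : √(2 - κ * planeSq q) ≠ 0 := (Real.sqrt_pos.2 h1).ne'
    refine ⟨(hmap q hq).1, ⟨(hmap q hq).2, ?_⟩, ?_⟩
    · rw [mem_ofPred_eq, h12 q hq]; exact h1
    · simp only [h12 q hq]
      simp [capChart, h2]
  · rintro p hp ⟨hpO, hp2⟩ -
    obtain ⟨h1, h2⟩ := hS p hp hpO hp2
    have h3 : 0 < 1 + p.1 2 := hp2
    have h4 : √(1 + p.1 2) ≠ 0 := (Real.sqrt_pos.2 h3).ne'
    have h5 : planeSq (p.1 0 / √(1 + p.1 2), p.1 1 / √(1 + p.1 2)) = κ * (1 - p.1 2) := by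
      simp only [planeSq, div_pow, Real.sq_sqrt h3.le]
      rw [← add_div, h1, mul_div_cancel_right₀ _ h3.ne']
    have h6 : 2 - κ * (κ * (1 - p.1 2)) = 1 + p.1 2 := by linear_combination (p.1 2 - 1) * hκ
    refine Prod.ext (funext fun i => ?_) ?_
    · fin_cases i <;> simp [capChart, h5, h6, h4]
      linear_combination (p.1 2 - 1) * hκ
    · simp [capChart, h5, h2]

/-- The curvature identity of the profile curve in the parameters of `capChart`. -/
theorem cap_curvature_identity {κ α m Q ν h k l : ℝ} (hκ : κ ^ 2 = 1) (hm0 : m ≠ 0) (hν0 : ν ≠ 0)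
    (hm : m ^ 2 = 2 - κ * α ^ 2) (hν : ν ^ 2 = 1 - Q ^ 2 * α ^ 2 * m ^ 2)
    (hk : k * m ^ 2 + 2 * Q * (1 - κ * α ^ 2) = 2 * h)
    (hl : l = (k * ν - Q * (-(2 * h * Q * α ^ 2 + Q * α ^ 2 * m ^ 2 * k) / (2 * ν))) / ν ^ 2) :
    (((-(3 * κ * α) / m - α ^ 3 / m ^ 3) * -(Q * (1 - κ * α ^ 2) * (α * m)) +
      κ * (-(2 * κ) * (κ * (Q * α ^ 2 * m ^ 2))) + (2 * (Q / ν) + 4 * l) * ν) * m ^ 2 +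
      (-(κ * α) / m * -(Q * (1 - κ * α ^ 2) * (α * m)) + κ * (-(2 * κ) * (κ * (Q * α ^ 2 * m ^ 2))) +
        2 * (Q / ν) * ν) * ((2 * (1 - κ * α ^ 2) / m) ^ 2 + κ * (-(2 * κ * α)) ^ 2 +
          (2 * α * (Q / ν)) ^ 2)) /
      (2 * (((2 * (1 - κ * α ^ 2) / m) ^ 2 + κ * (-(2 * κ * α)) ^ 2 + (2 * α * (Q / ν)) ^ 2) *
        m ^ 2)) = h := by
  have hE : (2 * (1 - κ * α ^ 2) / m) ^ 2 + κ * (-(2 * κ * α)) ^ 2 + (2 * α * (Q / ν)) ^ 2 =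
      4 / (m ^ 2 * ν ^ 2) := by
    have e1 : (2 * (1 - κ * α ^ 2) / m) ^ 2 + κ * (-(2 * κ * α)) ^ 2 = 4 / m ^ 2 := by
      field_simp
      linear_combination 4 * κ ^ 3 * α ^ 2 * hm + (8 * κ * α ^ 2 - 4 * κ ^ 2 * α ^ 4) * hκ
    rw [e1]
    field_simp
    linear_combination 4 * hν
  have h2 : -(κ * α) / m * -(Q * (1 - κ * α ^ 2) * (α * m)) +
      κ * (-(2 * κ) * (κ * (Q * α ^ 2 * m ^ 2))) + 2 * (Q / ν) * ν =
        Q * (1 - κ * α ^ 2) * m ^ 2 := by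
    field_simp
    rw [hm]
    linear_combination Q * (2 * κ ^ 2 * α ^ 4 - 4 * κ * α ^ 2) * hκ
  have h3 : (-(3 * κ * α) / m - α ^ 3 / m ^ 3) * -(Q * (1 - κ * α ^ 2) * (α * m)) +
      κ * (-(2 * κ) * (κ * (Q * α ^ 2 * m ^ 2))) + (2 * (Q / ν) + 4 * l) * ν =
        4 / (m ^ 2 * ν ^ 2) * (k * m ^ 2 + Q * (1 - κ * α ^ 2)) := by
    have e1 : l * ν ^ 3 = k + Q ^ 3 * α ^ 2 * (1 - κ * α ^ 2) := by
      rw [hl]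
      field_simp
      linear_combination 2 * k * hν - Q ^ 2 * α ^ 2 * hk
    have e2 : (-(3 * κ * α) / m - α ^ 3 / m ^ 3) * -(Q * (1 - κ * α ^ 2) * (α * m)) +
        κ * (-(2 * κ) * (κ * (Q * α ^ 2 * m ^ 2))) + 2 * Q = 4 * Q * (1 - κ * α ^ 2) / m ^ 2 := by
      field_simp
      rw [hm]
      linear_combination Q * (-(8 * κ * α ^ 2) + α ^ 4 * (8 * κ ^ 2 - 1) + α ^ 6 * (κ - 2 * κ ^ 3)) * hκ -
        2 * Q * α ^ 2 * κ ^ 3 * (m ^ 2 + (2 - κ * α ^ 2)) * hm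
    have e3 : 4 * l * ν = 4 * (k + Q ^ 3 * α ^ 2 * (1 - κ * α ^ 2)) / ν ^ 2 := by
      rw [← e1]; field_simp
    have e4 : (2 * (Q / ν) + 4 * l) * ν = 2 * Q + 4 * l * ν := by field_simp
    rw [e4, ← add_assoc, e2, e3]
    field_simp
    linear_combination Q * (1 - κ * α ^ 2) * hν
  -- The principal curvatures are Q(1 − κα²) along the parallel and km² + Q(1 − κα²) along the
  -- meridian; by the profile equation `hk` their sum is 2h.
  rw [hE, h2, h3]
  have h4 : k * m ^ 2 + Q * (1 - κ * α ^ 2) = 2 * h - Q * (1 - κ * α ^ 2) := by linarith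
  rw [h4]
  field_simp
  ring

/-- The computation is done at (α, 0), where the coordinate lines are orthogonal. Q stands for u/σ,
k for ξ times its derivative, and l for ξ times the derivative of the slope; keeping them as free
parameters lets the axis, the profile and the flat slice be treated together. -/
theorem hasLocalParam_capChart {κ r α Q ν k l : ℝ} {F G G' H : ℝ → ℝ} {S : Set Ambient}
    (hκ : κ ^ 2 = 1) (hF : ∀ ξ < r, HasDerivAt F (G ξ) ξ) (hG : ContinuousAt G (α ^ 2))
    (hG' : α ≠ 0 → HasDerivAt G (G' (α ^ 2)) (α ^ 2))
    (hφ : IsLocalParam S {q | planeSq q < r} (capChart κ F)) (hα : α ^ 2 < r)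
    (hα2 : 0 < 2 - κ * α ^ 2) (hν0 : ν ≠ 0) (hGQ : G (α ^ 2) = Q / ν)
    (hν : ν ^ 2 = 1 - Q ^ 2 * α ^ 2 * (2 - κ * α ^ 2))
    (hk : k * (2 - κ * α ^ 2) + 2 * Q * (1 - κ * α ^ 2) = 2 * H ν) (hlG : l = α ^ 2 * G' (α ^ 2))
    (hl : l = (k * ν - Q * (-(2 * H ν * Q * α ^ 2 + Q * α ^ 2 * (2 - κ * α ^ 2) * k) / (2 * ν))) /
      ν ^ 2) :
    HasLocalParam κ H S (capChart κ F (α, 0))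
      (![-(Q * (1 - κ * α ^ 2) * (α * √(2 - κ * α ^ 2))), 0, κ * (Q * α ^ 2 * (2 - κ * α ^ 2))],
        ν) := by
  set m := √(2 - κ * α ^ 2) with hmdef
  have hm0 : 0 < m := Real.sqrt_pos.2 hα2
  have hm : m ^ 2 = 2 - κ * α ^ 2 := Real.sq_sqrt hα2.le
  have hlin : ∀ t : ℝ, HasDerivAt (fun t : ℝ => α + t) 1 t := fun t => (hasDerivAt_id t).const_add α
  have hsq : ∀ t : ℝ, HasDerivAt (fun t : ℝ => (α + t) ^ 2) (2 * (α + t)) t := fun t => by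
    simpa using (hlin t).fun_pow 2
  have hsq' : ∀ t : ℝ, HasDerivAt (fun t : ℝ => α ^ 2 + t ^ 2) (2 * t) t := fun t => by
    simpa using ((hasDerivAt_id t).fun_pow 2).const_add (α ^ 2)
  have hc1 : ∀ᶠ t in 𝓝 (0 : ℝ), (α + t) ^ 2 < r ∧ 0 < 2 - κ * (α + t) ^ 2 := by
    have c1 : ContinuousAt (fun t : ℝ => (α + t) ^ 2) 0 := by fun_prop
    have c2 : ContinuousAt (fun t : ℝ => 2 - κ * (α + t) ^ 2) 0 := by fun_prop
    exact (c1.eventually (gt_mem_nhds (by simpa using hα))).and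
      (c2.eventually (lt_mem_nhds (by simpa using hα2)))
  have hd1 : ∀ᶠ t in 𝓝 (0 : ℝ), α ^ 2 + t ^ 2 < r ∧ 0 < 2 - κ * (α ^ 2 + t ^ 2) := by
    have c1 : ContinuousAt (fun t : ℝ => α ^ 2 + t ^ 2) 0 := by fun_prop
    have c2 : ContinuousAt (fun t : ℝ => 2 - κ * (α ^ 2 + t ^ 2)) 0 := by fun_prop
    exact (c1.eventually (gt_mem_nhds (by simpa using hα))).and
      (c2.eventually (lt_mem_nhds (by simpa using hα2)))
  have hcm : ∀ t : ℝ, 0 < 2 - κ * (α + t) ^ 2 → HasDerivAt (fun t : ℝ => √(2 - κ * (α + t) ^ 2))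
      (-(κ * (α + t)) / √(2 - κ * (α + t) ^ 2)) t := fun t ht => by
    refine ((((hsq t).const_mul κ).const_sub 2).sqrt ht.ne').congr_deriv ?_
    have := (Real.sqrt_pos.2 ht).ne'
    field_simp
  have hdm : ∀ t : ℝ, 0 < 2 - κ * (α ^ 2 + t ^ 2) →
      HasDerivAt (fun t : ℝ => √(2 - κ * (α ^ 2 + t ^ 2)))
      (-κ / √(2 - κ * (α ^ 2 + t ^ 2)) * t) t := fun t ht => by
    refine ((((hsq' t).const_mul κ).const_sub 2).sqrt ht.ne').congr_deriv ?_
    have := (Real.sqrt_pos.2 ht).ne'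
    field_simp
  have hm00 : √(2 - κ * (α + 0) ^ 2) = m := by rw [add_zero]
  have hm01 : √(2 - κ * (α ^ 2 + 0 ^ 2)) = m := by norm_num [hmdef]
  have hid : HasDerivAt (fun t : ℝ => t) 1 0 := hasDerivAt_id 0
  refine HasLocalParam.of_lines hφ (q := (α, 0))
    (c' := fun t => (![2 * (1 - κ * (α + t) ^ 2) / √(2 - κ * (α + t) ^ 2), 0, -(2 * κ * (α + t))],
      2 * (α + t) * G ((α + t) ^ 2)))
    (c'' := (![-(3 * κ * α) / m - α ^ 3 / m ^ 3, 0, -(2 * κ)], 2 * G (α ^ 2) + 4 * l))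
    (d' := fun t => (![α * (-κ / √(2 - κ * (α ^ 2 + t ^ 2))) * t,
      √(2 - κ * (α ^ 2 + t ^ 2)) + -κ / √(2 - κ * (α ^ 2 + t ^ 2)) * t * t, -(2 * κ) * t],
      G (α ^ 2 + t ^ 2) * 2 * t))
    (d'' := (![-(κ * α) / m, 0, -(2 * κ)], 2 * G (α ^ 2))) ?_ ?_ ?_ ?_ ?_ ?_ ?_ ?_ ?_
  · simpa [planeSq] using hα
  · filter_upwards [hc1] with t ht
    have e : (fun t : ℝ => capChart κ F ((α, 0) + t • ((1, 0) : ℝ × ℝ))) = fun t =>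
        (![(α + t) * √(2 - κ * (α + t) ^ 2), 0, 1 - κ * (α + t) ^ 2], F ((α + t) ^ 2)) := by
      funext t; simp [capChart, planeSq]
    rw [e]
    refine hasDerivAt_ambient ?_ (hasDerivAt_const _ _) ?_ ?_
    · refine ((hlin t).fun_mul (hcm t ht.2)).congr_deriv ?_
      have h1 := (Real.sqrt_pos.2 ht.2).ne'
      field_simp
      rw [Real.sq_sqrt ht.2.le]; ring
    · refine (((hsq t).const_mul κ).const_sub 1).congr_deriv (by ring)
    · refine ((hF _ ht.1).comp t (hsq t)).congr_deriv (by ring)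
  · have hp0 : 0 < 2 - κ * (α + 0) ^ 2 := by simpa using hα2
    refine hasDerivAt_ambient ?_ (hasDerivAt_const _ _) ?_ ?_
    · have h1 := ((((hsq 0).const_mul κ).const_sub 1).const_mul 2).fun_div (hcm 0 hp0)
        (by rw [hm00]; exact hm0.ne')
      refine h1.congr_deriv ?_
      rw [hm00, add_zero]
      field_simp
      rw [hm]
      linear_combination (-(α ^ 3)) * hκ
    · refine ((hlin 0).const_mul (2 * κ)).neg.congr_deriv (by ring)
    -- On the axis G need not be differentiable, but 2tG(t²) is, thanks to the factor t. Elsewhere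
    -- the chain rule contributes 4α²G' = 4l.
    · rcases eq_or_ne α 0 with rfl | h0
      · have hc : ContinuousAt (fun t : ℝ => 2 * G ((0 + t) ^ 2)) 0 := by
          refine continuousAt_const.mul (ContinuousAt.comp (f := fun t : ℝ => (0 + t) ^ 2) ?_
            (by fun_prop))
          simpa using hG
        have h1 := hasDerivAt_mul_of_eq_zero hc hid rfl
        refine (h1.congr_of_eventuallyEq (Eventually.of_forall fun t => ?_)).congr_deriv ?_
        · simp; ring
        · rw [hlG]; simp
      · have h1 := ((hlin 0).const_mul 2).fun_mul (HasDerivAt.comp (h₂ := G)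
          (h := fun t : ℝ => (α + t) ^ 2) (0 : ℝ) (by simpa using hG' h0) (hsq 0))
        refine h1.congr_deriv ?_
        simp only [Function.comp_apply, add_zero, hlG]
        ring
  · filter_upwards [hd1] with t ht
    have e : (fun t : ℝ => capChart κ F ((α, 0) + t • ((0, 1) : ℝ × ℝ))) = fun t =>
        (![α * √(2 - κ * (α ^ 2 + t ^ 2)), t * √(2 - κ * (α ^ 2 + t ^ 2)),
          1 - κ * (α ^ 2 + t ^ 2)], F (α ^ 2 + t ^ 2)) := by
      funext t; simp [capChart, planeSq]
    rw [e]
    refine hasDerivAt_ambient ?_ ?_ ?_ ?_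
    · exact ((hdm t ht.2).const_mul α).congr_deriv (by ring)
    · exact ((hasDerivAt_id t).fun_mul (hdm t ht.2)).congr_deriv (by simp; ring)
    · exact (((hsq' t).const_mul κ).const_sub 1).congr_deriv (by ring)
    · exact ((hF _ ht.1).comp t (hsq' t)).congr_deriv (by ring)
  · have hp0 : 0 < 2 - κ * (α ^ 2 + 0 ^ 2) := by simpa using hα2
    have hmc : ContinuousAt (fun t : ℝ => -κ / √(2 - κ * (α ^ 2 + t ^ 2))) 0 :=
      continuousAt_const.div (by fun_prop) (by rw [hm01]; exact hm0.ne')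
    refine hasDerivAt_ambient ?_ ?_ ?_ ?_
    · refine (hasDerivAt_mul_of_eq_zero (continuousAt_const.mul hmc) hid rfl).congr_deriv ?_
      rw [Pi.mul_apply, hm01]; ring
    · refine ((hdm 0 hp0).fun_add (hasDerivAt_mul_of_eq_zero (hmc.mul continuousAt_id) hid
        rfl)).congr_deriv ?_
      simp
    · exact (hid.const_mul (-(2 * κ))).congr_deriv (by ring)
    · have hc : ContinuousAt (fun t : ℝ => G (α ^ 2 + t ^ 2) * 2) 0 := by
        refine ContinuousAt.mul (ContinuousAt.comp (f := fun t : ℝ => α ^ 2 + t ^ 2) ?_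
            (by fun_prop)) continuousAt_const
        simpa using hG
      refine (hasDerivAt_mul_of_eq_zero hc hid rfl).congr_deriv ?_
      norm_num; ring
  · simp [ambientForm_apply]
  · simp only [ambientForm_apply, hGQ, add_zero, ← hmdef, Matrix.cons_val_zero,
      Matrix.cons_val_one, Matrix.cons_val]
    have e1 : 2 * (1 - κ * α ^ 2) / m * -(Q * (1 - κ * α ^ 2) * (α * m)) =
        -(2 * Q * α * (1 - κ * α ^ 2) ^ 2) := by field_simp
    have e2 : 2 * α * (Q / ν) * ν = 2 * α * Q := by field_simp
    rw [e1, e2]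
    linear_combination -(2 * Q * α * (2 * κ * α ^ 2 - κ ^ 2 * α ^ 4)) * hκ
  · simp [ambientForm_apply]
  · have := cap_curvature_identity (h := H ν) (Q := Q) (k := k) (l := l) hκ hm0.ne' hν0 hm
      (by rw [hm]; exact hν) (by rw [hm]; exact hk) (by rw [hm]; exact hl)
    rw [← this]
    have h0 : α ^ 2 + (0 : ℝ) ^ 2 = α ^ 2 := by norm_num
    simp only [ambientForm_apply, h0, hGQ, add_zero, ← hmdef, Matrix.cons_val_zero,
      Matrix.cons_val_one, Matrix.cons_val, mul_zero, zero_add]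
    rw [← hm]
    congr 1
    · ring
    · ring

/-! ### The chart around the equator -/

/-- A rotational surface with profile `ξ = Ξ(z)`, parametrized by the height and the second
coordinate. -/
noncomputable def bandChart (κ : ℝ) (Ξ : ℝ → ℝ) (q : ℝ × ℝ) : Ambient :=
  (![√(radiusSq κ (Ξ q.1) - q.2 ^ 2), q.2, 1 - κ * Ξ q.1], q.1)

/-- At the equator the profile is vertical, so height is used as a parameter. Both coordinate
vectors are unit there; the meridian contributes −Ξ''(0)/u₁ and the parallel (1 − κξ₁)/u₁ to the
trace, and the value of Ξ''(0) makes the sum 2H(0). -/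
theorem hasLocalParam_bandChart {κ ε ξ₁ u₁ : ℝ} {Ξ Ξ' Ξ'' H : ℝ → ℝ} {S : Set Ambient}
    (hκ : κ ^ 2 = 1) (hε : 0 < ε) (h1 : ∀ ζ ∈ Ioo (-ε) ε, HasDerivAt Ξ (Ξ' ζ) ζ)
    (h2 : ∀ ζ ∈ Ioo (-ε) ε, HasDerivAt Ξ' (Ξ'' ζ) ζ)
    (h3 : ∀ ζ ∈ Ioo (-ε) ε, ContinuousAt Ξ'' ζ) (hΞ0 : Ξ 0 = ξ₁) (hΞ'0 : Ξ' 0 = 0)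
    (hu : 0 < u₁) (hu' : u₁ ^ 2 = radiusSq κ ξ₁) (hΞ''0 : Ξ'' 0 = 1 - κ * ξ₁ - 2 * H 0 * u₁)
    (hS : ∀ p : Ambient, p.2 ∈ Ioo (-ε) ε → 0 < p.1 0 →
      (p ∈ S ↔ p.1 0 ^ 2 + p.1 1 ^ 2 = radiusSq κ (Ξ p.2) ∧ p.1 2 = 1 - κ * Ξ p.2)) :
    HasLocalParam κ H S (![u₁, 0, 1 - κ * ξ₁], 0) (![-(1 - κ * ξ₁), 0, κ * u₁], 0) := by
  have hsqrt : √(u₁ ^ 2) = u₁ := Real.sqrt_sq hu.le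
  have hΞC : ContDiffOn ℝ 2 Ξ (Ioo (-ε) ε) := contDiffOn_two_of_hasDerivAt isOpen_Ioo h1 h2
    fun ζ hζ => (h3 ζ hζ).continuousWithinAt
  have hband : IsOpen {q : ℝ × ℝ | q.1 ∈ Ioo (-ε) ε} := isOpen_Ioo.preimage continuous_fst
  have hΞC' : ContDiffOn ℝ 2 (fun q : ℝ × ℝ => Ξ q.1) {q | q.1 ∈ Ioo (-ε) ε} :=
    hΞC.comp contDiffOn_fst fun q hq => hq
  have hD : ContDiffOn ℝ 2 (fun q : ℝ × ℝ => radiusSq κ (Ξ q.1) - q.2 ^ 2)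
      {q | q.1 ∈ Ioo (-ε) ε} := by
    unfold radiusSq
    exact ((contDiffOn_const.mul hΞC').sub (contDiffOn_const.mul (hΞC'.pow 2))).sub
      (contDiffOn_snd.pow 2)
  set U : Set (ℝ × ℝ) := {q | q.1 ∈ Ioo (-ε) ε} ∩
    (fun q : ℝ × ℝ => radiusSq κ (Ξ q.1) - q.2 ^ 2) ⁻¹' Ioi 0 with hUdef
  have hU : IsOpen U := hD.continuousOn.isOpen_inter_preimage hband isOpen_Ioi
  have h0mem : (0 : ℝ) ∈ Ioo (-ε) ε := ⟨by linarith, hε⟩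
  have hφ : IsLocalParam S U (bandChart κ Ξ) := by
    refine isLocalParam_of_leftInverse (O := {p | p.2 ∈ Ioo (-ε) ε ∧ 0 < p.1 0})
      (I := fun p => (p.2, p.1 1)) hU ?_ ?_ ?_ ?_ ?_
    · refine contDiffOn_ambient ?_ contDiffOn_snd ?_ contDiffOn_fst
      · exact (hD.mono inter_subset_left).sqrt fun q hq => (ne_of_gt hq.2)
      · exact contDiffOn_const.sub (contDiffOn_const.mul (hΞC'.mono inter_subset_left))
    · exact (isOpen_Ioo.preimage continuous_snd).inter (isOpen_lt continuous_const
        (by fun_prop : Continuous fun p : Ambient => p.1 0))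
    · fun_prop
    · intro q hq
      have hq2 : 0 < radiusSq κ (Ξ q.1) - q.2 ^ 2 := hq.2
      have hpos : 0 < (bandChart κ Ξ q).1 0 := by
        simpa [bandChart] using hq2
      refine ⟨(hS (bandChart κ Ξ q) hq.1 hpos).2 ⟨?_, ?_⟩, ⟨hq.1, hpos⟩, ?_⟩
      · simp only [bandChart, Matrix.cons_val_zero, Matrix.cons_val_one]
        rw [Real.sq_sqrt hq2.le]; ring
      · simp [bandChart]
      · simp [bandChart]
    · intro p hp hpO _
      obtain ⟨e1, e2⟩ := (hS p hpO.1 hpO.2).1 hp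
      refine Prod.ext (funext fun i => ?_) rfl
      fin_cases i
      · simp only [bandChart, ← e1]
        simpa using Real.sqrt_sq hpO.2.le
      · simp [bandChart]
      · simp [bandChart, e2]
  have hpt : bandChart κ Ξ (0, 0) = (![u₁, 0, 1 - κ * ξ₁], 0) := by
    simp [bandChart, hΞ0, ← hu', hsqrt]
  have hq : ((0, 0) : ℝ × ℝ) ∈ U := ⟨h0mem, by
    simp only [mem_preimage, hΞ0, ← hu', mem_Ioi]; nlinarith⟩
  have hc1 : ∀ᶠ t in 𝓝 (0 : ℝ), t ∈ Ioo (-ε) ε ∧ 0 < radiusSq κ (Ξ t) := by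
    refine Filter.Eventually.and (Ioo_mem_nhds h0mem.1 h0mem.2) ?_
    have c : ContinuousAt (fun t => radiusSq κ (Ξ t)) 0 :=
      ContinuousAt.comp (f := Ξ) (continuous_radiusSq κ).continuousAt (h1 0 h0mem).continuousAt
    exact c.eventually (lt_mem_nhds (by simp only [hΞ0, ← hu']; positivity))
  have hd1 : ∀ᶠ t in 𝓝 (0 : ℝ), 0 < u₁ ^ 2 - t ^ 2 := by
    have c : ContinuousAt (fun t => u₁ ^ 2 - t ^ 2) 0 := by fun_prop
    exact c.eventually (lt_mem_nhds (by norm_num; positivity))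
  have hσt : ∀ t ∈ Ioo (-ε) ε, HasDerivAt (fun t => radiusSq κ (Ξ t))
      (2 * (1 - κ * Ξ t) * Ξ' t) t := fun t ht =>
    (hasDerivAt_radiusSq κ (Ξ t)).comp t (h1 t ht)
  have hid : HasDerivAt (fun t : ℝ => t) 1 0 := hasDerivAt_id 0
  rw [← hpt]
  refine HasLocalParam.of_lines hφ (q := (0, 0)) hq
    (c' := fun t => (![(1 - κ * Ξ t) / √(radiusSq κ (Ξ t)) * Ξ' t, 0, -κ * Ξ' t], 1))
    (c'' := (![(1 - κ * ξ₁) / u₁ * Ξ'' 0, 0, -κ * Ξ'' 0], 0))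
    (d' := fun t => (![-1 / √(u₁ ^ 2 - t ^ 2) * t, 1, 0], 0))
    (d'' := (![-1 / u₁, 0, 0], 0)) ?_ ?_ ?_ ?_ ?_ ?_ ?_ ?_
  · filter_upwards [hc1] with t ht
    have e : (fun t : ℝ => bandChart κ Ξ ((0, 0) + t • ((1, 0) : ℝ × ℝ))) = fun t =>
        (![√(radiusSq κ (Ξ t)), 0, 1 - κ * Ξ t], t) := by
      funext t; simp [bandChart]
    rw [e]
    refine hasDerivAt_ambient ?_ (hasDerivAt_const _ _) ?_ (hasDerivAt_id t)
    · refine ((hσt t ht.1).sqrt ht.2.ne').congr_deriv ?_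
      have := (Real.sqrt_pos.2 ht.2).ne'
      field_simp
    · exact (((h1 t ht.1).const_mul κ).const_sub 1).congr_deriv (by ring)
  · have hs : √(radiusSq κ (Ξ 0)) = u₁ := by rw [hΞ0, ← hu', hsqrt]
    refine hasDerivAt_ambient ?_ (hasDerivAt_const _ _) ((h2 0 h0mem).const_mul _)
      (hasDerivAt_const _ _)
    have c1 := (h1 0 h0mem).continuousAt
    have c2 : ContinuousAt (fun t => √(radiusSq κ (Ξ t))) 0 :=
      (hσt 0 h0mem).continuousAt.sqrt
    have c3 : ContinuousAt (fun t => (1 - κ * Ξ t) / √(radiusSq κ (Ξ t))) 0 :=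
      ContinuousAt.div (by fun_prop) c2 (by rw [hs]; exact hu.ne')
    refine (hasDerivAt_mul_of_eq_zero c3 (h2 0 h0mem) hΞ'0).congr_deriv ?_
    rw [hs, hΞ0]
  · filter_upwards [hd1] with t ht
    have e : (fun t : ℝ => bandChart κ Ξ ((0, 0) + t • ((0, 1) : ℝ × ℝ))) = fun t =>
        (![√(u₁ ^ 2 - t ^ 2), t, 1 - κ * ξ₁], 0) := by
      funext t; simp [bandChart, hΞ0, hu']
    rw [e]
    refine hasDerivAt_ambient ?_ (hasDerivAt_id t) (hasDerivAt_const _ _) (hasDerivAt_const _ _)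
    refine ((((hasDerivAt_id t).fun_pow 2).const_sub (u₁ ^ 2)).sqrt ht.ne').congr_deriv ?_
    have := (Real.sqrt_pos.2 ht).ne'
    simp only [id]
    field_simp
    norm_num
  · refine hasDerivAt_ambient ?_ (hasDerivAt_const _ _) (hasDerivAt_const _ _)
      (hasDerivAt_const _ _)
    have hs : √(u₁ ^ 2 - 0 ^ 2) = u₁ := by rw [zero_pow two_ne_zero, sub_zero, hsqrt]
    have c : ContinuousAt (fun t => -1 / √(u₁ ^ 2 - t ^ 2)) 0 :=
      ContinuousAt.div continuousAt_const (by fun_prop) (by rw [hs]; exact hu.ne')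
    refine (hasDerivAt_mul_of_eq_zero c hid rfl).congr_deriv ?_
    rw [hs, mul_one]
  · simp [ambientForm_apply, hΞ'0]
  · simp [ambientForm_apply, hΞ'0]
  · simp [ambientForm_apply]
  · simp only [ambientForm_apply, hΞ'0, Matrix.cons_val_zero, Matrix.cons_val_one, Matrix.cons_val,
      mul_zero, zero_mul, add_zero, zero_add, mul_one]
    have hx : (1 - κ * ξ₁) ^ 2 + κ * u₁ ^ 2 = 1 := by
      rw [hu']; unfold radiusSq; ring
    have e : (1 - κ * ξ₁) / u₁ * Ξ'' 0 * -(1 - κ * ξ₁) + κ * (-κ * Ξ'' 0 * (κ * u₁)) +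
        -1 / u₁ * -(1 - κ * ξ₁) = 2 * H 0 := by
      field_simp
      rw [hΞ''0]
      have hx' : (1 - κ * ξ₁) ^ 2 + κ ^ 3 * u₁ ^ 2 = 1 := by
        linear_combination hx + κ * u₁ ^ 2 * hκ
      linear_combination (-(1 - κ * ξ₁ - 2 * H 0 * u₁)) * hx'
    rw [e]; ring

/-! ### The closed surface: topology, normal field and curvature -/

/-- The coordinate `ξ = κ (1 - x₃)`, which vanishes on the axis. -/
def axialCoord (κ : ℝ) (p : Ambient) : ℝ := κ * (1 - p.1 2)

/-- The rotational surface made of the graphs of `f` and `-f` over the cap `ξ ≤ ξ₁`. -/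
def capSphere (κ ξ₁ : ℝ) (f : ℝ → ℝ) : Set Ambient :=
  {p | 0 ≤ axialCoord κ p ∧ axialCoord κ p ≤ ξ₁ ∧
    p.1 0 ^ 2 + p.1 1 ^ 2 = radiusSq κ (axialCoord κ p) ∧ |p.2| = f (axialCoord κ p)}

/-- The unit normal field of `capSphere`. -/
noncomputable def capNormal (κ : ℝ) (H u : ℝ → ℝ) (p : Ambient) : Ambient :=
  (![-(slopeRatio κ H u (axialCoord κ p) * p.1 2 * p.1 0),
    -(slopeRatio κ H u (axialCoord κ p) * p.1 2 * p.1 1), κ * u (axialCoord κ p)],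
    if p.2 ≤ 0 then angleFn κ u (axialCoord κ p) else -angleFn κ u (axialCoord κ p))

theorem continuous_axialCoord (κ : ℝ) : Continuous (axialCoord κ) := by
  unfold axialCoord; fun_prop

theorem height_eq {κ : ℝ} (hκ : κ ^ 2 = 1) (p : Ambient) : p.1 2 = 1 - κ * axialCoord κ p := by
  unfold axialCoord; linear_combination (1 - p.1 2) * hκ

theorem capSphere_subset {κ ξ₁ : ℝ} {f : ℝ → ℝ} (hκ : κ = 1 ∨ κ = -1) :
    capSphere κ ξ₁ f ⊆ productSpace κ := by
  rintro p ⟨h0, -, h2, -⟩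
  refine ⟨⟨?_, ?_⟩, mem_univ _⟩
  · simp only [axialCoord, radiusSq] at h2
    simp only [baseForm]
    rcases hκ with rfl | rfl
    · linear_combination h2
    · linear_combination h2
  · rcases hκ with rfl | rfl
    · simp
    · simp only [axialCoord] at h0
      linarith

theorem axialCoord_axialEquiv {c s b κ : ℝ} (hcs : c ^ 2 + s ^ 2 = 1) (hb : b ^ 2 = 1)
    (p : Ambient) : axialCoord κ (axialEquiv c s 1 b hcs (one_pow 2) hb p) = axialCoord κ p := by
  simp [axialCoord, axialEquiv_apply]

theorem capSphere_invariant {κ ξ₁ : ℝ} {f : ℝ → ℝ} {c s b : ℝ} (hcs : c ^ 2 + s ^ 2 = 1)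
    (hb : b ^ 2 = 1) :
    axialEquiv c s 1 b hcs (one_pow 2) hb '' capSphere κ ξ₁ f = capSphere κ ξ₁ f := by
  refine axialEquiv_image hcs _ hb fun c s hcs p hp => ?_
  obtain ⟨h0, h1, h2, h3⟩ := hp
  have hb1 : |b| = 1 := by
    rcases mul_self_eq_one_iff.1 ((sq b).symm.trans hb) with h | h <;> simp [h]
  refine ⟨?_, ?_, ?_, ?_⟩
  · rwa [axialCoord_axialEquiv]
  · rwa [axialCoord_axialEquiv]
  · rw [axialCoord_axialEquiv, ← h2]
    simp only [axialEquiv_apply, Matrix.cons_val_zero, Matrix.cons_val_one]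
    linear_combination (p.1 0 ^ 2 + p.1 1 ^ 2) * hcs
  · rw [axialCoord_axialEquiv, ← h3, axialEquiv_apply, abs_mul, hb1, one_mul]

theorem isRotational_of_image {S : Set Ambient} (hS : ∀ c s : ℝ, ∀ hcs : c ^ 2 + s ^ 2 = 1,
    axialEquiv c s 1 1 hcs (one_pow 2) (one_pow 2) '' S = S) : IsRotational S := by
  intro θ
  have e : ProductSurface.rotation θ = axialEquiv (Real.cos θ) (Real.sin θ) 1 1 (Real.cos_sq_add_sin_sq θ)
      (one_pow 2) (one_pow 2) := by
    funext p; simp [ProductSurface.rotation, axialEquiv_apply]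
  rw [e]
  exact hS _ _ _

theorem exists_polar {x y r : ℝ} (h : x ^ 2 + y ^ 2 = r ^ 2) :
    ∃ c s : ℝ, c ^ 2 + s ^ 2 = 1 ∧ x = c * r ∧ y = s * r := by
  rcases eq_or_ne r 0 with rfl | hr
  · refine ⟨1, 0, by norm_num, ?_, ?_⟩ <;> nlinarith [sq_nonneg x, sq_nonneg y]
  · refine ⟨x / r, y / r, ?_, ?_, ?_⟩ <;> field_simp
    exact h

/-- A rotational surface over a cap, whose height vanishes exactly on the boundary of the cap, is a
topological sphere. -/
theorem isSphere_capSphere {κ ξ₁ : ℝ} {f : ℝ → ℝ} (hκ : κ ^ 2 = 1) (h1 : 0 < ξ₁)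
    (h2 : ∀ ξ, 0 ≤ ξ → ξ ≤ ξ₁ → 0 < 2 - κ * ξ) (hf : ContinuousOn f (Iic ξ₁)) (hf0 : f ξ₁ = 0)
    (hfpos : ∀ ξ, 0 ≤ ξ → ξ < ξ₁ → 0 < f ξ) : IsSphere (capSphere κ ξ₁ f) := by
  -- On the unit sphere X = ξ₁(y₀² + y₁²), so X sweeps [0, ξ₁] from the poles to the equator. The
  -- sign of y₂ selects the sheet, and the two sheets agree at X = ξ₁ because f vanishes there.
  set X : EuclideanSpace ℝ (Fin 3) → ℝ := fun y => ξ₁ * (1 - y 2 ^ 2)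
  have hcoord : ∀ i : Fin 3, Continuous fun y : EuclideanSpace ℝ (Fin 3) => y i := fun i => by
    fun_prop
  have hXc : Continuous X := by
    have := hcoord 2
    fun_prop
  have hX1 : ∀ y, X y ≤ ξ₁ := fun y => by
    have := mul_nonneg h1.le (sq_nonneg (y 2))
    simp only [X]; linarith
  have hnorm : ∀ y : EuclideanSpace ℝ (Fin 3), y ∈ Metric.sphere (0 : EuclideanSpace ℝ (Fin 3)) 1 ↔
      y 0 ^ 2 + y 1 ^ 2 + y 2 ^ 2 = 1 := fun y => by
    rw [mem_sphere_zero_iff_norm, EuclideanSpace.norm_eq, Real.sqrt_eq_one, Fin.sum_univ_three]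
    simp
  have hX0 : ∀ y ∈ Metric.sphere (0 : EuclideanSpace ℝ (Fin 3)) 1, 0 ≤ X y := fun y hy => by
    have := (hnorm y).1 hy
    exact mul_nonneg h1.le (by nlinarith [sq_nonneg (y 0), sq_nonneg (y 1)])
  have hfnn : ∀ ξ, 0 ≤ ξ → ξ ≤ ξ₁ → 0 ≤ f ξ := fun ξ h h' => by
    rcases h'.eq_or_lt with rfl | h''
    · exact hf0.ge
    · exact (hfpos ξ h h'').le
  have hsq1 : √ξ₁ ^ 2 = ξ₁ := Real.sq_sqrt h1.le
  have hs1 : 0 < √ξ₁ := Real.sqrt_pos.2 h1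
  set Ψ : EuclideanSpace ℝ (Fin 3) → Ambient := fun y =>
    (![√ξ₁ * y 0 * √(2 - κ * X y), √ξ₁ * y 1 * √(2 - κ * X y), 1 - κ * X y],
      if 0 ≤ y 2 then f (X y) else -f (X y)) with hΨ
  have hfX : Continuous fun y => f (X y) := hf.comp_continuous hXc hX1
  have hΨc : Continuous Ψ := by
    have c0 := hcoord 0
    have c1 := hcoord 1
    refine Continuous.prodMk (continuous_pi fun i => ?_) ?_
    · fin_cases i
      · show Continuous fun y => √ξ₁ * y 0 * √(2 - κ * X y)
        fun_prop
      · show Continuous fun y => √ξ₁ * y 1 * √(2 - κ * X y)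
        fun_prop
      · show Continuous fun y => 1 - κ * X y
        fun_prop
    · refine Continuous.if_le hfX hfX.neg continuous_const (hcoord 2) fun y hy => ?_
      simp [X, ← hy, hf0]
  have hΨX : ∀ y, axialCoord κ (Ψ y) = X y := fun y => by
    simp only [axialCoord, hΨ, Matrix.cons_val]
    linear_combination X y * hκ
  have hmem : ∀ y ∈ Metric.sphere (0 : EuclideanSpace ℝ (Fin 3)) 1, Ψ y ∈ capSphere κ ξ₁ f := by
    intro y hy
    have hpos := h2 _ (hX0 y hy) (hX1 y)
    refine ⟨?_, ?_, ?_, ?_⟩ <;> rw [hΨX]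
    · exact hX0 y hy
    · exact hX1 y
    · simp only [hΨ, Matrix.cons_val_zero, Matrix.cons_val_one, mul_pow, hsq1,
        Real.sq_sqrt hpos.le]
      have e : ξ₁ * y 0 ^ 2 + ξ₁ * y 1 ^ 2 = X y := by
        simp only [X]; linear_combination ξ₁ * (hnorm y).1 hy
      rw [← add_mul, e]
      unfold radiusSq; ring
    · simp only [hΨ]
      split_ifs
      · exact abs_of_nonneg (hfnn _ (hX0 y hy) (hX1 y))
      · rw [abs_neg]; exact abs_of_nonneg (hfnn _ (hX0 y hy) (hX1 y))
  have hbij : Function.Bijective (fun y : Metric.sphere (0 : EuclideanSpace ℝ (Fin 3)) 1 =>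
      (⟨Ψ y, hmem y y.2⟩ : capSphere κ ξ₁ f)) := by
    constructor
    · rintro ⟨y, hy⟩ ⟨y', hy'⟩ h
      have h : Ψ y = Ψ y' := congrArg Subtype.val h
      have hXX : X y = X y' := by rw [← hΨX, ← hΨX, h]
      have hm : √(2 - κ * X y') ≠ 0 := (Real.sqrt_pos.2 (h2 _ (hX0 y' hy') (hX1 y'))).ne'
      have e0 : y 0 = y' 0 := by
        have := congrArg (fun p : Ambient => p.1 0) h
        simp only [hΨ, Matrix.cons_val_zero, hXX] at this
        exact mul_left_cancel₀ hs1.ne' (mul_right_cancel₀ hm this)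
      have e1 : y 1 = y' 1 := by
        have := congrArg (fun p : Ambient => p.1 1) h
        simp only [hΨ, Matrix.cons_val_one, hXX] at this
        exact mul_left_cancel₀ hs1.ne' (mul_right_cancel₀ hm this)
      have e2 : y 2 = y' 2 := by
        have hsq : y 2 ^ 2 = y' 2 ^ 2 := by
          have := mul_left_cancel₀ h1.ne' hXX
          linarith
        have hz := congrArg (fun p : Ambient => p.2) h
        simp only [hΨ, hXX] at hz
        have hlt : ∀ w : EuclideanSpace ℝ (Fin 3), w 2 < 0 → X w < ξ₁ := fun w hw => by
          have : 0 < ξ₁ * w 2 ^ 2 := by have := hw.ne; positivity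
          simp only [X]; linarith
        rcases sq_eq_sq_iff_eq_or_eq_neg.1 hsq with h' | h'
        · exact h'
        · rcases lt_trichotomy (y' 2) 0 with h3 | h3 | h3
          · have h4 := hfpos _ (hX0 y' hy') (hlt y' h3)
            rw [if_pos (by linarith), if_neg (by linarith)] at hz
            linarith
          · rw [h', h3, neg_zero]
          · have h4 := hfpos _ (hX0 y hy) (hlt y (by linarith))
            rw [if_neg (by linarith), if_pos h3.le, ← hXX] at hz
            linarith
      exact Subtype.ext (PiLp.ext fun i => by fin_cases i <;> assumption)
    · rintro ⟨p, hp⟩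
      obtain ⟨p0, p1, p2, p3⟩ := hp
      set ξ := axialCoord κ p with hξ
      have hpos := h2 ξ p0 p1
      have hm : 0 < √(2 - κ * ξ) := Real.sqrt_pos.2 hpos
      have hq : 0 ≤ 1 - ξ / ξ₁ := by
        rw [sub_nonneg, div_le_one h1]; exact p1
      set w : ℝ := if 0 ≤ p.2 then √(1 - ξ / ξ₁) else -√(1 - ξ / ξ₁) with hw
      have hw2 : w ^ 2 = 1 - ξ / ξ₁ := by
        simp only [hw]; split_ifs
        · exact Real.sq_sqrt hq
        · rw [neg_sq]; exact Real.sq_sqrt hq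
      set y : EuclideanSpace ℝ (Fin 3) :=
        !₂[p.1 0 / (√ξ₁ * √(2 - κ * ξ)), p.1 1 / (√ξ₁ * √(2 - κ * ξ)), w] with hy
      have y0 : y 0 = p.1 0 / (√ξ₁ * √(2 - κ * ξ)) := rfl
      have y1 : y 1 = p.1 1 / (√ξ₁ * √(2 - κ * ξ)) := rfl
      have y2 : y 2 = w := rfl
      have hXy : X y = ξ := by
        simp only [X, y2, hw2]; field_simp; ring
      have hys : y ∈ Metric.sphere (0 : EuclideanSpace ℝ (Fin 3)) 1 := by
        rw [hnorm, y0, y1, y2, hw2, div_pow, div_pow, mul_pow, hsq1, Real.sq_sqrt hpos.le, ← add_div,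
          p2]
        have : radiusSq κ ξ = ξ * (2 - κ * ξ) := by unfold radiusSq; ring
        rw [this, mul_div_mul_right _ _ hpos.ne']
        ring
      refine ⟨⟨y, hys⟩, Subtype.ext (Prod.ext (funext fun i => ?_) ?_)⟩
      · simp only [hΨ, hXy, y0, y1]
        fin_cases i
        · simp; field_simp
        · simp; field_simp
        · simpa using (height_eq hκ p).symm
      · simp only [hΨ, hXy, y2]
        rcases lt_or_ge p.2 0 with h3 | h3
        · have h4 : ξ < ξ₁ := by
            refine lt_of_le_of_ne p1 fun h => ?_
            rw [h, hf0, abs_eq_zero] at p3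
            linarith
          have h5 : 0 < √(1 - ξ / ξ₁) := by
            rw [Real.sqrt_pos, sub_pos, div_lt_one h1]; exact h4
          rw [abs_of_neg h3] at p3
          rw [hw, if_neg h3.not_ge, if_neg (by linarith)]
          linarith
        · rw [abs_of_nonneg h3] at p3
          rw [hw, if_pos h3, if_pos (Real.sqrt_nonneg _), p3]
  have hc : Continuous (Equiv.ofBijective _ hbij) :=
    (hΨc.comp continuous_subtype_val).subtype_mk _
  -- A continuous bijection from a compact space to a Hausdorff space has a continuous inverse, so
  -- no inverse formula has to be checked.
  exact ⟨(hc.homeoOfEquivCompactToT2).symm⟩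

/-- Only the lower cap is treated, as the graph of −f; its normal has positive vertical part, equal
to the angle function. The parameter α = √ξ places the point on the first coordinate axis. -/
theorem capSphere_hasLocalParam_meridian {κ R ξ₁ : ℝ} {H u f : ℝ → ℝ} (hκ : κ ^ 2 = 1)
    (h : IsCapProfile κ H u R ξ₁) (hH : ContinuousOn H (Icc (-1) 1))
    (hf0 : f ξ₁ = 0) (hfa : StrictAntiOn f (Icc 0 ξ₁))
    (hfd : ∀ ξ < ξ₁, HasDerivAt f (-slopeFn κ H u ξ) ξ) {ξ : ℝ} (hξ0 : 0 ≤ ξ) (hξ : ξ < ξ₁) :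
    HasLocalParam κ H (capSphere κ ξ₁ f) (![√(radiusSq κ ξ), 0, 1 - κ * ξ], -f ξ)
      (![-(slopeRatio κ H u ξ * (1 - κ * ξ) * √(radiusSq κ ξ)), 0, κ * u ξ], angleFn κ u ξ) := by
  have hfpos : ∀ ξ, 0 ≤ ξ → ξ < ξ₁ → 0 < f ξ := fun ξ h0 h1 => by
    have := hfa ⟨h0, h1.le⟩ ⟨h.pos_end.le, le_rfl⟩ h1
    rwa [hf0] at this
  have hFd : ∀ ξ < ξ₁, HasDerivAt (fun ξ => -f ξ) (slopeFn κ H u ξ) ξ := fun ξ hξ => by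
    simpa using (hfd ξ hξ).fun_neg
  have hF := contDiffOn_radial hFd h.continuousOn_slopeFn
    (fun ξ hξ => h.hasDerivAt_slopeFn hξ.1 hξ.2) (h.continuousOn_slopeFnDeriv hH)
    (h.tendsto_mul_slopeFnDeriv hH)
  have hcoord : ∀ q, axialCoord κ (capChart κ (fun ξ => -f ξ) q) = planeSq q := fun q => by
    simp only [axialCoord, capChart, Matrix.cons_val]
    linear_combination planeSq q * hκ
  have hφ : IsLocalParam (capSphere κ ξ₁ f) {q | planeSq q < ξ₁} (capChart κ fun ξ => -f ξ) := by
    refine isLocalParam_capChart (O := {p | p.2 < 0}) hκ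
      (fun ξ h0 h1 => h.two_sub_pos h0 (h1.trans h.end_lt).le) hF
      (isOpen_lt continuous_snd continuous_const) (fun q hq => ⟨⟨?_, ?_, ?_, ?_⟩, ?_⟩) ?_
    · rw [hcoord]; exact planeSq_nonneg q
    · rw [hcoord]; exact hq.le
    · rw [hcoord]
      simp only [capChart, Matrix.cons_val_zero, Matrix.cons_val_one, mul_pow]
      rw [Real.sq_sqrt (h.two_sub_pos (planeSq_nonneg q) (hq.trans h.end_lt).le).le]
      unfold radiusSq planeSq; ring
    · rw [hcoord]
      simp only [capChart, abs_neg]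
      exact abs_of_pos (hfpos _ (planeSq_nonneg q) hq)
    · simpa [capChart] using hfpos _ (planeSq_nonneg q) hq
    · rintro p ⟨h0, h1, h2, h3⟩ hp -
      have hp' : p.2 < 0 := hp
      constructor
      · rw [h2]
        unfold radiusSq axialCoord
        linear_combination (-(κ * (1 - p.1 2) ^ 2)) * hκ
      · rw [abs_of_neg hp'] at h3
        show p.2 = -f (axialCoord κ p)
        linarith
  have hα : √ξ ^ 2 = ξ := Real.sq_sqrt hξ0
  have h2 := h.two_sub_pos hξ0 (hξ.trans h.end_lt).le
  have hν := h.angleFn_pos hξ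
  have hu := h.u_eq hξ0 (hξ.trans h.end_lt).le
  have hu' : u ξ = slopeRatio κ H u ξ * ξ * (2 - κ * ξ) := by rw [hu]; unfold radiusSq; ring
  have hs : √ξ * √(2 - κ * ξ) = √(radiusSq κ ξ) := by
    rw [← Real.sqrt_mul hξ0]; congr 1; unfold radiusSq; ring
  have key := hasLocalParam_capChart (α := √ξ) (r := ξ₁) (F := fun ξ => -f ξ)
    (G := slopeFn κ H u) (G' := slopeFnDeriv κ H u) (Q := slopeRatio κ H u ξ)
    (ν := angleFn κ u ξ) (H := H) (l := ξ * slopeFnDeriv κ H u ξ)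
    (k := (2 * H (angleFn κ u ξ) - 2 * slopeRatio κ H u ξ * (1 - κ * ξ)) / (2 - κ * ξ))
    hκ hFd (h.continuousOn_slopeFn.continuousAt (Iio_mem_nhds (by rwa [hα])))
    (fun h0 => by
      rw [hα]
      exact h.hasDerivAt_slopeFn (lt_of_le_of_ne hξ0 fun h' => h0 (by simp [← h'])) hξ)
    hφ (by rwa [hα]) (by rwa [hα]) hν.ne' (by rw [hα]; rfl)
    (by rw [hα, h.angleFn_sq hξ0 hξ.le, hu']; ring) (by rw [hα]; field_simp; ring) (by rw [hα])
    (by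
      rw [hα]
      rcases hξ0.eq_or_lt with rfl | h0
      · have e1 : angleFn κ u 0 = 1 := by rw [angleFn, if_pos le_rfl]
        have e2 : slopeRatio κ H u 0 = H 1 := by rw [slopeRatio, if_pos le_rfl]
        simp [e1, e2]
      · rw [h.mul_slopeFnDeriv h0 hξ, ← hu'])
  have e1 : capChart κ (fun ξ => -f ξ) (√ξ, 0) = (![√(radiusSq κ ξ), 0, 1 - κ * ξ], -f ξ) := by
    simp [capChart, planeSq, hα, hs]
  rw [e1, hα, hs, ← hu'] at key
  exact key

/-- Injectivity of f turns |z| = f(ξ) into ξ = Ξ(z), which describes both caps at once in a band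
around the equator. -/
theorem capSphere_hasLocalParam_equator {κ R ξ₁ ε : ℝ} {H u f Ξ Ξ' Ξ'' : ℝ → ℝ} (hκ : κ ^ 2 = 1)
    (h : IsCapProfile κ H u R ξ₁) (hfa : StrictAntiOn f (Icc 0 ξ₁)) (hε : 0 < ε)
    (hΞ0 : Ξ 0 = ξ₁) (hΞ'0 : Ξ' 0 = 0) (hΞ''0 : Ξ'' 0 = 1 - κ * ξ₁ - 2 * H 0 * u ξ₁)
    (hΞ : ∀ ζ ∈ Ioo (-ε) ε, Ξ ζ ∈ Ioc 0 ξ₁ ∧ f (Ξ ζ) = |ζ| ∧ HasDerivAt Ξ (Ξ' ζ) ζ ∧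
      HasDerivAt Ξ' (Ξ'' ζ) ζ ∧ ContinuousAt Ξ'' ζ) :
    HasLocalParam κ H (capSphere κ ξ₁ f) (![u ξ₁, 0, 1 - κ * ξ₁], 0)
      (![-(1 - κ * ξ₁), 0, κ * u ξ₁], 0) := by
  refine hasLocalParam_bandChart hκ hε (fun ζ hζ => (hΞ ζ hζ).2.2.1)
    (fun ζ hζ => (hΞ ζ hζ).2.2.2.1) (fun ζ hζ => (hΞ ζ hζ).2.2.2.2) hΞ0 hΞ'0
    (h.pos ξ₁ ⟨h.pos_end, le_rfl⟩) h.sq_end hΞ''0 fun p hp _ => ?_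
  obtain ⟨h1, h2, -⟩ := hΞ p.2 hp
  constructor
  · rintro ⟨g0, g1, g2, g3⟩
    have : axialCoord κ p = Ξ p.2 := hfa.injOn ⟨g0, g1⟩ ⟨h1.1.le, h1.2⟩ (by rw [h2, g3])
    exact ⟨by rw [g2, this], by rw [height_eq hκ p, this]⟩
  · rintro ⟨g1, g2⟩
    have : axialCoord κ p = Ξ p.2 := by
      rw [axialCoord, g2]; linear_combination Ξ p.2 * hκ
    exact ⟨by rw [this]; exact h1.1.le, by rw [this]; exact h1.2, by rw [this, g1],
      by rw [this, h2]⟩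

/-- Existence of the rotational sphere when the prescribed function is positive at `1`. -/
theorem exists_capSphere {κ : ℝ} (hκ : κ = 1 ∨ κ = -1) {H : ℝ → ℝ} (hH : IsAdmissible κ H)
    (hH1 : 0 < H 1) :
    ∃ (S : Set Ambient) (η : Ambient → Ambient), IsEmbeddedHSurface κ H S η ∧
      IsRotational S ∧ IsSphere S ∧ ∀ p ∈ S, (η p).2 ∈ Icc (-1 : ℝ) 1 := by
  have hκ2 : κ ^ 2 = 1 := by rcases hκ with rfl | rfl <;> norm_num
  have hHc := hH.contDiffOn.continuousOn
  obtain ⟨u, R, ξ₁, h⟩ := exists_capProfile hκ hH hH1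
  obtain ⟨f, hf0, hfc, hfa, hfd, ε, hε, Ξ, Ξ', Ξ'', hΞ0, hΞ'0, hΞ''0, hΞ⟩ :=
    h.exists_height hHc hH1
  have hfpos : ∀ ξ, 0 ≤ ξ → ξ < ξ₁ → 0 < f ξ := fun ξ h0 h1 => by
    have := hfa ⟨h0, h1.le⟩ ⟨h.pos_end.le, le_rfl⟩ h1
    rwa [hf0] at this
  have hcanon : ∀ ξ, 0 ≤ ξ → ξ ≤ ξ₁ → HasLocalParam κ H (capSphere κ ξ₁ f)
      (![√(radiusSq κ ξ), 0, 1 - κ * ξ], -f ξ)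
      (![-(slopeRatio κ H u ξ * (1 - κ * ξ) * √(radiusSq κ ξ)), 0, κ * u ξ], angleFn κ u ξ) := by
    intro ξ h0 h1
    rcases h1.lt_or_eq with h2 | rfl
    · exact capSphere_hasLocalParam_meridian hκ2 h hHc hf0 hfa hfd h0 h2
    · have e := capSphere_hasLocalParam_equator hκ2 h hfa hε hΞ0 hΞ'0 hΞ''0 hΞ
      have hup := h.pos ξ ⟨h.pos_end, le_rfl⟩
      have e1 : √(radiusSq κ ξ) = u ξ := by rw [← h.sq_end, Real.sqrt_sq hup.le]
      have e2 : slopeRatio κ H u ξ * (1 - κ * ξ) * u ξ = 1 - κ * ξ := by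
        rw [slopeRatio, if_neg h.pos_end.not_ge, ← h.sq_end]
        field_simp
      rw [e1, e2, hf0, h.angleFn_end, neg_zero]
      exact e
  have hηmem : ∀ p ∈ capSphere κ ξ₁ f, (capNormal κ H u p).2 ∈ Icc (-1 : ℝ) 1 := by
    rintro p ⟨h0, h1, -, -⟩
    have g1 := angleFn_nonneg κ u (axialCoord κ p)
    have g2 := h.angleFn_le_one (h1.trans h.end_lt.le)
    simp only [capNormal]
    split_ifs <;> constructor <;> linarith
  refine ⟨capSphere κ ξ₁ f, capNormal κ H u, ⟨capSphere_subset hκ, ?_, ?_, ?_, ?_⟩,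
    isRotational_of_image fun c s hcs => capSphere_invariant hcs _,
    isSphere_capSphere hκ2 h.pos_end (fun ξ h0 h1 => h.two_sub_pos h0 (h1.trans h.end_lt.le)) hfc
      hf0 hfpos, hηmem⟩
  · have hX := continuous_axialCoord κ
    have hco : ∀ i : Fin 3, Continuous fun p : Ambient => p.1 i := fun i => by fun_prop
    rw [continuousOn_iff_continuous_domRestrict]
    have hle : ∀ p : capSphere κ ξ₁ f, axialCoord κ p < R := fun p => p.2.2.1.trans_lt h.end_lt
    have hXs : Continuous fun p : capSphere κ ξ₁ f => axialCoord κ p := hX.comp continuous_subtype_val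
    have hQ : Continuous fun p : capSphere κ ξ₁ f => slopeRatio κ H u (axialCoord κ p) :=
      continuous_iff_continuousAt.2 fun p =>
        ContinuousAt.comp (f := fun p : capSphere κ ξ₁ f => axialCoord κ p)
          (h.continuousAt_slopeRatio (hle p)) hXs.continuousAt
    have hN : Continuous fun p : capSphere κ ξ₁ f => angleFn κ u (axialCoord κ p) :=
      continuous_iff_continuousAt.2 fun p =>
        ContinuousAt.comp (f := fun p : capSphere κ ξ₁ f => axialCoord κ p)
          (h.continuousAt_angleFn (hle p)) hXs.continuousAt
    have hcs : ∀ i : Fin 3, Continuous fun p : capSphere κ ξ₁ f => p.1.1 i := fun i =>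
      (hco i).comp continuous_subtype_val
    refine Continuous.prodMk (continuous_pi fun i => ?_) ?_
    · fin_cases i
      · exact ((hQ.mul (hcs 2)).mul (hcs 0)).neg
      · exact ((hQ.mul (hcs 2)).mul (hcs 1)).neg
      · exact continuous_const.mul (h.continuous.comp hXs)
    · refine Continuous.if_le hN hN.neg (continuous_snd.comp continuous_subtype_val)
        continuous_const fun p hp => ?_
      have hp0 : p.1.2 = 0 := hp
      have h3 := p.2.2.2.2
      have h4 : axialCoord κ p = ξ₁ := by
        by_contra hne
        have := hfpos _ p.2.1 (lt_of_le_of_ne p.2.2.1 hne)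
        rw [hp0, abs_zero] at h3
        linarith
      rw [h4, h.angleFn_end, neg_zero]
  · rintro p ⟨h0, h1, h2, -⟩
    have hu := h.u_eq h0 (h1.trans h.end_lt.le)
    simp only [IsTangent, baseForm, capNormal, Matrix.cons_val_zero, Matrix.cons_val_one,
      Matrix.cons_val, hu]
    linear_combination (-(slopeRatio κ H u (axialCoord κ p) * p.1 2)) * h2 +
      slopeRatio κ H u (axialCoord κ p) * p.1 2 * radiusSq κ (axialCoord κ p) * hκ2
  · rintro p ⟨h0, h1, h2, -⟩
    have hu := h.u_eq h0 (h1.trans h.end_lt.le)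
    have hν := h.angleFn_sq h0 h1
    have h3 := height_eq hκ2 p
    have hz : (capNormal κ H u p).2 * (capNormal κ H u p).2 =
        angleFn κ u (axialCoord κ p) ^ 2 := by
      simp only [capNormal]; split_ifs <;> ring
    rw [ambientForm_apply, hz, hν]
    simp only [capNormal, Matrix.cons_val_zero, Matrix.cons_val_one, Matrix.cons_val]
    set Q := slopeRatio κ H u (axialCoord κ p)
    set ξ := axialCoord κ p
    have h4 : p.1 2 ^ 2 + κ * radiusSq κ ξ = 1 := by
      rw [h3]; unfold radiusSq; ring
    rw [hu]
    linear_combination Q ^ 2 * p.1 2 ^ 2 * h2 + Q ^ 2 * radiusSq κ ξ * h4 +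
      κ * Q ^ 2 * radiusSq κ ξ ^ 2 * hκ2
  · rintro p hp
    obtain ⟨h0, h1, h2, h3⟩ := hp
    have hσ : 0 ≤ radiusSq κ (axialCoord κ p) := by rw [← h2]; positivity
    obtain ⟨c, s, hcs, hx, hy⟩ := exists_polar (h2.trans (Real.sq_sqrt hσ).symm)
    set ξ := axialCoord κ p
    -- The sign b is the reflection taking the lower meridian point to the cap containing p. It also
    -- changes the sign of the vertical part of the normal, which H ignores by evenness.
    obtain ⟨b, hb, hbp, hbz⟩ : ∃ b : ℝ, b ^ 2 = 1 ∧ p.2 = b * -f ξ ∧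
        (capNormal κ H u p).2 = b * angleFn κ u ξ := by
      rcases le_or_gt p.2 0 with hz | hz
      · refine ⟨1, by norm_num, ?_, ?_⟩
        · rw [← h3, abs_of_nonpos hz]; ring
        · simp only [capNormal, if_pos hz, one_mul]; rfl
      · refine ⟨-1, by norm_num, ?_, ?_⟩
        · rw [← h3, abs_of_pos hz]; ring
        · simp only [capNormal, if_neg hz.not_ge, neg_mul, one_mul]; rfl
    have hang := h.angleFn_mem (h1.trans h.end_lt.le)
    have hHb : H (b * angleFn κ u ξ) = H (angleFn κ u ξ) := by
      rcases mul_self_eq_one_iff.1 ((sq b).symm.trans hb) with rfl | rfl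
      · rw [one_mul]
      · rw [neg_one_mul]; exact hH.even _ hang
    have key := (hcanon ξ h0 h1).comp_equiv (axialEquiv c s 1 b hcs (one_pow 2) hb)
      (capSphere_invariant hcs hb) (axialEquiv_form _ _ _ κ) hHb
    have e1 : axialEquiv c s 1 b hcs (one_pow 2) hb (![√(radiusSq κ ξ), 0, 1 - κ * ξ], -f ξ) = p := by
      refine Prod.ext (funext fun i => ?_) ?_
      · fin_cases i
        · simp [axialEquiv_apply, hx]
        · simp [axialEquiv_apply, hy]
        · simpa [axialEquiv_apply] using (height_eq hκ2 p).symm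
      · rw [hbp]; rfl
    have e2 : axialEquiv c s 1 b hcs (one_pow 2) hb
        (![-(slopeRatio κ H u ξ * (1 - κ * ξ) * √(radiusSq κ ξ)), 0, κ * u ξ], angleFn κ u ξ) =
        capNormal κ H u p := by
      refine Prod.ext (funext fun i => ?_) ?_
      · have h5 := height_eq hκ2 p
        fin_cases i
        · simp only [axialEquiv_apply, capNormal, hx, h5]
          simp; ring
        · simp only [axialEquiv_apply, capNormal, hy, h5]
          simp; ring
        · simp [axialEquiv_apply, capNormal, ξ]
      · rw [hbz]; rfl
    rw [e1, e2] at key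
    exact key

/-! ### The totally geodesic slice and the change of orientation -/

/-- The slice at height zero of the product of the sphere with the line. -/
def sphereSlice : Set Ambient := {p | p.1 0 ^ 2 + p.1 1 ^ 2 + p.1 2 ^ 2 = 1 ∧ p.2 = 0}

theorem sphereSlice_invariant {c s a : ℝ} (hcs : c ^ 2 + s ^ 2 = 1) (ha : a ^ 2 = 1) :
    axialEquiv c s a 1 hcs ha (one_pow 2) '' sphereSlice = sphereSlice := by
  refine axialEquiv_image hcs _ _ fun c s hcs p hp => ⟨?_, ?_⟩
  · simp only [axialEquiv_apply, Matrix.cons_val_zero, Matrix.cons_val_one, Matrix.cons_val]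
    linear_combination hp.1 + (p.1 0 ^ 2 + p.1 1 ^ 2) * hcs + p.1 2 ^ 2 * ha
  · rw [axialEquiv_apply, hp.2, mul_zero]

theorem isSphere_sphereSlice : IsSphere sphereSlice := by
  have hnorm : ∀ y : EuclideanSpace ℝ (Fin 3), y ∈ Metric.sphere (0 : EuclideanSpace ℝ (Fin 3)) 1 ↔
      y 0 ^ 2 + y 1 ^ 2 + y 2 ^ 2 = 1 := fun y => by
    rw [mem_sphere_zero_iff_norm, EuclideanSpace.norm_eq, Real.sqrt_eq_one, Fin.sum_univ_three]
    simp
  have hbij : Function.Bijective (fun y : Metric.sphere (0 : EuclideanSpace ℝ (Fin 3)) 1 =>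
      (⟨(fun i => y.1 i, 0), (hnorm y).1 y.2, rfl⟩ : sphereSlice)) := by
    constructor
    · intro y y' h
      refine Subtype.ext (PiLp.ext fun i => ?_)
      exact congrArg (fun p : sphereSlice => p.1.1 i) h
    · rintro ⟨p, hp1, hp2⟩
      refine ⟨⟨WithLp.toLp 2 p.1, (hnorm _).2 hp1⟩, Subtype.ext (Prod.ext rfl hp2.symm)⟩
  have hc : Continuous (Equiv.ofBijective _ hbij) := by
    refine Continuous.subtype_mk ?_ _
    refine Continuous.prodMk (continuous_pi fun i => ?_) continuous_const
    exact (by fun_prop : Continuous fun y : EuclideanSpace ℝ (Fin 3) => y i).comp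
      continuous_subtype_val
  exact ⟨(hc.homeoOfEquivCompactToT2).symm⟩

/-- The slice is the case of zero slope, F = 0 and Q = 0, whose mean curvature 0 equals H(1). Every
point is the image of a chart point under a rotation combined with a reflection of x₃. -/
theorem sphereSlice_hasLocalParam {H : ℝ → ℝ} (hH1 : H 1 = 0) {p : Ambient} (hp : p ∈ sphereSlice) :
    HasLocalParam 1 H sphereSlice p vertical := by
  have hφ : IsLocalParam sphereSlice {q | planeSq q < 2} (capChart 1 fun _ => 0) := by
    refine isLocalParam_capChart (O := univ) (by norm_num) (fun ξ _ h => by linarith)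
      contDiffOn_const isOpen_univ (fun q hq => ⟨⟨?_, rfl⟩, mem_univ _⟩) ?_
    · simp only [capChart, Matrix.cons_val_zero, Matrix.cons_val_one, Matrix.cons_val, mul_pow]
      rw [Real.sq_sqrt (by linarith)]
      unfold planeSq; ring
    · intro p hp _ _
      exact ⟨by linear_combination hp.1, hp.2⟩
  -- The chart misses the south pole; the reflection reduces to points with x₃ ≥ 0, which it covers.
  obtain ⟨a, ha, ha0⟩ : ∃ a : ℝ, a ^ 2 = 1 ∧ 0 ≤ a * p.1 2 := by
    rcases le_total 0 (p.1 2) with h | h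
    · exact ⟨1, by norm_num, by linarith⟩
    · exact ⟨-1, by norm_num, by linarith⟩
  set x := a * p.1 2 with hx
  have hx2 : x ^ 2 = p.1 2 ^ 2 := by rw [hx, mul_pow, ha, one_mul]
  have hx1 : x ≤ 1 := by nlinarith [hp.1, sq_nonneg (p.1 0), sq_nonneg (p.1 1)]
  have hα : √(1 - x) ^ 2 = 1 - x := Real.sq_sqrt (by linarith)
  have hr : (√(1 - x) * √(1 + x)) ^ 2 = 1 - x ^ 2 := by
    rw [mul_pow, hα, Real.sq_sqrt (by linarith)]; ring
  obtain ⟨c, s, hcs, hc, hs⟩ := exists_polar (x := p.1 0) (y := p.1 1) (r := √(1 - x) * √(1 + x))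
    (by rw [hr, hx2]; linear_combination hp.1)
  have key := hasLocalParam_capChart (κ := 1) (α := √(1 - x)) (r := 2) (F := fun _ => 0)
    (G := fun _ => 0) (G' := fun _ => 0) (Q := 0) (ν := 1) (k := 0) (l := 0) (H := H)
    (S := sphereSlice) (by norm_num) (fun ξ _ => hasDerivAt_const _ _) continuousAt_const
    (fun _ => hasDerivAt_const _ _) hφ (by rw [hα]; linarith) (by rw [hα]; linarith) one_ne_zero
    (by norm_num) (by norm_num) (by rw [hH1]; norm_num) (by norm_num) (by norm_num)
  have hn : ((![-(0 * (1 - 1 * √(1 - x) ^ 2) * (√(1 - x) * √(2 - 1 * √(1 - x) ^ 2))), 0,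
      1 * (0 * √(1 - x) ^ 2 * (2 - 1 * √(1 - x) ^ 2))], 1) : Ambient) = vertical := by
    refine Prod.ext (funext fun i => ?_) rfl
    fin_cases i <;> simp [vertical]
  rw [hn] at key
  have hA : axialEquiv c s a 1 hcs ha (one_pow 2) vertical = vertical := by
    refine Prod.ext (funext fun i => ?_) ?_
    · fin_cases i <;> simp [vertical, axialEquiv_apply]
    · simp [vertical, axialEquiv_apply]
  have key2 := key.comp_equiv (axialEquiv c s a 1 hcs ha (one_pow 2)) (sphereSlice_invariant hcs ha)
    (axialEquiv_form _ _ _ 1) (by rw [hA])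
  have hpe : axialEquiv c s a 1 hcs ha (one_pow 2) (capChart 1 (fun _ => 0) (√(1 - x), 0)) = p := by
    have e1 : 2 - (1 - x) = 1 + x := by ring
    refine Prod.ext (funext fun i => ?_) ?_
    · fin_cases i
      · simp [axialEquiv_apply, capChart, planeSq, hα, e1, hc]
      · simp [axialEquiv_apply, capChart, planeSq, hα, e1, hs]
      · simp [axialEquiv_apply, capChart, planeSq, hα]
        rw [hx]; linear_combination p.1 2 * ha
    · simp [axialEquiv_apply, capChart, hp.2]
  rwa [hA, hpe] at key2

theorem isEmbeddedHSurface_sphereSlice {H : ℝ → ℝ} (hH1 : H 1 = 0) :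
    IsEmbeddedHSurface 1 H sphereSlice fun _ => vertical where
  subset p hp := ⟨⟨by simp only [baseForm]; linear_combination hp.1, by simp⟩, mem_univ _⟩
  normal_continuous := continuousOn_const
  normal_tangent p _ := by simp [IsTangent, baseForm, vertical]
  normal_unit p _ := by simp [ambientForm_apply, vertical]
  local_param p hp := sphereSlice_hasLocalParam hH1 hp

theorem ProductSurface.IsEmbeddedHSurface.neg {κ : ℝ} {H : ℝ → ℝ} {S : Set Ambient}
    {η : Ambient → Ambient} (h : IsEmbeddedHSurface κ (fun y => -H y) S η)
    (heven : ∀ p ∈ S, H (-(η p).2) = H (η p).2) : IsEmbeddedHSurface κ H S fun p => -η p where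
  subset := h.subset
  normal_continuous := h.normal_continuous.neg
  normal_tangent p hp := by
    have := h.normal_tangent p hp
    simp only [IsTangent, baseForm, Prod.fst_neg, Pi.neg_apply] at this ⊢
    linear_combination -this
  normal_unit p hp := by
    rw [← h.normal_unit p hp]
    simp only [ambientForm_apply, Prod.fst_neg, Prod.snd_neg, Pi.neg_apply]
    ring
  local_param p hp := by
    obtain ⟨U, φ, q, hφ, hq, hqp, hn, hmc⟩ := h.local_param p hp
    refine ⟨U, φ, q, hφ, hq, hqp, fun v => by rw [ambientForm_neg_right, hn, neg_zero], ?_⟩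
    rw [ambientForm_vertical] at hmc ⊢
    rw [Prod.snd_neg, heven p hp, ← neg_eq_iff_eq_neg.2 hmc]
    simp only [meanCurvature, secondForm, ambientForm_neg_right]
    ring

theorem ProductSurface.IsAdmissible.neg {κ : ℝ} {H : ℝ → ℝ} (hH : IsAdmissible κ H) :
    IsAdmissible κ fun y => -H y where
  contDiffOn := hH.contDiffOn.neg
  even y hy := by rw [hH.even y hy]
  bound hκ y hy := by rw [abs_neg]; exact hH.bound hκ y hy

end

theorem theorem4p1 (κ : ℝ) (hκ : κ = 1 ∨ κ = -1) (H : ℝ → ℝ)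
    (hH : ProductSurface.IsAdmissible κ H) :
    ∃ (S : Set ProductSurface.Ambient) (η : ProductSurface.Ambient → ProductSurface.Ambient),
      ProductSurface.IsEmbeddedHSurface κ H S η ∧
      ProductSurface.IsRotational S ∧ ProductSurface.IsSphere S := by
  rcases lt_trichotomy (H 1) 0 with h1 | h1 | h1
  · obtain ⟨S, η, hS, hrot, hsph, hη⟩ := exists_capSphere hκ hH.neg (by linarith)
    -- Reversing the normal changes the sign of the mean curvature and of ν. Evenness of H absorbs
    -- the latter, which is why `exists_capSphere` also records that ν lies in [−1, 1].
    exact ⟨S, fun p => -η p, hS.neg fun p hp => hH.even _ (hη p hp), hrot, hsph⟩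
  · rcases hκ with rfl | rfl
    · exact ⟨sphereSlice, fun _ => ProductSurface.vertical, isEmbeddedHSurface_sphereSlice h1,
        isRotational_of_image fun c s hcs => sphereSlice_invariant hcs _, isSphere_sphereSlice⟩
    -- At y = 1 the hyperbolic bound reads 0 < 2|H(1)|, so H(1) = 0 cannot occur.
    · have := hH.bound rfl 1 ⟨by norm_num, le_rfl⟩
      norm_num [h1] at this
  · obtain ⟨S, η, hS, hrot, hsph, -⟩ := exists_capSphere hκ hH h1
    exact ⟨S, η, hS, hrot, hsph⟩
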